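/- Let $k$ be a commutative ring and $A$ a unital associative $k$-algebra. **Symmetric homology.** Let $\Delta S_+$ be the category of non-commutative sets: its objects are $[n]=\{0,\dots,n\}$ for $n\ge -1$ (so $[-1]=\emptyset$), and a morphism is a map of finite sets together with a total order on each fibre; in a composite $g\circ f$ the fibres are ordered lexicographically, first along the fibre of $g$ and then along the fibres of $f$. Let $\Delta S\subset\Delta S_+$ be the full subcategory on the non-empty sets. Let $B^{sym_+}_*A:\Delta S_+\to k\text{-Mod}$ be the functor $[n]\mapsto A^{\otimes (n+1)}$ in which a morphism $f$ sends $a_0\otimes\cdots\otimes a_n$ to the tensor whose $i$-th factor is the product of the $a_x$, $x\in f^{-1}(i)$, in the order of that fibre (the empty product is $1$), and let $B^{sym}_*A$ be its restriction to $\Delta S$. Then $$HS_n(A)=\mathrm{Tor}_n^{\Delta S}(k,B^{sym}_*A),\qquad HS_*(A)=\bigoplus_{n\ge 0}HS_n(A).$$ **The complex.** Let $\mathscr{Y}^+_*A=k[N(-\setminus\Delta S_+)]\otimes_{\Delta S_+}B^{sym_+}_*A$, where $X\setminus\Delta S_+$ is the category of objects under $X$ and $N$ is the nerve. Let $\mathcal{N}$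 denote the normalized chain complex of a simplicial $k$-module (chains modulo degenerate chains), and let $\mathscr{D}_{\mathrm{ch}}(2)=\mathcal{N}k[N(ES_2)]$, where $ES_2$ has object set $S_2$ and exactly one morphism between any two objects. **The structure map.** Let $\odot$ be the operation on $\Delta S_+$ of placing side by side. For objects $\sigma\in ES_2$, $f_1:X_1\to P_1$ and $f_2:X_2\to P_2$ put $$\mu(\sigma,f_1,f_2)=\sigma\{p_1,p_2\}\circ(f_1\odot f_2):\ X_1\odot X_2\to P_1\odot P_2,$$ where $\sigma\{p_1,p_2\}$ permutes the two blocks of sizes $p_i=|P_i|$ according to $\sigma$. Extend $\mu$ to a functor $ES_2\times (X_1\setminus\Delta S_+)\times (X_2\setminus\Delta S_+)\to (X_1\odot X_2)\setminus\Delta S_+$ by sending a morphism $(\sigma\to\tau,\ g_1:P_1\to Q_1,\ g_2:P_2\to Q_2)$ to $\tau\{q_1,q_2\}\circ(g_1\odot g_2)\circ\sigma\{p_1,p_2\}^{-1}$. Together with concatenation of tensors, $\mu$ induces a map of simplicial $k$-modules $k[N(ES_2)]\,\widehat\otimes\,\mathscr{Y}^+_*A\,\widehat\otimes\,\mathscr{Y}^+_*A\to\mathscr{Y}^+_*A$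 (degreewise tensor product). Its normalization, precomposed with the iterated Eilenberg–Zilber shuffle map, is the arity-two $E_\infty$-structure map $$\widetilde\chi:\ \mathscr{D}_{\mathrm{ch}}(2)\otimes\mathcal{N}\mathscr{Y}^+_*A\otimes\mathcal{N}\mathscr{Y}^+_*A\longrightarrow\mathcal{N}\mathscr{Y}^+_*A .$$ **Theorem.** There are canonical isomorphisms $HS_n(A)\cong H_n(\mathcal{N}\mathscr{Y}^+_*A)$ for all $n\ge0$: for every projective resolution $P\to k$ of right $\Delta S$-modules and every chain map $P\to k[N(-\setminus\Delta S)]$ over $k$ (and such a pair exists), they are the maps induced by that chain map and the inclusion $\Delta S\subset\Delta S_+$. Under these isomorphisms $HS_*(A)$ carries a $k$-bilinear Pontryagin product with the following properties. 1. For every $0$-chain $c\in\mathscr{D}_{\mathrm{ch}}(2)$ representing the generator $1\in H_0(\mathscr{D}_{\mathrm{ch}}(2))=k$ and all cycles $x$, $y$ of $\mathcal{N}\mathscr{Y}^+_*A$ of degrees $p$, $q$, the chain $\widetilde\chi(c\otimes x\otimes y)$ is a cycle of degree $p+q$, and $$[x]\cdot[y]=[\widetilde\chi(c\otimes x\otimes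 y)].$$ In particular this class depends neither on $c$ nor on the choice of cycles representing $[x]$ and $[y]$. 2. The product makes $HS_*(A)$ a graded $k$-algebra that is associative, unital with unit in $HS_0(A)$, and graded-commutative: $a\cdot b=(-1)^{pq}\,b\cdot a$ for $a\in HS_p(A)$, $b\in HS_q(A)$. -/

import Mathlib

open CategoryTheory Opposite
namespace SymHom

/-- Objects of the category `F(as)` of non-commutative sets, that is of `ΔS₊`: the object `⟨n⟩` is the
finite set with `n` elements, written `[n - 1]` in `ΔS₊`. -/
structure FAs : Type where
  n : ℕ

namespace FAs

/-- A morphism of non-commutative sets: a map of finite sets (`toFun`) with a total ordering of each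
fibre; the ordered fibre over `i` is the repetition-free list `fib i` of the preimages of `i`. -/
@[ext]
structure Hom (X Y : FAs) : Type where
  toFun : Fin X.n → Fin Y.n
  fib : Fin Y.n → List (Fin X.n)
  nodup : ∀ i, (fib i).Nodup
  mem_fib : ∀ i x, x ∈ fib i ↔ toFun x = i

theorem Hom.ext_fib {X Y : FAs} {f g : Hom X Y} (h : ∀ i, f.fib i = g.fib i) : f = g := by
  have hf : f.fib = g.fib := funext h
  refine Hom.ext (funext fun x => ?_) hf
  exact ((g.mem_fib (f.toFun x) x).1 (by rw [← hf]; exact (f.mem_fib _ x).2 rfl)).symm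

/-- Composition of non-commutative sets: the fibre of `g ∘ f` over `i` is ordered lexicographically,
first along the fibre of `g` and then along the fibres of `f`. -/
instance : Category FAs where
  Hom := Hom
  id X := ⟨fun x => x, fun i => [i], by simp, by simp⟩
  comp {X Y Z} f g :=
    { toFun := fun x => g.toFun (f.toFun x)
      fib := fun i => (g.fib i).flatMap f.fib
      nodup := fun i => by
        rw [List.nodup_flatMap]
        refine ⟨fun j _ => f.nodup j, (g.nodup i).imp fun {a b} hab => ?_⟩
        intro x hx hx'
        exact hab (((f.mem_fib a x).1 hx).symm.trans ((f.mem_fib b x).1 hx'))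
      mem_fib := fun i x => by simp [List.mem_flatMap, f.mem_fib, g.mem_fib] }
  id_comp f := Hom.ext_fib fun i => by simp
  comp_id f := Hom.ext_fib fun i => by simp
  assoc f g h := Hom.ext_fib fun i => by simp [List.flatMap_assoc]

theorem hom_ext {X Y : FAs} {f g : X ⟶ Y} (h : ∀ i, f.fib i = g.fib i) : f = g := Hom.ext_fib h

@[simp] theorem id_fib (X : FAs) (i : Fin X.n) : Hom.fib (𝟙 X) i = [i] := rfl

@[simp] theorem comp_fib {X Y Z : FAs} (f : X ⟶ Y) (g : Y ⟶ Z) (i : Fin Z.n) :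
    Hom.fib (f ≫ g) i = (Hom.fib g i).flatMap (Hom.fib f) := rfl

/-- The permutative product `⊙` on objects. -/
def add (X Y : FAs) : FAs := ⟨X.n + Y.n⟩


/-- The first block of `X ⊙ Y`. -/
def inl (X Y : FAs) (x : Fin X.n) : Fin (add X Y).n := Fin.castAdd Y.n x

/-- The second block of `X ⊙ Y`. -/
def inr (X Y : FAs) (y : Fin Y.n) : Fin (add X Y).n := Fin.natAdd X.n y

def sumEquiv (X Y : FAs) : Fin X.n ⊕ Fin Y.n ≃ Fin (add X Y).n := finSumFinEquiv

theorem sumEquiv_symm_inl (X Y : FAs) (x : Fin X.n) : (sumEquiv X Y).symm (inl X Y x) = .inl x :=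
  (sumEquiv X Y).symm_apply_eq.2 rfl

theorem sumEquiv_symm_inr (X Y : FAs) (y : Fin Y.n) : (sumEquiv X Y).symm (inr X Y y) = .inr y :=
  (sumEquiv X Y).symm_apply_eq.2 rfl

theorem inl_injective (X Y : FAs) : Function.Injective (inl X Y) := Fin.castAdd_injective _ _

theorem inr_injective (X Y : FAs) : Function.Injective (inr X Y) := Fin.natAdd_injective _ _

theorem inl_ne_inr (X Y : FAs) (x : Fin X.n) (y : Fin Y.n) : inl X Y x ≠ inr X Y y := fun h => by
  have := congrArg (sumEquiv X Y).symm h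
  simp [sumEquiv_symm_inl, sumEquiv_symm_inr] at this

theorem add_cases {X Y : FAs} {P : Fin (add X Y).n → Prop} (hl : ∀ x, P (inl X Y x))
    (hr : ∀ y, P (inr X Y y)) (i : Fin (add X Y).n) : P i := by
  obtain ⟨i | i, rfl⟩ := (sumEquiv X Y).surjective i
  exacts [hl i, hr i]

def addFun {X X' Y Y' : FAs} (f : X ⟶ X') (g : Y ⟶ Y') (i : Fin (add X Y).n) :
    Fin (add X' Y').n :=
  match (sumEquiv X Y).symm i with
  | .inl x => inl X' Y' (Hom.toFun f x)
  | .inr y => inr X' Y' (Hom.toFun g y)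

def addFib {X X' Y Y' : FAs} (f : X ⟶ X') (g : Y ⟶ Y') (i : Fin (add X' Y').n) :
    List (Fin (add X Y).n) :=
  match (sumEquiv X' Y').symm i with
  | .inl x => (Hom.fib f x).map (inl X Y)
  | .inr y => (Hom.fib g y).map (inr X Y)

section
variable {X X' X'' Y Y' Y'' : FAs} (f : X ⟶ X') (g : Y ⟶ Y') (f' : X' ⟶ X'') (g' : Y' ⟶ Y'')

theorem addFun_inl (x : Fin X.n) : addFun f g (inl X Y x) = inl X' Y' (Hom.toFun f x) := by
  rw [addFun, sumEquiv_symm_inl]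

theorem addFun_inr (y : Fin Y.n) : addFun f g (inr X Y y) = inr X' Y' (Hom.toFun g y) := by
  rw [addFun, sumEquiv_symm_inr]

theorem addFib_inl (x : Fin X'.n) : addFib f g (inl X' Y' x) = (Hom.fib f x).map (inl X Y) := by
  rw [addFib, sumEquiv_symm_inl]

theorem addFib_inr (y : Fin Y'.n) : addFib f g (inr X' Y' y) = (Hom.fib g y).map (inr X Y) := by
  rw [addFib, sumEquiv_symm_inr]

/-- The permutative product `⊙` on morphisms (placing side by side). -/
def addHom : add X Y ⟶ add X' Y' :=
  show Hom _ _ from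
  { toFun := addFun f g
    fib := addFib f g
    nodup := add_cases
      (fun i => by rw [addFib_inl]; exact (Hom.nodup f i).map (inl_injective X Y))
      (fun i => by rw [addFib_inr]; exact (Hom.nodup g i).map (inr_injective X Y))
    mem_fib := by
      refine add_cases (fun i => add_cases (fun x => ?_) fun x => ?_)
        (fun i => add_cases (fun x => ?_) fun x => ?_)
      · rw [addFib_inl, addFun_inl, List.mem_map_of_injective (inl_injective X Y), Hom.mem_fib,
          (inl_injective X' Y').eq_iff]
      · rw [addFib_inl, addFun_inr]
        simp [inl_ne_inr, (inl_ne_inr _ _ _ _).symm]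
      · rw [addFib_inr, addFun_inl]
        simp [inl_ne_inr, (inl_ne_inr _ _ _ _).symm]
      · rw [addFib_inr, addFun_inr, List.mem_map_of_injective (inr_injective X Y), Hom.mem_fib,
          (inr_injective X' Y').eq_iff] }

theorem addHom_fib_inl (i : Fin X'.n) :
    Hom.fib (addHom f g) (inl X' Y' i) = (Hom.fib f i).map (inl X Y) := addFib_inl f g i

theorem addHom_fib_inr (i : Fin Y'.n) :
    Hom.fib (addHom f g) (inr X' Y' i) = (Hom.fib g i).map (inr X Y) := addFib_inr f g i

theorem addHom_id (X Y : FAs) : addHom (𝟙 X) (𝟙 Y) = 𝟙 (add X Y) :=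
  hom_ext <| add_cases (fun i => by simp [addHom_fib_inl]) (fun i => by simp [addHom_fib_inr])

theorem addHom_comp : addHom (f ≫ f') (g ≫ g') = addHom f g ≫ addHom f' g' :=
  hom_ext <| add_cases
    (fun i => by
      simp only [addHom_fib_inl, comp_fib, List.map_flatMap, List.flatMap_map])
    (fun i => by
      simp only [addHom_fib_inr, comp_fib, List.map_flatMap, List.flatMap_map])

end

/-- A permutation as an automorphism in `F(as)`. -/
def permHom {X : FAs} (e : Equiv.Perm (Fin X.n)) : X ⟶ X :=
  show Hom _ _ from
  { toFun := e
    fib := fun i => [e.symm i]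
    nodup := by simp
    mem_fib := fun i x => by simp [Equiv.eq_symm_apply] }

def permIso {X : FAs} (e : Equiv.Perm (Fin X.n)) : X ≅ X where
  hom := permHom e
  inv := permHom e.symm
  hom_inv_id := hom_ext fun i => by simp [permHom]
  inv_hom_id := hom_ext fun i => by simp [permHom]

/-- The block permutation `σ{p, q}` of `p + q` letters for `σ ∈ S₂`: the identity, or the exchange of
the initial block of size `p` with the final block of size `q`. -/
def blockPerm (σ : Equiv.Perm (Fin 2)) (p q : ℕ) : Equiv.Perm (Fin (p + q)) :=
  if σ = 1 then 1 else finAddFlip.trans (finCongr (Nat.add_comm q p))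

end FAs

section Bsym
open scoped TensorProduct
universe u
variable (k : Type u) [CommRing k] (A : Type u) [Ring A] [Algebra k A]

theorem prod_update_map {ι : Type*} [DecidableEq ι] {M : Type*} [Monoid M] (l : List ι)
    (hl : l.Nodup) (a : ι → M) (x : ι) (hx : x ∈ l) :
    ∃ P Q : M, ∀ v, (l.map (Function.update a x v)).prod = P * v * Q := by
  obtain ⟨s, t, rfl⟩ := List.append_of_mem hx
  refine ⟨(s.map a).prod, (t.map a).prod, fun v => ?_⟩
  have hs : x ∉ s := by
    intro h; exact (List.nodup_append.1 hl).2.2 x h x (by simp) rfl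
  have ht : x ∉ t := by
    have := (List.nodup_append.1 hl).2.1; simp at this; exact this.1
  have h1 : s.map (Function.update a x v) = s.map a :=
    List.map_congr_left fun y hy => Function.update_of_ne (by rintro rfl; exact hs hy) _ _
  have h2 : t.map (Function.update a x v) = t.map a :=
    List.map_congr_left fun y hy => Function.update_of_ne (by rintro rfl; exact ht hy) _ _
  simp [h1, h2, mul_assoc]

theorem fibProd_update {X Y : FAs} (f : X ⟶ Y) [DecidableEq (Fin X.n)] (a : Fin X.n → A)
    (x : Fin X.n) :
    ∃ P Q : A, ∀ v, (fun i => ((FAs.Hom.fib f i).map (Function.update a x v)).prod) =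
      Function.update (fun i => ((FAs.Hom.fib f i).map a).prod) (FAs.Hom.toFun f x)
        (P * v * Q) := by
  obtain ⟨P, Q, h⟩ := prod_update_map (FAs.Hom.fib f (FAs.Hom.toFun f x)) (FAs.Hom.nodup f _) a x
    ((FAs.Hom.mem_fib f _ _).2 rfl)
  refine ⟨P, Q, fun v => funext fun i => ?_⟩
  by_cases hi : i = FAs.Hom.toFun f x
  · subst hi; rw [Function.update_self]; exact h v
  · rw [Function.update_of_ne hi]
    congr 1
    refine List.map_congr_left fun y hy => Function.update_of_ne ?_ _ _
    rintro rfl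
    exact hi ((FAs.Hom.mem_fib f _ _).1 hy).symm

noncomputable def actMultilinear {X Y : FAs} (f : X ⟶ Y) :
    MultilinearMap k (fun _ : Fin X.n => A) (⨂[k] _ : Fin Y.n, A) where
  toFun a := PiTensorProduct.tprod k fun i => ((FAs.Hom.fib f i).map a).prod
  map_update_add' a x v w := by
    obtain ⟨P, Q, h⟩ := fibProd_update A f a x
    rw [h, h, h, mul_add, add_mul, MultilinearMap.map_update_add]
  map_update_smul' a x c v := by
    obtain ⟨P, Q, h⟩ := fibProd_update A f a x
    rw [h, h, mul_smul_comm, smul_mul_assoc, MultilinearMap.map_update_smul]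

/-- The action of a morphism `f` of `F(as)` on tensors: the `i`-th factor of `f_* (a₁ ⊗ ⋯ ⊗ aₘ)` is the
product of the `a_x` for `x` in the fibre over `i`, in the order of that fibre. -/
noncomputable def act {X Y : FAs} (f : X ⟶ Y) :
    (⨂[k] _ : Fin X.n, A) →ₗ[k] ⨂[k] _ : Fin Y.n, A :=
  PiTensorProduct.lift (actMultilinear k A f)

@[simp] theorem act_tprod {X Y : FAs} (f : X ⟶ Y) (a : Fin X.n → A) :
    act k A f (PiTensorProduct.tprod k a) =
      PiTensorProduct.tprod k fun i => ((FAs.Hom.fib f i).map a).prod :=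
  PiTensorProduct.lift.tprod _

theorem prod_flatMap' {ι M : Type*} [Monoid M] (l : List ι) (f : ι → List M) :
    (l.flatMap f).prod = (l.map fun i => (f i).prod).prod := by
  induction l with
  | nil => rfl
  | cons a l ih => simp [ih]

/-- The functor `B^{sym₊}_* A` on `ΔS₊`, `[n - 1] ↦ A^{⊗ n}`. -/
noncomputable def Bplus : FAs ⥤ ModuleCat.{u} k where
  obj X := ModuleCat.of k (⨂[k] _ : Fin X.n, A)
  map f := ModuleCat.ofHom (act k A f)
  map_id X := by
    refine ModuleCat.hom_ext (PiTensorProduct.ext (MultilinearMap.ext fun a => ?_))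
    simp
  map_comp f g := by
    refine ModuleCat.hom_ext (PiTensorProduct.ext (MultilinearMap.ext fun a => ?_))
    simp [List.map_flatMap, prod_flatMap']

/-- Juxtaposition `A^{⊗ m} × A^{⊗ n} → A^{⊗ (m + n)}`. -/
noncomputable def juxt (X Y : FAs) :
    (⨂[k] _ : Fin X.n, A) →ₗ[k] (⨂[k] _ : Fin Y.n, A) →ₗ[k] ⨂[k] _ : Fin (FAs.add X Y).n, A :=
  TensorProduct.curry ((PiTensorProduct.reindex k (fun _ => A) (FAs.sumEquiv X Y)).toLinearMap ∘ₗ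
    (PiTensorProduct.tmulEquiv k A).toLinearMap)

theorem juxt_tprod (X Y : FAs) (a : Fin X.n → A) (b : Fin Y.n → A) :
    juxt k A X Y (PiTensorProduct.tprod k a) (PiTensorProduct.tprod k b) =
      PiTensorProduct.tprod k fun i => Sum.elim a b ((FAs.sumEquiv X Y).symm i) := by
  simp [juxt, PiTensorProduct.tmulEquiv_apply, PiTensorProduct.reindex_tprod]

theorem juxt_act {X X' Y Y' : FAs} (f : X ⟶ X') (g : Y ⟶ Y') (v : ⨂[k] _ : Fin X.n, A)
    (w : ⨂[k] _ : Fin Y.n, A) :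
    juxt k A X' Y' (act k A f v) (act k A g w) =
      act k A (FAs.addHom f g) (juxt k A X Y v w) := by
  have : (juxt k A X' Y').compl₁₂ (act k A f) (act k A g) =
      (juxt k A X Y).compr₂ (act k A (FAs.addHom f g)) := by
    refine PiTensorProduct.ext (MultilinearMap.ext fun a => ?_)
    refine PiTensorProduct.ext (MultilinearMap.ext fun b => ?_)
    simp only [LinearMap.compMultilinearMap_apply, LinearMap.compl₁₂_apply, LinearMap.compr₂_apply,
      act_tprod, juxt_tprod]
    congr 1
    funext i
    revert i
    refine FAs.add_cases (fun i => ?_) (fun i => ?_)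
    · rw [FAs.sumEquiv_symm_inl, FAs.addHom_fib_inl]
      simp [Function.comp_def, FAs.sumEquiv_symm_inl]
    · rw [FAs.sumEquiv_symm_inr, FAs.addHom_fib_inr]
      simp [Function.comp_def, FAs.sumEquiv_symm_inr]
  exact LinearMap.congr_fun₂ this v w

end Bsym

section TensorOver
open scoped TensorProduct
universe u
variable (k : Type u) [CommRing k] {C : Type} [SmallCategory C]

open Classical in
/-- The relations `f^* g ⊗ b = g ⊗ f_* b` defining the tensor product of functors. -/
noncomputable def tensorRel (G : Cᵒᵖ ⥤ ModuleCat.{u} k) (F : C ⥤ ModuleCat.{u} k) :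
    Submodule k (DirectSum C fun X => (G.obj (op X) : Type u) ⊗[k] (F.obj X : Type u)) :=
  Submodule.span k {z | ∃ (X Y : C) (f : X ⟶ Y) (g : G.obj (op Y)) (b : F.obj X),
    z = DirectSum.lof k C (fun X => (G.obj (op X) : Type u) ⊗[k] (F.obj X : Type u)) X
          (G.map f.op g ⊗ₜ b) -
        DirectSum.lof k C (fun X => (G.obj (op X) : Type u) ⊗[k] (F.obj X : Type u)) Y
          (g ⊗ₜ F.map f b)}

/-- The tensor product `G ⊗_C F` of a right module `G` and a left module `F` over a small category `C`. -/
abbrev TensorOver (G : Cᵒᵖ ⥤ ModuleCat.{u} k) (F : C ⥤ ModuleCat.{u} k) : Type u :=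
  (DirectSum C fun X => (G.obj (op X) : Type u) ⊗[k] (F.obj X : Type u)) ⧸ tensorRel k G F

namespace TensorOver
variable {k} {G : Cᵒᵖ ⥤ ModuleCat.{u} k} {F : C ⥤ ModuleCat.{u} k}

open Classical in
/-- The class of `g ⊗ b`. -/
noncomputable def mk (G : Cᵒᵖ ⥤ ModuleCat.{u} k) (F : C ⥤ ModuleCat.{u} k) (X : C) :
    (G.obj (op X) : Type u) →ₗ[k] (F.obj X : Type u) →ₗ[k] TensorOver k G F :=
  TensorProduct.curry ((tensorRel k G F).mkQ ∘ₗ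
    DirectSum.lof k C (fun X => (G.obj (op X) : Type u) ⊗[k] (F.obj X : Type u)) X)

theorem mk_balanced {X Y : C} (f : X ⟶ Y) (g : G.obj (op Y)) (b : F.obj X) :
    mk G F X (G.map f.op g) b = mk G F Y g (F.map f b) :=
  (Submodule.Quotient.eq _).2 (Submodule.subset_span ⟨X, Y, f, g, b, rfl⟩)

open Classical in
noncomputable def lift {M : Type u} [AddCommGroup M] [Module k M]
    (φ : ∀ X : C, (G.obj (op X) : Type u) →ₗ[k] (F.obj X : Type u) →ₗ[k] M)
    (h : ∀ (X Y : C) (f : X ⟶ Y) (g : G.obj (op Y)) (b : F.obj X),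
      φ X (G.map f.op g) b = φ Y g (F.map f b)) : TensorOver k G F →ₗ[k] M :=
  (tensorRel k G F).liftQ (DirectSum.toModule k C M fun X => TensorProduct.lift (φ X)) <| by
    refine Submodule.span_le.2 ?_
    rintro _ ⟨X, Y, f, g, b, rfl⟩
    simp [h]

@[simp] theorem lift_mk {M : Type u} [AddCommGroup M] [Module k M]
    (φ : ∀ X : C, (G.obj (op X) : Type u) →ₗ[k] (F.obj X : Type u) →ₗ[k] M) (h) (X : C)
    (g : G.obj (op X)) (b : F.obj X) : lift φ h (mk G F X g b) = φ X g b := by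
  classical
  exact (Submodule.liftQ_apply _ _ _).trans
    ((DirectSum.toModule_lof k X _).trans (TensorProduct.lift.tmul _ _))

theorem hom_ext {M : Type u} [AddCommGroup M] [Module k M] {α β : TensorOver k G F →ₗ[k] M}
    (h : ∀ X g b, α (mk G F X g b) = β (mk G F X g b)) : α = β := by
  classical
  refine Submodule.linearMap_qext _ (DirectSum.linearMap_ext _ fun X => ?_)
  refine TensorProduct.ext' fun g b => ?_
  exact h X g b

noncomputable def map {G' : Cᵒᵖ ⥤ ModuleCat.{u} k} (α : G ⟶ G') (F : C ⥤ ModuleCat.{u} k) :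
    TensorOver k G F →ₗ[k] TensorOver k G' F :=
  lift (fun X => (mk G' F X).comp (α.app (op X)).hom) fun X Y f g b => by
    have := congrArg (fun t => t.hom g) (α.naturality f.op)
    simp only [ModuleCat.hom_comp, LinearMap.comp_apply] at this
    simp only [LinearMap.comp_apply]
    rw [← mk_balanced]
    exact congrArg (fun t => mk G' F X t b) this

@[simp] theorem map_mk {G' : Cᵒᵖ ⥤ ModuleCat.{u} k} (α : G ⟶ G') (X : C) (g : G.obj (op X))
    (b : F.obj X) : map α F (mk G F X g b) = mk G' F X (α.app (op X) g) b := lift_mk _ _ _ _ _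

end TensorOver

/-- The functor `- ⊗_C F` on right `C`-modules. -/
noncomputable def tensorFunctor (F : C ⥤ ModuleCat.{u} k) :
    (Cᵒᵖ ⥤ ModuleCat.{u} k) ⥤ ModuleCat.{u} k where
  obj G := ModuleCat.of k (TensorOver k G F)
  map α := ModuleCat.ofHom (TensorOver.map α F)
  map_id G := ModuleCat.hom_ext <| TensorOver.hom_ext fun X g b => by simp
  map_comp α β := ModuleCat.hom_ext <| TensorOver.hom_ext fun X g b => by simp

instance (F : C ⥤ ModuleCat.{u} k) : (tensorFunctor k F).Additive where
  map_add {G G' α β} := ModuleCat.hom_ext <| TensorOver.hom_ext fun X g b => by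
    change TensorOver.map (α + β) F _ = TensorOver.map α F _ + TensorOver.map β F _
    rw [TensorOver.map_mk, TensorOver.map_mk, TensorOver.map_mk, NatTrans.app_add,
      ← LinearMap.add_apply, ← map_add]
    rfl

end TensorOver

section Simplicial
open scoped TensorProduct Simplicial
universe u
variable (k : Type u) [CommRing k]

/-- The free `k`-module functor. -/
noncomputable def linearize : Type ⥤ ModuleCat.{u} k where
  obj S := ModuleCat.of k (S →₀ k)
  map f := ModuleCat.ofHom (Finsupp.lmapDomain k k f)
  map_id S := ModuleCat.hom_ext <| Finsupp.lhom_ext' fun x => LinearMap.ext_ring (by simp)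
  map_comp f g := ModuleCat.hom_ext <| Finsupp.lhom_ext' fun x => LinearMap.ext_ring (by simp)

/-- The simplicial right `C`-module `k[N(- ∖ C)]`, where `X ∖ C` is the under-category. -/
noncomputable def stdRes (C : Type) [SmallCategory C] :
    SimplicialObject (Cᵒᵖ ⥤ ModuleCat.{u} k) :=
  ((Under.mapFunctor C ⋙ nerveFunctor.{0, 0}) ⋙
    (Functor.whiskeringRight SimplexCategoryᵒᵖ Type (ModuleCat.{u} k)).obj (linearize k)).flip

/-- The simplicial `k`-module `k[N(- ∖ C)] ⊗_C F`. -/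
noncomputable def stdBar {C : Type} [SmallCategory C] (F : C ⥤ ModuleCat.{u} k) :
    SimplicialObject (ModuleCat.{u} k) :=
  ((SimplicialObject.whiskering _ _).obj (tensorFunctor k F)).obj (stdRes k C)



/-- The sum of coefficients `k[S] → k`. -/
noncomputable def coeffSum (S : Type) : (linearize k).obj S ⟶ ModuleCat.of k k :=
  ModuleCat.ofHom (Finsupp.lsum k fun _ => LinearMap.id)

theorem linearize_map_coeffSum {S T : Type} (f : S ⟶ T) :
    (linearize k).map f ≫ coeffSum k T = coeffSum k S := by
  refine ModuleCat.hom_ext <| Finsupp.lhom_ext' fun x => LinearMap.ext_ring ?_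
  simp [linearize, coeffSum]

/-- The augmentation of `k[N(- ∖ C)]` to the constant module. -/
noncomputable def stdAug (C : Type) [SmallCategory C] :
    (stdRes k C).obj (op ⦋0⦌) ⟶ (Functor.const Cᵒᵖ).obj (ModuleCat.of k k) where
  app X := coeffSum k ((nerve (Under X.unop)).obj (op ⦋0⦌))
  naturality _ _ _ := (linearize_map_coeffSum k _).trans (Category.comp_id _).symm

/-- Modules over a small category have enough projectives. -/
instance {C : Type} [SmallCategory C] : EnoughProjectives (Cᵒᵖ ⥤ ModuleCat.{u} k) where
  presentation G := by
    let P (X : Cᵒᵖ) : Cᵒᵖ ⥤ ModuleCat.{u} k :=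
      (evaluationLeftAdjoint (ModuleCat.{u} k) X).obj (Projective.over (G.obj X))
    let φ (X : Cᵒᵖ) : P X ⟶ G :=
      ((evaluationAdjunctionRight (ModuleCat.{u} k) X).homEquiv _ _).symm (Projective.π (G.obj X))
    have hP (X : Cᵒᵖ) : Projective (P X) :=
      (evaluationAdjunctionRight (ModuleCat.{u} k) X).map_projective _ inferInstance
    have : Epi (Limits.Sigma.desc φ) := by
      rw [NatTrans.epi_iff_epi_app]
      intro X
      let u := (evaluationAdjunctionRight (ModuleCat.{u} k) X).unit.app (Projective.over (G.obj X))
      let v := (Limits.Sigma.ι P X).app X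
      have h : u ≫ v ≫ (Limits.Sigma.desc φ).app X = Projective.π (G.obj X) := by
        rw [← NatTrans.comp_app, Limits.Sigma.ι_desc]
        exact ((evaluationAdjunctionRight (ModuleCat.{u} k) X).homEquiv_unit
          (f := φ X)).symm.trans (Equiv.apply_symm_apply _ _)
      have h' : (u ≫ v) ≫ (Limits.Sigma.desc φ).app X = Projective.π (G.obj X) := by
        rw [Category.assoc, h]
      have : Epi ((u ≫ v) ≫ (Limits.Sigma.desc φ).app X) := by
        rw [h']; infer_instance
      exact epi_of_epi (u ≫ v) _
    have hQ : Projective (∐ P) := ⟨fun f e _ =>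
      ⟨Limits.Sigma.desc fun X => Projective.factorThru (Limits.Sigma.ι P X ≫ f) e,
        Limits.Sigma.hom_ext _ _ fun X => by simp⟩⟩
    exact ⟨{ p := ∐ P, f := Limits.Sigma.desc φ }⟩

/-- The simplicial module `𝒟_sm(m) = k[N(E S_m)]`, where the category `E S_m` has object set `S_m` and
exactly one morphism between any two objects. -/
noncomputable def Dsm (m : ℕ) : SimplicialObject (ModuleCat.{u} k) :=
  nerve (Codiscrete (Equiv.Perm (Fin m))) ⋙ linearize k

variable {k}

/-- The degreewise tensor product of simplicial `k`-modules. -/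
noncomputable def hat (X Y : SimplicialObject (ModuleCat.{u} k)) :
    SimplicialObject (ModuleCat.{u} k) where
  obj n := ModuleCat.of k ((X.obj n : Type u) ⊗[k] (Y.obj n : Type u))
  map f := ModuleCat.ofHom (TensorProduct.map (X.map f).hom (Y.map f).hom)
  map_id n := ModuleCat.hom_ext <| TensorProduct.ext' fun x y => by simp
  map_comp f g := ModuleCat.hom_ext <| TensorProduct.ext' fun x y => by simp

/-- The degenerate `n`-chains: the span of the images of the degeneracy maps. -/
noncomputable def degen (X : SimplicialObject (ModuleCat.{u} k)) (n : ℕ) :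
    Submodule k (X.obj (op ⦋n⦌)) :=
  match n with
  | 0 => ⊥
  | n + 1 => ⨆ i : Fin (n + 1), LinearMap.range (X.σ i).hom

theorem degen_map {X Y : SimplicialObject (ModuleCat.{u} k)} (f : X ⟶ Y) (n : ℕ) :
    degen X n ≤ (degen Y n).comap (f.app (op ⦋n⦌)).hom := by
  cases n with
  | zero => exact bot_le (α := Submodule k (X.obj (op ⦋0⦌)))
  | succ n =>
    refine iSup_le fun i => ?_
    rintro _ ⟨x, rfl⟩
    refine Submodule.mem_iSup_of_mem i ⟨f.app _ x, ?_⟩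
    exact (congrArg (fun t => t.hom x) (f.naturality (SimplexCategory.σ i).op)).symm

noncomputable def hatMk (X Y : SimplicialObject (ModuleCat.{u} k)) (n : SimplexCategoryᵒᵖ) :
    (X.obj n : Type u) →ₗ[k] (Y.obj n : Type u) →ₗ[k] ((hat X Y).obj n : Type u) :=
  TensorProduct.mk k (X.obj n) (Y.obj n)

theorem hat_map_hatMk (X Y : SimplicialObject (ModuleCat.{u} k)) {n m : SimplexCategoryᵒᵖ}
    (f : n ⟶ m) (x : X.obj n) (y : Y.obj n) :
    (hat X Y).map f (hatMk X Y n x y) = hatMk X Y m (X.map f x) (Y.map f y) := rfl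

theorem factor_of_eq {n m : ℕ} (θ : ⦋n + 1⦌ ⟶ ⦋m⦌) (j : Fin (n + 1))
    (h : θ j.castSucc = θ j.succ) :
    θ = SimplexCategory.σ j ≫ SimplexCategory.δ j.succ ≫ θ := by
  ext i : 3
  change θ i = θ (j.succ.succAbove (j.predAbove i))
  by_cases hi : i = j.succ
  · subst hi
    rw [Fin.predAbove_succ_self, Fin.succAbove_of_castSucc_lt _ _ (by simp [Fin.lt_def]), h]
  · congr 1
    have : i.val ≠ j.val + 1 := fun h' => hi (Fin.ext h')
    clear h hi
    rw [Fin.ext_iff, Fin.succAbove, Fin.predAbove]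
    simp only [Fin.lt_def, Fin.val_castSucc, Fin.val_succ]
    split_ifs <;> simp_all only [Fin.val_castSucc, Fin.val_succ, Fin.val_pred, Fin.coe_castPred] <;>
      omega

theorem map_eq_σ_of_eq (X : SimplicialObject (ModuleCat.{u} k)) {n m : ℕ}
    (θ : ⦋n + 1⦌ ⟶ ⦋m⦌) (j : Fin (n + 1)) (h : θ j.castSucc = θ j.succ)
    (x : X.obj (op ⦋m⦌)) :
    X.map θ.op x = X.map (SimplexCategory.σ j).op
      (X.map (SimplexCategory.δ j.succ).op (X.map θ.op x)) := by
  conv_lhs => rw [factor_of_eq θ j h]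
  simp

theorem exists_eq_succ {n m : ℕ} (θ : ⦋n + 1⦌ ⟶ ⦋m⦌) (h : ¬ Function.Injective θ) :
    ∃ j : Fin (n + 1), θ j.castSucc = θ j.succ := by
  by_contra! H
  refine h (StrictMono.injective (Fin.strictMono_iff_lt_succ.2 fun j => lt_of_le_of_ne ?_ (H j)))
  exact θ.toOrderHom.monotone (Fin.castSucc_lt_succ).le

theorem σ_mem_degen (X : SimplicialObject (ModuleCat.{u} k)) {n : ℕ} (j : Fin (n + 1))
    (x : X.obj (op ⦋n⦌)) : X.map (SimplexCategory.σ j).op x ∈ degen X (n + 1) :=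
  (le_iSup (fun i : Fin (n + 1) => LinearMap.range (X.σ i).hom) j) ⟨x, rfl⟩

theorem map_mem_degen (X : SimplicialObject (ModuleCat.{u} k)) {n m : ℕ}
    (θ : ⦋n⦌ ⟶ ⦋m⦌) (h : ¬ Function.Injective θ) (x : X.obj (op ⦋m⦌)) :
    X.map θ.op x ∈ degen X n := by
  cases n with
  | zero => exact absurd (fun a b _ => Subsingleton.elim (α := Fin 1) a b) h
  | succ n =>
    obtain ⟨j, hj⟩ := exists_eq_succ θ h
    rw [map_eq_σ_of_eq X θ j hj]
    exact σ_mem_degen X j _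

theorem degen_d (X : SimplicialObject (ModuleCat.{u} k)) (i j : ℕ) :
    degen X i ≤ (degen X j).comap
      (((AlgebraicTopology.alternatingFaceMapComplex _).obj X).d i j).hom := by
  by_cases hij : j + 1 = i
  swap
  · intro x _
    rw [Submodule.mem_comap, HomologicalComplex.shape _ i j hij]
    exact zero_mem _
  subst hij
  refine iSup_le fun i => ?_
  rintro _ ⟨x, rfl⟩
  rw [Submodule.mem_comap, AlgebraicTopology.alternatingFaceMapComplex_obj_d]
  have key : (AlgebraicTopology.AlternatingFaceMapComplex.objD X j).hom ((X.σ i).hom x) =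
      ∑ l : Fin (j + 2), (-1 : ℤ) ^ (l : ℕ) •
        X.map (SimplexCategory.δ l ≫ SimplexCategory.σ i).op x := by
    simp [AlgebraicTopology.AlternatingFaceMapComplex.objD, ModuleCat.hom_sum]
    rfl
  refine key ▸ ?_
  have h0 : SimplexCategory.δ i.castSucc ≫ SimplexCategory.σ i = 𝟙 _ :=
    SimplexCategory.δ_comp_σ_self
  have h1 : SimplexCategory.δ i.succ ≫ SimplexCategory.σ i = 𝟙 _ :=
    SimplexCategory.δ_comp_σ_succ
  have hne : i.castSucc ≠ i.succ := Fin.castSucc_lt_succ.ne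
  rw [← Finset.add_sum_erase _ _ (Finset.mem_univ i.castSucc),
    ← Finset.add_sum_erase _ _ (Finset.mem_erase.2 ⟨hne.symm, Finset.mem_univ i.succ⟩),
    h0, h1, ← add_assoc]
  refine add_mem ?_ (sum_mem fun l hl => zsmul_mem (map_mem_degen X _ ?_ x) _)
  · simp [pow_succ]
  · simp only [Finset.mem_erase, Finset.mem_univ, and_true] at hl
    intro hinj
    obtain ⟨a, ha⟩ := Fin.exists_succAbove_eq (x := i.castSucc) (y := l) (Ne.symm hl.2)
    obtain ⟨b, hb⟩ := Fin.exists_succAbove_eq (x := i.succ) (y := l) (Ne.symm hl.1)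
    have : a = b := hinj (by
      change i.predAbove (l.succAbove a) = i.predAbove (l.succAbove b)
      rw [ha, hb, Fin.predAbove_castSucc_self, Fin.predAbove_succ_self])
    exact hne (by rw [← ha, ← hb, this])

/-- The normalized complex: chains modulo degenerate chains, with the alternating sum of faces. -/
noncomputable def normalized (X : SimplicialObject (ModuleCat.{u} k)) :
    ChainComplex (ModuleCat.{u} k) ℕ where
  X n := ModuleCat.of k ((X.obj (op ⦋n⦌) : Type u) ⧸ degen X n)
  d i j := ModuleCat.ofHom (Submodule.mapQ _ _
    (((AlgebraicTopology.alternatingFaceMapComplex _).obj X).d i j).hom (degen_d X i j))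
  shape i j h := by
    refine ModuleCat.hom_ext (Submodule.linearMap_qext _ (LinearMap.ext fun x => ?_))
    have : (((AlgebraicTopology.alternatingFaceMapComplex _).obj X).d i j).hom x = 0 := by
      rw [HomologicalComplex.shape _ i j h]; rfl
    exact (congrArg (Submodule.mkQ _) this).trans (map_zero _)
  d_comp_d' i j l _ _ := by
    refine ModuleCat.hom_ext (Submodule.linearMap_qext _ (LinearMap.ext fun x => ?_))
    have : (((AlgebraicTopology.alternatingFaceMapComplex _).obj X).d j l).hom
        ((((AlgebraicTopology.alternatingFaceMapComplex _).obj X).d i j).hom x) = 0 := by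
      rw [← LinearMap.comp_apply, ← ModuleCat.hom_comp, HomologicalComplex.d_comp_d]; rfl
    exact (congrArg (Submodule.mkQ _) this).trans (map_zero _)

instance (n m : ℕ) : Finite (⦋n⦌ ⟶ ⦋m⦌) :=
  Finite.of_injective (fun f : ⦋n⦌ ⟶ ⦋m⦌ => (f : Fin (n + 1) → Fin (m + 1)))
    fun f g h => by ext i : 3; exact congrFun h i

/-- For `n = p + q`, a `(p, q)`-shuffle `(μ, ν)`, encoded as the corresponding maximal chain in
`[p] × [q]`, i.e. as the pair of iterated degeneracies `s_ν` and `s_μ`: the steps at which `fst`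
increases are the `μ`'s, those at which `snd` increases are the `ν`'s. -/
structure Shuffle (p q n : ℕ) where
  fst : ⦋n⦌ ⟶ ⦋p⦌
  snd : ⦋n⦌ ⟶ ⦋q⦌
  injective : Function.Injective fun i => (fst i, snd i)

noncomputable instance (p q n : ℕ) : Fintype (Shuffle p q n) :=
  have : Finite (Shuffle p q n) := Finite.of_injective (fun s => (s.fst, s.snd))
    fun ⟨a, b, _⟩ ⟨c, d, _⟩ h => by
      obtain ⟨rfl, rfl⟩ := Prod.mk.inj h; rfl
  Fintype.ofFinite _

/-- The number of inversions of the shuffle `(μ, ν)`: pairs with `μ_i > ν_j`. -/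
def Shuffle.inversions {p q n : ℕ} (s : Shuffle p q n) : ℕ :=
  (Finset.univ.filter fun ij : Fin n × Fin n => ij.2 < ij.1 ∧
    s.fst ij.1.castSucc ≠ s.fst ij.1.succ ∧ s.snd ij.2.castSucc ≠ s.snd ij.2.succ).card

theorem exists_step {p q n : ℕ} (h : p + q = n) (f g : Fin (n + 1) → ℕ) (hf : Monotone f)
    (hg : Monotone g) (hfg : Function.Injective fun j => (f j, g j)) (hfp : ∀ j, f j ≤ p)
    (hgq : ∀ j, g j ≤ q) (i : ℕ) (hi : i < p) :
    ∃ j : Fin n, f j.castSucc = i ∧ f j.succ = i + 1 ∧ g j.castSucc = g j.succ := by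
  have hlt : ∀ j : Fin n, f j.castSucc + g j.castSucc < f j.succ + g j.succ := fun j => by
    have h1 := hf (Fin.castSucc_lt_succ (i := j)).le
    have h2 := hg (Fin.castSucc_lt_succ (i := j)).le
    have h3 : ¬ (f j.castSucc = f j.succ ∧ g j.castSucc = g j.succ) := fun h =>
      (Fin.castSucc_lt_succ (i := j)).ne (hfg (Prod.ext h.1 h.2))
    omega
  have hlow : ∀ j : Fin (n + 1), (j : ℕ) ≤ f j + g j := fun j => by
    induction j using Fin.induction with
    | zero => simp
    | succ j ih => have := hlt j; simp only [Fin.val_castSucc, Fin.val_succ] at *; omega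
  have hup : ∀ j : Fin (n + 1), f j + g j ≤ (j : ℕ) := fun j => by
    induction j using Fin.reverseInduction with
    | last => have := hfp (Fin.last n); have := hgq (Fin.last n); simp only [Fin.val_last]; omega
    | cast j ih => have := hlt j; simp only [Fin.val_castSucc, Fin.val_succ] at *; omega
  have hex : ∃ j : ℕ, ∃ hj : j < n + 1, i < f ⟨j, hj⟩ := by
    refine ⟨n, n.lt_succ_self, ?_⟩
    have h1 := hlow (Fin.last n); have h2 := hgq (Fin.last n)
    rw [Fin.val_last] at h1
    change i < f (Fin.last n)
    omega
  classical
  obtain ⟨hj, hij⟩ := Nat.find_spec hex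
  have hmin := fun m hm => Nat.find_min hex (m := m) hm
  generalize Nat.find hex = m at hj hij hmin
  cases m with
  | zero => have := hup ⟨0, hj⟩; simp only at this; omega
  | succ m =>
    have hm : ¬ i < f ⟨m, by omega⟩ := fun hc => hmin m m.lt_succ_self ⟨by omega, hc⟩
    let j : Fin n := ⟨m, by omega⟩
    have e1 : j.castSucc = ⟨m, by omega⟩ := rfl
    have e2 : j.succ = ⟨m + 1, hj⟩ := rfl
    have h1 := hlow ⟨m, by omega⟩; have h2 := hup ⟨m + 1, hj⟩
    have h3 := hg (Fin.castSucc_lt_succ (i := j)).le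
    rw [e1, e2] at h3
    simp only at h1 h2
    refine ⟨j, ?_⟩
    rw [e1, e2]
    omega

section
variable {p q n : ℕ} (s : Shuffle p q n)

theorem Shuffle.exists_fst (h : p + q = n) (i : ℕ) (hi : i < p) :
    ∃ j : Fin n, (s.fst j.castSucc).val = i ∧ (s.fst j.succ).val = i + 1 ∧
      s.snd j.castSucc = s.snd j.succ := by
  obtain ⟨j, h1, h2, h3⟩ := exists_step h (fun j => (s.fst j).val) (fun j => (s.snd j).val)
    (fun a b hab => s.fst.toOrderHom.monotone hab) (fun a b hab => s.snd.toOrderHom.monotone hab)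
    (fun a b hab => s.injective (Prod.ext (Fin.ext (Prod.mk.inj hab).1)
      (Fin.ext (Prod.mk.inj hab).2)))
    (fun j => Nat.lt_succ_iff.1 (s.fst j).isLt) (fun j => Nat.lt_succ_iff.1 (s.snd j).isLt) i hi
  exact ⟨j, h1, h2, Fin.ext h3⟩

theorem Shuffle.exists_snd (h : p + q = n) (i : ℕ) (hi : i < q) :
    ∃ j : Fin n, (s.snd j.castSucc).val = i ∧ (s.snd j.succ).val = i + 1 ∧
      s.fst j.castSucc = s.fst j.succ := by
  obtain ⟨j, h1, h2, h3⟩ := exists_step (p := q) (q := p) ((Nat.add_comm q p).trans h)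
    (fun j => (s.snd j).val) (fun j => (s.fst j).val)
    (fun a b hab => s.snd.toOrderHom.monotone hab) (fun a b hab => s.fst.toOrderHom.monotone hab)
    (fun a b hab => s.injective (Prod.ext (Fin.ext (Prod.mk.inj hab).2)
      (Fin.ext (Prod.mk.inj hab).1)))
    (fun j => Nat.lt_succ_iff.1 (s.snd j).isLt) (fun j => Nat.lt_succ_iff.1 (s.fst j).isLt) i hi
  exact ⟨j, h1, h2, Fin.ext h3⟩
end

theorem tmul_mem_degen (X Y : SimplicialObject (ModuleCat.{u} k)) {p q n : ℕ} (α : ⦋n⦌ ⟶ ⦋p⦌)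
    (β : ⦋n⦌ ⟶ ⦋q⦌) (j : Fin n) (hα : α j.castSucc = α j.succ) (hβ : β j.castSucc = β j.succ)
    (x : X.obj (op ⦋p⦌)) (y : Y.obj (op ⦋q⦌)) :
    hatMk X Y _ (X.map α.op x) (Y.map β.op y) ∈ degen (hat X Y) n := by
  cases n with
  | zero => exact j.elim0
  | succ n =>
    rw [map_eq_σ_of_eq X α j hα, map_eq_σ_of_eq Y β j hβ]
    rw [← hat_map_hatMk]
    exact σ_mem_degen (hat X Y) j _

theorem degen_induction (X : SimplicialObject (ModuleCat.{u} k)) {p : ℕ}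
    (N : Submodule k (X.obj (op ⦋p⦌)))
    (h : ∀ (m : ℕ) (i : Fin (m + 1)) (e : p = m + 1) (x : X.obj (op ⦋m⦌)),
      X.map (eqToHom (by rw [e]) ≫ SimplexCategory.σ i : ⦋p⦌ ⟶ ⦋m⦌).op x ∈ N) : degen X p ≤ N := by
  cases p with
  | zero => exact bot_le (α := Submodule k (X.obj (op ⦋0⦌)))
  | succ p =>
    refine iSup_le fun i => ?_
    rintro _ ⟨x, rfl⟩
    have := h p i rfl x
    rw [eqToHom_refl, Category.id_comp] at this
    exact this

/-- The Eilenberg-Zilber shuffle map `x ⊗ y ↦ ∑ sgn(μ, ν) s_ν x ⊗ s_μ y` on all chains. -/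
noncomputable def shuffleChain (X Y : SimplicialObject (ModuleCat.{u} k)) (p q n : ℕ) :
    (X.obj (op ⦋p⦌) : Type u) →ₗ[k] (Y.obj (op ⦋q⦌) : Type u) →ₗ[k]
      ((hat X Y).obj (op ⦋n⦌) : Type u) :=
  ∑ s : Shuffle p q n, (-1 : ℤ) ^ s.inversions •
      (hatMk X Y (op ⦋n⦌)).compl₁₂
        (X.map s.fst.op).hom (Y.map s.snd.op).hom

theorem shuffleChain_apply (X Y : SimplicialObject (ModuleCat.{u} k)) (p q n : ℕ)
    (x : X.obj (op ⦋p⦌)) (y : Y.obj (op ⦋q⦌)) :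
    shuffleChain X Y p q n x y = ∑ s : Shuffle p q n, (-1 : ℤ) ^ s.inversions •
      hatMk X Y _ (X.map s.fst.op x) (Y.map s.snd.op y) := by
  simp only [shuffleChain, LinearMap.sum_apply]
  rfl

theorem shuffleChain_left (X Y : SimplicialObject (ModuleCat.{u} k)) {p q n : ℕ} (h : p + q = n)
    (x : X.obj (op ⦋p⦌)) (hx : x ∈ degen X p) (y : Y.obj (op ⦋q⦌)) :
    shuffleChain X Y p q n x y ∈ degen (hat X Y) n := by
  suffices degen X p ≤ (degen (hat X Y) n).comap ((shuffleChain X Y p q n).flip y) from this hx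
  clear hx x
  refine degen_induction X _ fun m i e x => ?_
  subst e
  rw [Submodule.mem_comap, LinearMap.flip_apply, shuffleChain_apply]
  refine sum_mem fun s _ => zsmul_mem ?_ _
  obtain ⟨j, h1, h2, h3⟩ := s.exists_fst h i (by omega)
  have hj : (s.fst ≫ SimplexCategory.σ i) j.castSucc = (s.fst ≫ SimplexCategory.σ i) j.succ := by
    change i.predAbove (s.fst j.castSucc) = i.predAbove (s.fst j.succ)
    rw [show s.fst j.castSucc = i.castSucc from Fin.ext h1,
      show s.fst j.succ = i.succ from Fin.ext h2, Fin.predAbove_castSucc_self,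
      Fin.predAbove_succ_self]
  have := tmul_mem_degen X Y (s.fst ≫ SimplexCategory.σ i) s.snd j hj h3 x y
  simpa using this

theorem shuffleChain_right (X Y : SimplicialObject (ModuleCat.{u} k)) {p q n : ℕ} (h : p + q = n)
    (x : X.obj (op ⦋p⦌)) (y : Y.obj (op ⦋q⦌)) (hy : y ∈ degen Y q) :
    shuffleChain X Y p q n x y ∈ degen (hat X Y) n := by
  suffices degen Y q ≤ (degen (hat X Y) n).comap (shuffleChain X Y p q n x) from this hy
  clear hy y
  refine degen_induction Y _ fun m i e y => ?_
  subst e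
  rw [Submodule.mem_comap, shuffleChain_apply]
  refine sum_mem fun s _ => zsmul_mem ?_ _
  obtain ⟨j, h1, h2, h3⟩ := s.exists_snd h i (by omega)
  have hj : (s.snd ≫ SimplexCategory.σ i) j.castSucc = (s.snd ≫ SimplexCategory.σ i) j.succ := by
    change i.predAbove (s.snd j.castSucc) = i.predAbove (s.snd j.succ)
    rw [show s.snd j.castSucc = i.castSucc from Fin.ext h1,
      show s.snd j.succ = i.succ from Fin.ext h2, Fin.predAbove_castSucc_self,
      Fin.predAbove_succ_self]
  have := tmul_mem_degen X Y s.fst (s.snd ≫ SimplexCategory.σ i) j h3 hj x y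
  simpa using this

/-- The Eilenberg-Zilber shuffle map `𝒩X ⊗ 𝒩Y → 𝒩(X ⊗̂ Y)` on normalized chains. -/
noncomputable def Sh (X Y : SimplicialObject (ModuleCat.{u} k)) {p q n : ℕ} (h : p + q = n) :
    ((normalized X).X p : Type u) →ₗ[k] ((normalized Y).X q : Type u) →ₗ[k]
      ((normalized (hat X Y)).X n : Type u) :=
  (degen X p).liftQ
    (LinearMap.flip ((degen Y q).liftQ
      ((shuffleChain X Y p q n).compr₂ (degen (hat X Y) n).mkQ).flip
      fun y hy => LinearMap.ext fun x =>
        (Submodule.Quotient.mk_eq_zero _).2 (shuffleChain_right X Y h x y hy)))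
    fun x hx => by
      refine LinearMap.ext fun y => ?_
      obtain ⟨y, rfl⟩ := Submodule.Quotient.mk_surjective _ y
      exact (Submodule.Quotient.mk_eq_zero _).2 (shuffleChain_left X Y h x hx y)

end Simplicial

section Structure
open scoped TensorProduct Simplicial
universe u

def blockIso (σ : Equiv.Perm (Fin 2)) (P Q : FAs) : FAs.add P Q ≅ FAs.add P Q :=
  FAs.permIso (X := FAs.add P Q) (FAs.blockPerm σ P.n Q.n)

/-- The operad-module structure functor `𝒟_cat(2) × 𝒦_cat(m) × 𝒦_cat(n) → 𝒦_cat(m + n)`, given on objects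
by `(σ, f₁, f₂) ↦ σ{p₁, p₂} (f₁ ⊙ f₂)`. On morphisms `(σ, f₁, f₂) → (τ, g₁ f₁, g₂ f₂)` it is
`τ{q₁, q₂} (g₁ ⊙ g₂) σ{p₁, p₂}⁻¹`, which is `(τσ⁻¹){q_σ} g_σ^⊙`. -/
def mu (X Y : FAs) :
    Codiscrete (Equiv.Perm (Fin 2)) × (Under X × Under Y) ⥤ Under (FAs.add X Y) where
  obj t := Under.mk (FAs.addHom t.2.1.hom t.2.2.hom ≫
    (blockIso t.1.as t.2.1.right t.2.2.right).hom)
  map {t t'} g := Under.homMk ((blockIso t.1.as t.2.1.right t.2.2.right).inv ≫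
      FAs.addHom g.2.1.right g.2.2.right ≫ (blockIso t'.1.as t'.2.1.right t'.2.2.right).hom) (by
    have h := FAs.addHom_comp t.2.1.hom t.2.2.hom g.2.1.right g.2.2.right
    rw [Under.w, Under.w] at h
    simp [h])
  map_id t := by
    apply Under.UnderMorphism.ext
    simp [FAs.addHom_id]
  map_comp g g' := by
    apply Under.UnderMorphism.ext
    simp [FAs.addHom_comp]

theorem under_functor_ext {J : Type} [SmallCategory J] {Z : FAs} (F G : J ⥤ Under Z)
    (h : F ⋙ Under.forget Z = G ⋙ Under.forget Z) (hobj : ∀ j, F.obj j = G.obj j) : F = G :=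
  CategoryTheory.Functor.ext hobj fun i j f => Under.UnderMorphism.ext <| by
    rw [Under.comp_right, Under.comp_right, Under.eqToHom_right, Under.eqToHom_right]
    exact Functor.congr_hom h f

theorem mu_map {X X' Y Y' : FAs} (f : X ⟶ X') (g : Y ⟶ Y') :
    (𝟭 _).prod ((Under.map f).prod (Under.map g)) ⋙ mu X Y =
      mu X' Y' ⋙ Under.map (FAs.addHom f g) :=
  under_functor_ext _ _ rfl fun t =>
    congrArg Under.mk ((congrArg (fun φ => φ ≫ (blockIso t.1.as t.2.1.right t.2.2.right).hom)
      (FAs.addHom_comp f g t.2.1.hom t.2.2.hom)).trans (Category.assoc _ _ _))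

def muNerve {Δ : SimplexCategoryᵒᵖ} {X Y : FAs}
    (s : (nerve (Codiscrete (Equiv.Perm (Fin 2)))).obj Δ) (u : (nerve (Under X)).obj Δ)
    (v : (nerve (Under Y)).obj Δ) : (nerve (Under (FAs.add X Y))).obj Δ :=
  Functor.prod' s (Functor.prod' u v) ⋙ mu X Y

theorem muNerve_map {Δ Δ' : SimplexCategoryᵒᵖ} (θ : Δ ⟶ Δ') {X Y : FAs}
    (s : (nerve (Codiscrete (Equiv.Perm (Fin 2)))).obj Δ) (u : (nerve (Under X)).obj Δ)
    (v : (nerve (Under Y)).obj Δ) :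
    (nerve _).map θ (muNerve s u v) =
      muNerve ((nerve _).map θ s) ((nerve _).map θ u) ((nerve _).map θ v) := rfl

theorem muNerve_under {Δ : SimplexCategoryᵒᵖ} {X X' Y Y' : FAs} (f : X ⟶ X') (g : Y ⟶ Y')
    (s : (nerve (Codiscrete (Equiv.Perm (Fin 2)))).obj Δ) (u : (nerve (Under X')).obj Δ)
    (v : (nerve (Under Y')).obj Δ) :
    muNerve s ((nerveMap (Under.map f)).app Δ u) ((nerveMap (Under.map g)).app Δ v) =
      (nerveMap (Under.map (FAs.addHom f g))).app Δ (muNerve s u v) :=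
  congrArg (fun F => Functor.prod' s (Functor.prod' u v) ⋙ F) (mu_map f g)

variable (k : Type u) [CommRing k]

noncomputable def linMul {S T W : Type} (m : S → T → W) :
    (S →₀ k) →ₗ[k] (T →₀ k) →ₗ[k] (W →₀ k) :=
  Finsupp.linearCombination k fun s => Finsupp.lmapDomain k k (m s)

theorem linMul_single {S T W : Type} (m : S → T → W) (s : S) (t : T) :
    linMul k m (Finsupp.single s 1) (Finsupp.single t 1) = Finsupp.single (m s t) 1 := by
  simp [linMul]

noncomputable def stdMul {Δ : SimplexCategoryᵒᵖ}
    (s : (nerve (Codiscrete (Equiv.Perm (Fin 2)))).obj Δ) (X Y : FAs) :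
    (((stdRes k FAs).obj Δ).obj (op X) : Type u) →ₗ[k]
      (((stdRes k FAs).obj Δ).obj (op Y) : Type u) →ₗ[k]
        (((stdRes k FAs).obj Δ).obj (op (FAs.add X Y)) : Type u) :=
  linMul k (muNerve (X := X) (Y := Y) s)

noncomputable def stdSingle (C : Type) [SmallCategory C] {Δ : SimplexCategoryᵒᵖ} {X : C}
    (u : (nerve (Under X)).obj Δ) : ((stdRes k C).obj Δ).obj (op X) :=
  (Finsupp.single u 1 : (nerve (Under X)).obj Δ →₀ k)

theorem std_hom_ext {C : Type} [SmallCategory C] {Δ : SimplexCategoryᵒᵖ} {X : C} {M : Type*}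
    [AddCommGroup M] [Module k M] {α β : (((stdRes k C).obj Δ).obj (op X) : Type u) →ₗ[k] M}
    (h : ∀ u, α (stdSingle k C u) = β (stdSingle k C u)) : α = β :=
  Finsupp.lhom_ext' (R := k) (M := k) (α := (nerve (Under X)).obj Δ)
    fun u => LinearMap.ext_ring (h u)

theorem stdSingle_map {C : Type} [SmallCategory C] {Δ : SimplexCategoryᵒᵖ} {X Y : C} (f : X ⟶ Y)
    (u : (nerve (Under Y)).obj Δ) :
    ((stdRes k C).obj Δ).map f.op (stdSingle k C u) =
      stdSingle k C ((nerveMap (Under.map f)).app Δ u) :=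
  Finsupp.mapDomain_single

theorem stdSingle_app {C : Type} [SmallCategory C] {Δ Δ' : SimplexCategoryᵒᵖ} (θ : Δ ⟶ Δ') {X : C}
    (u : (nerve (Under X)).obj Δ) :
    ((stdRes k C).map θ).app (op X) (stdSingle k C u) =
      stdSingle k C ((nerve (Under X)).map θ u) :=
  Finsupp.mapDomain_single

theorem stdMul_single {Δ : SimplexCategoryᵒᵖ}
    (s : (nerve (Codiscrete (Equiv.Perm (Fin 2)))).obj Δ) (X Y : FAs)
    (u : (nerve (Under X)).obj Δ) (v : (nerve (Under Y)).obj Δ) :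
    stdMul k s X Y (stdSingle k FAs u) (stdSingle k FAs v) = stdSingle k FAs (muNerve s u v) :=
  linMul_single k _ u v

theorem stdMul_map {Δ : SimplexCategoryᵒᵖ} (s : (nerve (Codiscrete (Equiv.Perm (Fin 2)))).obj Δ)
    {X X' Y Y' : FAs} (f : X ⟶ X') (g : Y ⟶ Y') (x : ((stdRes k FAs).obj Δ).obj (op X'))
    (y : ((stdRes k FAs).obj Δ).obj (op Y')) :
    stdMul k s X Y (((stdRes k FAs).obj Δ).map f.op x) (((stdRes k FAs).obj Δ).map g.op y) =
      ((stdRes k FAs).obj Δ).map (FAs.addHom f g).op (stdMul k s X' Y' x y) := by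
  have : (stdMul k s X Y).compl₁₂ (((stdRes k FAs).obj Δ).map f.op).hom
      (((stdRes k FAs).obj Δ).map g.op).hom =
      (stdMul k s X' Y').compr₂ (((stdRes k FAs).obj Δ).map (FAs.addHom f g).op).hom := by
    refine std_hom_ext k fun u => std_hom_ext k fun v => ?_
    change stdMul k s X Y (((stdRes k FAs).obj Δ).map f.op (stdSingle k FAs u))
      (((stdRes k FAs).obj Δ).map g.op (stdSingle k FAs v)) =
      ((stdRes k FAs).obj Δ).map (FAs.addHom f g).op
        (stdMul k s X' Y' (stdSingle k FAs u) (stdSingle k FAs v))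
    rw [stdSingle_map, stdSingle_map, stdMul_single, stdMul_single, stdSingle_map, muNerve_under]
  exact LinearMap.congr_fun₂ this x y

theorem stdMul_app {Δ Δ' : SimplexCategoryᵒᵖ} (θ : Δ ⟶ Δ')
    (s : (nerve (Codiscrete (Equiv.Perm (Fin 2)))).obj Δ) {X Y : FAs}
    (x : ((stdRes k FAs).obj Δ).obj (op X)) (y : ((stdRes k FAs).obj Δ).obj (op Y)) :
    ((stdRes k FAs).map θ).app (op (FAs.add X Y)) (stdMul k s X Y x y) =
      stdMul k ((nerve _).map θ s) X Y (((stdRes k FAs).map θ).app (op X) x)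
        (((stdRes k FAs).map θ).app (op Y) y) := by
  have : (stdMul k s X Y).compr₂ (((stdRes k FAs).map θ).app (op (FAs.add X Y))).hom =
      (stdMul k ((nerve _).map θ s) X Y).compl₁₂ (((stdRes k FAs).map θ).app (op X)).hom
        (((stdRes k FAs).map θ).app (op Y)).hom := by
    refine std_hom_ext k fun u => std_hom_ext k fun v => ?_
    change ((stdRes k FAs).map θ).app (op (FAs.add X Y))
        (stdMul k s X Y (stdSingle k FAs u) (stdSingle k FAs v)) =
      stdMul k ((nerve _).map θ s) X Y (((stdRes k FAs).map θ).app (op X) (stdSingle k FAs u))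
        (((stdRes k FAs).map θ).app (op Y) (stdSingle k FAs v))
    rw [stdSingle_app, stdSingle_app, stdMul_single, stdMul_single, stdSingle_app, muNerve_map]
  exact LinearMap.congr_fun₂ this x y

variable (A : Type u) [Ring A] [Algebra k A]

/-- The simplicial `k`-module `𝒴⁺_* A = k[N(- ∖ ΔS₊)] ⊗_{ΔS₊} B^{sym₊}_* A`. -/
noncomputable def Yplus : SimplicialObject (ModuleCat.{u} k) := stdBar k (Bplus k A)

noncomputable def Ymk (Δ : SimplexCategoryᵒᵖ) (X : FAs) :
    (((stdRes k FAs).obj Δ).obj (op X) : Type u) →ₗ[k] ((Bplus k A).obj X : Type u) →ₗ[k]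
      ((Yplus k A).obj Δ : Type u) :=
  TensorOver.mk ((stdRes k FAs).obj Δ) (Bplus k A) X

theorem Ymk_balanced {Δ : SimplexCategoryᵒᵖ} {X Y : FAs} (f : X ⟶ Y)
    (g : ((stdRes k FAs).obj Δ).obj (op Y)) (b : (Bplus k A).obj X) :
    Ymk k A Δ X (((stdRes k FAs).obj Δ).map f.op g) b = Ymk k A Δ Y g ((Bplus k A).map f b) :=
  TensorOver.mk_balanced f g b

theorem Y_map_Ymk {Δ Δ' : SimplexCategoryᵒᵖ} (θ : Δ ⟶ Δ') (X : FAs)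
    (g : ((stdRes k FAs).obj Δ).obj (op X)) (b : (Bplus k A).obj X) :
    (Yplus k A).map θ (Ymk k A Δ X g b) = Ymk k A Δ' X (((stdRes k FAs).map θ).app (op X) g) b :=
  TensorOver.map_mk _ _ _ _

theorem Y_hom_ext {Δ : SimplexCategoryᵒᵖ} {M : Type u} [AddCommGroup M] [Module k M]
    {α β : ((Yplus k A).obj Δ : Type u) →ₗ[k] M}
    (h : ∀ X g b, α (Ymk k A Δ X g b) = β (Ymk k A Δ X g b)) : α = β :=
  TensorOver.hom_ext h

noncomputable def Ylift {Δ : SimplexCategoryᵒᵖ} {M : Type u} [AddCommGroup M] [Module k M]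
    (φ : ∀ X : FAs, (((stdRes k FAs).obj Δ).obj (op X) : Type u) →ₗ[k]
      ((Bplus k A).obj X : Type u) →ₗ[k] M)
    (h : ∀ (X Y : FAs) (f : X ⟶ Y) (g : ((stdRes k FAs).obj Δ).obj (op Y)) (b : (Bplus k A).obj X),
      φ X (((stdRes k FAs).obj Δ).map f.op g) b = φ Y g ((Bplus k A).map f b)) :
    ((Yplus k A).obj Δ : Type u) →ₗ[k] M :=
  TensorOver.lift φ h

theorem Ylift_mk {Δ : SimplexCategoryᵒᵖ} {M : Type u} [AddCommGroup M] [Module k M]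
    (φ : ∀ X : FAs, (((stdRes k FAs).obj Δ).obj (op X) : Type u) →ₗ[k]
      ((Bplus k A).obj X : Type u) →ₗ[k] M) (h) (X : FAs)
    (g : ((stdRes k FAs).obj Δ).obj (op X)) (b : (Bplus k A).obj X) :
    Ylift k A φ h (Ymk k A Δ X g b) = φ X g b := TensorOver.lift_mk _ _ _ _ _

noncomputable def juxtB (X Y : FAs) : ((Bplus k A).obj X : Type u) →ₗ[k]
    ((Bplus k A).obj Y : Type u) →ₗ[k] ((Bplus k A).obj (FAs.add X Y) : Type u) :=
  juxt k A X Y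

theorem juxtB_map {X X' Y Y' : FAs} (f : X ⟶ X') (g : Y ⟶ Y') (v : (Bplus k A).obj X)
    (w : (Bplus k A).obj Y) :
    juxtB k A X' Y' ((Bplus k A).map f v) ((Bplus k A).map g w) =
      (Bplus k A).map (FAs.addHom f g) (juxtB k A X Y v w) := juxt_act k A f g v w

theorem chi_balanced {Δ : SimplexCategoryᵒᵖ}
    (s : (nerve (Codiscrete (Equiv.Perm (Fin 2)))).obj Δ) {X X' Y Y' : FAs} (f : X ⟶ X')
    (f' : Y ⟶ Y') (g : ((stdRes k FAs).obj Δ).obj (op X')) (b : (Bplus k A).obj X)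
    (g' : ((stdRes k FAs).obj Δ).obj (op Y')) (b' : (Bplus k A).obj Y) :
    Ymk k A Δ _ (stdMul k s X Y (((stdRes k FAs).obj Δ).map f.op g)
      (((stdRes k FAs).obj Δ).map f'.op g')) (juxtB k A X Y b b') =
    Ymk k A Δ _ (stdMul k s X' Y' g g')
      (juxtB k A X' Y' ((Bplus k A).map f b) ((Bplus k A).map f' b')) := by
  rw [stdMul_map, Ymk_balanced, juxtB_map]

noncomputable def chiRight {Δ : SimplexCategoryᵒᵖ}
    (s : (nerve (Codiscrete (Equiv.Perm (Fin 2)))).obj Δ) (X : FAs)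
    (g : ((stdRes k FAs).obj Δ).obj (op X)) (b : (Bplus k A).obj X) :
    ((Yplus k A).obj Δ : Type u) →ₗ[k] ((Yplus k A).obj Δ : Type u) :=
  Ylift k A (fun Y => (Ymk k A Δ _).compl₁₂ (stdMul k s X Y g) (juxtB k A X Y b))
    fun Y Y' f' g' b' => by
      have := chi_balanced k A s (𝟙 X) f' g b g' b'
      simpa using this

theorem chiRight_mk {Δ : SimplexCategoryᵒᵖ}
    (s : (nerve (Codiscrete (Equiv.Perm (Fin 2)))).obj Δ) (X Y : FAs)
    (g : ((stdRes k FAs).obj Δ).obj (op X)) (b : (Bplus k A).obj X)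
    (g' : ((stdRes k FAs).obj Δ).obj (op Y)) (b' : (Bplus k A).obj Y) :
    chiRight k A s X g b (Ymk k A Δ Y g' b') =
      Ymk k A Δ _ (stdMul k s X Y g g') (juxtB k A X Y b b') := Ylift_mk k A _ _ _ _ _

/-- For a simplex `s` of `N(E S₂)`: `(g ⊗ b, g' ⊗ b') ↦ μ(s, g, g') ⊗ (b ⊗ b')`. -/
noncomputable def chiAt {Δ : SimplexCategoryᵒᵖ}
    (s : (nerve (Codiscrete (Equiv.Perm (Fin 2)))).obj Δ) :
    ((Yplus k A).obj Δ : Type u) →ₗ[k] ((Yplus k A).obj Δ : Type u) →ₗ[k]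
      ((Yplus k A).obj Δ : Type u) :=
  Ylift k A (fun X => LinearMap.mk₂ k (chiRight k A s X)
    (fun _ _ _ => Y_hom_ext k A fun _ _ _ => by simp [chiRight_mk])
    (fun _ _ _ => Y_hom_ext k A fun _ _ _ => by simp [chiRight_mk])
    (fun _ _ _ => Y_hom_ext k A fun _ _ _ => by simp [chiRight_mk])
    (fun _ _ _ => Y_hom_ext k A fun _ _ _ => by simp [chiRight_mk]))
    fun X X' f g b => Y_hom_ext k A fun Y g' b' => by
      have := chi_balanced k A s f (𝟙 Y) g b g' b'
      simpa [chiRight_mk] using this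

theorem chiAt_mk {Δ : SimplexCategoryᵒᵖ}
    (s : (nerve (Codiscrete (Equiv.Perm (Fin 2)))).obj Δ) (X Y : FAs)
    (g : ((stdRes k FAs).obj Δ).obj (op X)) (b : (Bplus k A).obj X)
    (g' : ((stdRes k FAs).obj Δ).obj (op Y)) (b' : (Bplus k A).obj Y) :
    chiAt k A s (Ymk k A Δ X g b) (Ymk k A Δ Y g' b') =
      Ymk k A Δ _ (stdMul k s X Y g g') (juxtB k A X Y b b') := by
  refine (LinearMap.congr_fun (Ylift_mk k A _ _ _ _ _) _).trans ?_
  exact chiRight_mk k A s X Y g b g' b'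

theorem chiAt_map {Δ Δ' : SimplexCategoryᵒᵖ} (θ : Δ ⟶ Δ')
    (s : (nerve (Codiscrete (Equiv.Perm (Fin 2)))).obj Δ) (x y : (Yplus k A).obj Δ) :
    (Yplus k A).map θ (chiAt k A s x y) =
      chiAt k A ((nerve _).map θ s) ((Yplus k A).map θ x) ((Yplus k A).map θ y) := by
  have : (chiAt k A s).compr₂ ((Yplus k A).map θ).hom =
      (chiAt k A ((nerve _).map θ s)).compl₁₂ ((Yplus k A).map θ).hom ((Yplus k A).map θ).hom := by
    refine Y_hom_ext k A fun X g b => Y_hom_ext k A fun Y g' b' => ?_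
    change (Yplus k A).map θ (chiAt k A s (Ymk k A Δ X g b) (Ymk k A Δ Y g' b')) =
      chiAt k A ((nerve _).map θ s) ((Yplus k A).map θ (Ymk k A Δ X g b))
        ((Yplus k A).map θ (Ymk k A Δ Y g' b'))
    rw [Y_map_Ymk, Y_map_Ymk, chiAt_mk, chiAt_mk, Y_map_Ymk, stdMul_app]
  exact LinearMap.congr_fun₂ this x y

noncomputable def chiLin (Δ : SimplexCategoryᵒᵖ) :
    ((Dsm k 2).obj Δ : Type u) →ₗ[k] ((Yplus k A).obj Δ : Type u) →ₗ[k]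
      ((Yplus k A).obj Δ : Type u) →ₗ[k] ((Yplus k A).obj Δ : Type u) :=
  Finsupp.linearCombination k
    fun s : (nerve (Codiscrete (Equiv.Perm (Fin 2)))).obj Δ => chiAt k A s

theorem chiLin_map {Δ Δ' : SimplexCategoryᵒᵖ} (θ : Δ ⟶ Δ') (c : (Dsm k 2).obj Δ)
    (x y : (Yplus k A).obj Δ) :
    (Yplus k A).map θ (chiLin k A Δ c x y) =
      chiLin k A Δ' ((Dsm k 2).map θ c) ((Yplus k A).map θ x) ((Yplus k A).map θ y) := by
  have h1 (Δ : SimplexCategoryᵒᵖ) (s : (nerve (Codiscrete (Equiv.Perm (Fin 2)))).obj Δ) :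
      chiLin k A Δ (Finsupp.single s 1) = chiAt k A s :=
    (Finsupp.linearCombination_single k (1 : k) s).trans (one_smul k _)
  have h2 (s : (nerve (Codiscrete (Equiv.Perm (Fin 2)))).obj Δ) :
      (Dsm k 2).map θ (Finsupp.single s (1 : k)) =
        (Finsupp.single ((nerve _).map θ s) (1 : k) :
          (nerve (Codiscrete (Equiv.Perm (Fin 2)))).obj Δ' →₀ k) := Finsupp.mapDomain_single
  let α : ((nerve (Codiscrete (Equiv.Perm (Fin 2)))).obj Δ →₀ k) →ₗ[k]
      ((Yplus k A).obj Δ' : Type u) := ((Yplus k A).map θ).hom ∘ₗ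
        ((chiLin k A Δ).flip x).flip y
  let β : ((nerve (Codiscrete (Equiv.Perm (Fin 2)))).obj Δ →₀ k) →ₗ[k]
      ((Yplus k A).obj Δ' : Type u) :=
    ((chiLin k A Δ').flip ((Yplus k A).map θ x)).flip ((Yplus k A).map θ y) ∘ₗ
      ((Dsm k 2).map θ).hom
  have : α = β := Finsupp.lhom_ext' fun s => LinearMap.ext_ring <| by
    change (Yplus k A).map θ (chiLin k A Δ (Finsupp.single s 1) x y) =
      chiLin k A Δ' ((Dsm k 2).map θ (Finsupp.single s (1 : k))) ((Yplus k A).map θ x)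
        ((Yplus k A).map θ y)
    rw [h1, h2, h1, chiAt_map]
  exact LinearMap.congr_fun this c

/-- The arity two structure map `𝒟_sm(2) ⊗̂ 𝒴⁺ ⊗̂ 𝒴⁺ → 𝒴⁺` of simplicial `k`-modules. -/
noncomputable def chiBar : hat (Dsm k 2) (hat (Yplus k A) (Yplus k A)) ⟶ Yplus k A where
  app Δ := ModuleCat.ofHom (TensorProduct.lift
    ((TensorProduct.lift.equiv (RingHom.id k) ((Yplus k A).obj Δ : Type u)
      ((Yplus k A).obj Δ : Type u) ((Yplus k A).obj Δ : Type u)).toLinearMap ∘ₗ chiLin k A Δ))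
  naturality Δ Δ' θ := by
    refine ModuleCat.hom_ext (TensorProduct.ext (LinearMap.ext fun c => TensorProduct.ext'
      fun x y => ?_))
    exact (chiLin_map k A θ c x y).symm

theorem chiBar_hatMk (Δ : SimplexCategoryᵒᵖ) (c : (Dsm k 2).obj Δ) (x y : (Yplus k A).obj Δ) :
    (chiBar k A).app Δ (hatMk (Dsm k 2) (hat (Yplus k A) (Yplus k A)) Δ c
      (hatMk (Yplus k A) (Yplus k A) Δ x y)) = chiLin k A Δ c x y := rfl

/-- Functoriality of the normalized complex. -/
noncomputable def normalizedMap {X Y : SimplicialObject (ModuleCat.{u} k)} (f : X ⟶ Y) :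
    normalized X ⟶ normalized Y where
  f n := ModuleCat.ofHom (Submodule.mapQ _ _ (f.app (op ⦋n⦌)).hom (degen_map f n))
  comm' i j _ := by
    refine ModuleCat.hom_ext (Submodule.linearMap_qext _ (LinearMap.ext fun x => ?_))
    have := congrArg (fun t => t.hom x)
      (((AlgebraicTopology.alternatingFaceMapComplex (ModuleCat.{u} k)).map f).comm i j)
    exact congrArg (degen Y j).mkQ this

noncomputable def toNormalized (X : SimplicialObject (ModuleCat.{u} k)) :
    (AlgebraicTopology.alternatingFaceMapComplex _).obj X ⟶ normalized X where
  f n := ModuleCat.ofHom (degen X n).mkQ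
  comm' _ _ _ := rfl

/-- The complex `𝒟_ch(m)`. -/
noncomputable abbrev Dch (m : ℕ) : ChainComplex (ModuleCat.{u} k) ℕ := normalized (Dsm k m)

/-- The normalized complex `𝒩𝒴⁺_* A`. -/
noncomputable abbrev NYplus : ChainComplex (ModuleCat.{u} k) ℕ := normalized (Yplus k A)

/-- The arity two `E_∞`-structure map `𝒟_ch(2) ⊗ 𝒩𝒴⁺ ⊗ 𝒩𝒴⁺ → 𝒩𝒴⁺`, evaluated on `c ⊗ x ⊗ y`: the
(iterated) shuffle map followed by the normalization of `chiBar`. -/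
noncomputable def chiTilde {r p q n : ℕ} (h : r + (p + q) = n) (c : (Dch k 2).X r)
    (x : (NYplus k A).X p) (y : (NYplus k A).X q) : (NYplus k A).X n :=
  (normalizedMap k (chiBar k A)).f n
    (Sh (Dsm k 2) (hat (Yplus k A) (Yplus k A)) h c (Sh (Yplus k A) (Yplus k A) rfl x y))

theorem degen_zero (X : SimplicialObject (ModuleCat.{u} k)) : degen X 0 = ⊥ := rfl

/-- The augmentation `𝒟_ch(m)₀ → k`, which induces the identification `H₀(𝒟_ch(m)) = k`. -/
noncomputable def augD (m : ℕ) : ((Dch k m).X 0 : Type u) →ₗ[k] k :=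
  (degen (Dsm k m) 0).liftQ (coeffSum k ((nerve (Codiscrete (Equiv.Perm (Fin m)))).obj (op ⦋0⦌))).hom
    ((degen_zero k (Dsm k m)).trans_le bot_le)

end Structure

section HS
open scoped TensorProduct Simplicial
universe u
variable (k : Type u) [CommRing k] (A : Type u) [Ring A] [Algebra k A]

/-- The category `ΔS`, the full subcategory of `ΔS₊` on the non-empty sets. -/
abbrev DeltaS : Type := ObjectProperty.FullSubcategory fun X : FAs => X.n ≠ 0

abbrev inclDeltaS : DeltaS ⥤ FAs := ObjectProperty.ι _

/-- The functor `B^{sym}_* A` on `ΔS`. -/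
noncomputable def Bsym : DeltaS ⥤ ModuleCat.{u} k := inclDeltaS ⋙ Bplus k A

/-- Symmetric homology `HS_n(A) = Tor_n^{ΔS}(k, B^{sym}_* A)`: the left derived functors of
`- ⊗_{ΔS} B^{sym}_* A` at the constant right `ΔS`-module `k`. -/
noncomputable def HS (n : ℕ) : ModuleCat.{u} k :=
  ((tensorFunctor k (Bsym k A)).leftDerived n).obj
    ((Functor.const DeltaSᵒᵖ).obj (ModuleCat.of k k))

theorem post_map {X Y : DeltaS} (f : X ⟶ Y) :
    Under.map f ⋙ Under.post (X := X) inclDeltaS =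
      Under.post (X := Y) inclDeltaS ⋙ Under.map (inclDeltaS.map f) :=
  under_functor_ext _ _ rfl fun U => congrArg Under.mk (inclDeltaS.map_comp f U.hom)

noncomputable def stdIncl (Δ : SimplexCategoryᵒᵖ) (X : DeltaS) :
    (((stdRes k DeltaS).obj Δ).obj (op X) : Type u) →ₗ[k]
      (((stdRes k FAs).obj Δ).obj (op (inclDeltaS.obj X)) : Type u) :=
  Finsupp.lmapDomain k k ((nerveMap (Under.post (X := X) inclDeltaS)).app Δ)

theorem stdIncl_single {Δ : SimplexCategoryᵒᵖ} {X : DeltaS} (u : (nerve (Under X)).obj Δ) :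
    stdIncl k Δ X (stdSingle k DeltaS u) =
      stdSingle k FAs ((nerveMap (Under.post (X := X) inclDeltaS)).app Δ u) :=
  Finsupp.mapDomain_single

theorem stdIncl_map {Δ : SimplexCategoryᵒᵖ} {X Y : DeltaS} (f : X ⟶ Y)
    (g : ((stdRes k DeltaS).obj Δ).obj (op Y)) :
    stdIncl k Δ X (((stdRes k DeltaS).obj Δ).map f.op g) =
      ((stdRes k FAs).obj Δ).map (inclDeltaS.map f).op (stdIncl k Δ Y g) := by
  have : stdIncl k Δ X ∘ₗ (((stdRes k DeltaS).obj Δ).map f.op).hom =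
      (((stdRes k FAs).obj Δ).map (inclDeltaS.map f).op).hom ∘ₗ stdIncl k Δ Y := by
    refine std_hom_ext k fun u => ?_
    change stdIncl k Δ X (((stdRes k DeltaS).obj Δ).map f.op (stdSingle k DeltaS u)) =
      ((stdRes k FAs).obj Δ).map (inclDeltaS.map f).op (stdIncl k Δ Y (stdSingle k DeltaS u))
    rw [stdSingle_map, stdIncl_single, stdIncl_single, stdSingle_map]
    exact congrArg (fun F => stdSingle k FAs (Δ := Δ) (u ⋙ F)) (post_map f)
  exact LinearMap.congr_fun this g

theorem stdIncl_app {Δ Δ' : SimplexCategoryᵒᵖ} (θ : Δ ⟶ Δ') {X : DeltaS}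
    (g : ((stdRes k DeltaS).obj Δ).obj (op X)) :
    stdIncl k Δ' X (((stdRes k DeltaS).map θ).app (op X) g) =
      ((stdRes k FAs).map θ).app (op (inclDeltaS.obj X)) (stdIncl k Δ X g) := by
  have : stdIncl k Δ' X ∘ₗ (((stdRes k DeltaS).map θ).app (op X)).hom =
      (((stdRes k FAs).map θ).app (op (inclDeltaS.obj X))).hom ∘ₗ stdIncl k Δ X := by
    refine std_hom_ext k fun u => ?_
    change stdIncl k Δ' X (((stdRes k DeltaS).map θ).app (op X) (stdSingle k DeltaS u)) =
      ((stdRes k FAs).map θ).app (op (inclDeltaS.obj X)) (stdIncl k Δ X (stdSingle k DeltaS u))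
    rw [stdSingle_app, stdIncl_single, stdIncl_single, stdSingle_app]
    rfl
  exact LinearMap.congr_fun this g

/-- The simplicial `k`-module `k[N(- ∖ ΔS)] ⊗_{ΔS} B^{sym}_* A`. -/
noncomputable abbrev YDeltaS : SimplicialObject (ModuleCat.{u} k) := stdBar k (Bsym k A)

noncomputable def inclYAt (Δ : SimplexCategoryᵒᵖ) :
    TensorOver k ((stdRes k DeltaS).obj Δ) (Bsym k A) →ₗ[k] ((Yplus k A).obj Δ : Type u) :=
  TensorOver.lift (fun X => (Ymk k A Δ (inclDeltaS.obj X)).comp (stdIncl k Δ X)) fun X X' f g b =>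
    (congrArg (fun t => Ymk k A Δ (inclDeltaS.obj X) t b) (stdIncl_map k f g)).trans
      (Ymk_balanced k A (inclDeltaS.map f) (stdIncl k Δ X' g) b)

theorem inclYAt_mk {Δ : SimplexCategoryᵒᵖ} (X : DeltaS)
    (g : ((stdRes k DeltaS).obj Δ).obj (op X)) (b : (Bsym k A).obj X) :
    inclYAt k A Δ (TensorOver.mk ((stdRes k DeltaS).obj Δ) (Bsym k A) X g b) =
      Ymk k A Δ (inclDeltaS.obj X) (stdIncl k Δ X g) b := TensorOver.lift_mk _ _ _ _ _

/-- The map of simplicial modules induced by the inclusion of `ΔS` in `ΔS₊`. -/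
noncomputable def inclY : YDeltaS k A ⟶ Yplus k A where
  app Δ := ModuleCat.ofHom (inclYAt k A Δ)
  naturality Δ Δ' θ := by
    refine ModuleCat.hom_ext (TensorOver.hom_ext fun X g b => ?_)
    have h1 := (congrArg (inclYAt k A Δ') (TensorOver.map_mk ((stdRes k DeltaS).map θ) X g b)).trans
      (inclYAt_mk k A X _ b)
    have h2 := (congrArg ((Yplus k A).map θ) (inclYAt_mk k A X g b)).trans
      (Y_map_Ymk k A θ _ _ _)
    refine h1.trans (Eq.trans ?_ h2.symm)
    exact congrArg (fun t => Ymk k A Δ' (inclDeltaS.obj X) t b) (stdIncl_app k θ g)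

/-- The standard complex `k[N(- ∖ ΔS)]` of right `ΔS`-modules. -/
noncomputable abbrev stdComplex : ChainComplex (DeltaSᵒᵖ ⥤ ModuleCat.{u} k) ℕ :=
  (AlgebraicTopology.alternatingFaceMapComplex _).obj (stdRes k DeltaS)

/-- Tensoring the standard complex degreewise gives the complex of `YDeltaS`. -/
noncomputable def tensorStd :
    ((tensorFunctor k (Bsym k A)).mapHomologicalComplex _).obj (stdComplex k) ⟶
      (AlgebraicTopology.alternatingFaceMapComplex _).obj (YDeltaS k A) where
  f n := 𝟙 _
  comm' i j h := by
    have h : j + 1 = i := h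
    subst h
    refine (Category.id_comp _).trans (Eq.trans ?_ (Category.comp_id _).symm)
    rw [AlgebraicTopology.alternatingFaceMapComplex_obj_d,
      Functor.mapHomologicalComplex_obj_d, AlgebraicTopology.alternatingFaceMapComplex_obj_d,
      AlgebraicTopology.AlternatingFaceMapComplex.objD,
      AlgebraicTopology.AlternatingFaceMapComplex.objD, Functor.map_sum]
    simp only [Functor.map_zsmul]
    rfl

/-- The map `Tor_n^{ΔS}(k, B^{sym}_* A) → H_n(𝒩𝒴⁺_* A)` obtained from a projective resolution `P` of `k` and
a chain map `φ` from `P` to the standard complex. -/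
noncomputable def comparison (P : ProjectiveResolution
      ((Functor.const DeltaSᵒᵖ).obj (ModuleCat.of k k) : DeltaSᵒᵖ ⥤ ModuleCat.{u} k))
    (φ : P.complex ⟶ stdComplex k) (n : ℕ) : HS k A n ⟶ (NYplus k A).homology n :=
  (P.isoLeftDerivedObj (tensorFunctor k (Bsym k A)) n).hom ≫
    HomologicalComplex.homologyMap
      (((tensorFunctor k (Bsym k A)).mapHomologicalComplex _).map φ ≫ tensorStd k A ≫
        (AlgebraicTopology.alternatingFaceMapComplex _).map (inclY k A) ≫
          toNormalized k (Yplus k A)) n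

/-- The chain map `φ` lifts the identity of the constant module `k`. -/
def IsAugmented (P : ProjectiveResolution
      ((Functor.const DeltaSᵒᵖ).obj (ModuleCat.of k k) : DeltaSᵒᵖ ⥤ ModuleCat.{u} k))
    (φ : P.complex ⟶ stdComplex k) : Prop :=
  φ.f 0 ≫ stdAug k DeltaS = P.π.f 0 ≫ (HomologicalComplex.singleObjXSelf _ 0 _).hom

/-- The element of `HS_n(A)` represented by a cycle of `𝒩𝒴⁺_* A`. -/
noncomputable def cycleClass {k : Type u} [CommRing k] {A : Type u} [Ring A] [Algebra k A]
    (e : ∀ n, HS k A n ≅ (NYplus k A).homology n) (n : ℕ) (z : (NYplus k A).cycles n) : HS k A n :=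
  (e n).inv ((NYplus k A).homologyπ n z)

/-- The graded `k`-module `HS_*(A)`. -/
noncomputable abbrev HSStar : Type u := DirectSum ℕ fun n => (HS k A n : Type u)

/-- The homogeneous element of `HS_*(A)` given by `a ∈ HS_n(A)`. -/
noncomputable def HSof (n : ℕ) (a : HS k A n) : HSStar k A :=
  DirectSum.lof k ℕ (fun n => (HS k A n : Type u)) n a

end HS
end SymHom

universe u

/-!
Why the theorem holds.

**The isomorphism.** For each object `X` the category `X ∖ ΔS` has an initial object, so its nerve has
an extra degeneracy, and in each degree `k[N(- ∖ ΔS)]` is a sum of representable functors. Hence it is a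
projective resolution of the constant module `k` (`stdResolution`), and symmetric homology is the
homology of `k[N(- ∖ ΔS)] ⊗_{ΔS} B^{sym}_* A`. Passing to normalized chains is a homotopy equivalence
(`normalizedHomotopyEquiv`). The inclusion of `ΔS` in `ΔS₊` is not an equivalence, but the functor
`[0] ⊙ -` from `ΔS₊` to `ΔS` receives natural transformations `X → [0] ⊙ X` on both sides; on bar
constructions they give simplicial homotopies, so the inclusion induces an isomorphism in homology
(`homMap_push_eq_id`, `isIso_homMap_inclY`). Independence of the resolution and of the lift is the
comparison theorem for projective resolutions (`comparison_eq`).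

**The product.** The shuffle map is a natural external product in the homology of normalized complexes:
it is compatible with the differentials (`d_Sh_eq_zero`), associative (`shH_assoc`) and graded-commutative
(`shH_comm`). These are statements about maximal chains in products of linear orders: the sign of a
shuffle is given by the area on one side of its lattice path, faces in corners cancel in pairs, and a
threefold path factors uniquely through two planar ones.

A vertex `σ` of `E S₂` makes the structure map into a simplicial map `chiC σ : 𝒴⁺ ⊗̂ 𝒴⁺ ⟶ 𝒴⁺`. At the
identity it is strictly associative and unital, because `⊙` is; at the transposition it is the product at
the identity with its factors exchanged, since a block permutation in the target of an under-category
can be moved through the tensor product over `ΔS₊` into the coefficients (`chiAtConst_of_ne_one`). External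
multiplication by a `0`-chain is induced by a simplicial map, and the two ends of an edge are homologous
(`homMap_hatLeft_comp`, `class₀_simp1_eq`); so the edge of `E S₂` between its two vertices identifies their
products in homology, which is graded commutativity. Every `0`-chain of `𝒟_ch(2)` of augmentation `1` is
homologous to a vertex (`class₀_eq_smul`), which gives the independence of `c`.
-/

namespace SymHom
open scoped TensorProduct Simplicial

/-! ### Shuffles as lattice paths -/

namespace Shuffle

variable {p q n : ℕ}

theorem fst_mono (s : Shuffle p q n) {i j : Fin (n + 1)} (h : i ≤ j) :
    (s.fst i).val ≤ (s.fst j).val := s.fst.toOrderHom.monotone h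

theorem snd_mono (s : Shuffle p q n) {i j : Fin (n + 1)} (h : i ≤ j) :
    (s.snd i).val ≤ (s.snd j).val := s.snd.toOrderHom.monotone h

/-- A maximal chain of `[p] × [q]` passes through exactly one point of each rank. -/
theorem fst_add_snd (s : Shuffle p q n) (h : p + q = n) (i : Fin (n + 1)) :
    (s.fst i).val + (s.snd i).val = i.val := by
  have hlt : ∀ j : Fin n, (s.fst j.castSucc).val + (s.snd j.castSucc).val <
      (s.fst j.succ).val + (s.snd j.succ).val := fun j => by
    have h1 := s.fst_mono (Fin.castSucc_lt_succ (i := j)).le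
    have h2 := s.snd_mono (Fin.castSucc_lt_succ (i := j)).le
    have h3 : ¬ ((s.fst j.castSucc).val = (s.fst j.succ).val ∧
        (s.snd j.castSucc).val = (s.snd j.succ).val) := fun h =>
      (Fin.castSucc_lt_succ (i := j)).ne (s.injective (Prod.ext (Fin.ext h.1) (Fin.ext h.2)))
    omega
  have hlow : ∀ j : Fin (n + 1), (j : ℕ) ≤ (s.fst j).val + (s.snd j).val := fun j => by
    induction j using Fin.induction with
    | zero => simp
    | succ j ih => have := hlt j; simp only [Fin.val_castSucc, Fin.val_succ] at *; omega
  have hup : ∀ j : Fin (n + 1), (s.fst j).val + (s.snd j).val ≤ (j : ℕ) := fun j => by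
    induction j using Fin.reverseInduction with
    | last =>
      have := (s.fst (Fin.last n)).isLt; have := (s.snd (Fin.last n)).isLt
      simp only [Fin.val_last]; simp only [SimplexCategory.len_mk] at *; omega
    | cast j ih => have := hlt j; simp only [Fin.val_castSucc, Fin.val_succ] at *; omega
  exact le_antisymm (hup i) (hlow i)

theorem fst_succ_le (s : Shuffle p q n) (h : p + q = n) (j : Fin n) :
    (s.fst j.succ).val ≤ (s.fst j.castSucc).val + 1 := by
  have h1 := s.fst_add_snd h j.castSucc
  have h2 := s.fst_add_snd h j.succ
  have h3 := s.snd_mono (Fin.castSucc_lt_succ (i := j)).le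
  simp only [Fin.val_castSucc, Fin.val_succ] at *
  omega

theorem ext_fst (h : p + q = n) {s t : Shuffle p q n}
    (hst : ∀ i, (s.fst i).val = (t.fst i).val) : s = t := by
  have h1 : s.fst = t.fst := by ext i : 3; exact Fin.ext (hst i)
  have h2 : s.snd = t.snd := by
    ext i : 3
    refine Fin.ext ?_
    have := s.fst_add_snd h i; have := t.fst_add_snd h i; have := hst i
    change (s.snd i).val = (t.snd i).val
    omega
  obtain ⟨a, b, _⟩ := s; obtain ⟨c, d, _⟩ := t
  obtain rfl : a = c := h1
  obtain rfl : b = d := h2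
  rfl

/-- A lattice path, given by its first coordinate `a`, as a shuffle. -/
def ofPath (h : p + q = n) (a : ℕ → ℕ) (h0 : a 0 = 0) (hn : a n = p)
    (hle : ∀ m < n, a m ≤ a (m + 1)) (hsucc : ∀ m < n, a (m + 1) ≤ a m + 1) : Shuffle p q n :=
  have mono : ∀ d m : ℕ, m + d ≤ n → a m ≤ a (m + d) ∧ a (m + d) ≤ a m + d := fun d => by
    induction d with
    | zero => intro m _; simp
    | succ d ih =>
      intro m hm
      have h1 := ih m (by omega); have h2 := hle (m + d) (by omega)
      have h3 := hsucc (m + d) (by omega)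
      simp only [← Nat.add_assoc]; omega
  have mono' : ∀ i j : Fin (n + 1), i ≤ j → a i ≤ a j ∧ a j ≤ a i + (j - i) := fun i j hij => by
    have := mono (j - i) i (by have := j.isLt; omega)
    rwa [Nat.add_sub_cancel' (Fin.le_def.1 hij)] at this
  have le_self : ∀ i : Fin (n + 1), a i ≤ i := fun i => by
    have := (mono' 0 i (Fin.zero_le i)).2
    simpa [h0] using this
  have top : ∀ i : Fin (n + 1), a i ≤ p ∧ p ≤ a i + (n - i) := fun i => by
    have := mono' i (Fin.last n) (Fin.le_last i)
    simpa [hn] using this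
  { fst := SimplexCategory.mkHom ⟨fun i => ⟨a i, by have := top i; omega⟩,
      fun i j hij => (mono' i j hij).1⟩
    snd := SimplexCategory.mkHom ⟨fun i => ⟨i - a i, by have := top i; have := i.isLt; omega⟩,
      fun i j hij => by
        have := mono' i j hij; have := le_self i; have := le_self j
        have : (i : ℕ) ≤ j := hij
        change (i : ℕ) - a i ≤ j - a j
        omega⟩
    injective := fun i j hij => by
      have h1 : a i = a j := congrArg Fin.val (Prod.mk.inj hij).1
      have h2 : (i : ℕ) - a i = j - a j := congrArg Fin.val (Prod.mk.inj hij).2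
      have := le_self i; have := le_self j
      exact Fin.ext (by omega) }

theorem fst_zero (s : Shuffle p q n) (h : p + q = n) : (s.fst 0).val = 0 := by
  have := s.fst_add_snd h 0; simp only [Fin.val_zero] at this; omega

theorem fst_last (s : Shuffle p q n) (h : p + q = n) : (s.fst (Fin.last n)).val = p := by
  have := s.fst_add_snd h (Fin.last n)
  have := (s.fst (Fin.last n)).isLt; have := (s.snd (Fin.last n)).isLt
  simp only [Fin.val_last, SimplexCategory.len_mk] at *; omega

/-- The area `∑ (α (i + 1) - α i) * β i` on one side of the path `(α, β)`. -/
def area (α : ⦋n⦌ ⟶ ⦋p⦌) (β : ⦋n⦌ ⟶ ⦋q⦌) : ℕ :=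
  ∑ i : Fin n, ((α i.succ).val - (α i.castSucc).val) * (β i.castSucc).val

/-- The number of inversions of a shuffle is the area on one side of its lattice path: the number of
second steps before `i` is the second coordinate of the `i`-th point. -/
theorem inversions_eq_area (s : Shuffle p q n) (h : p + q = n) :
    s.inversions = area s.fst s.snd := by
  classical
  have hE (i : Fin (n + 1)) : ∑ j : Fin n with j.val < i.val,
      (if s.snd j.castSucc ≠ s.snd j.succ then 1 else 0) = (s.snd i).val := by
    induction i using Fin.induction with
    | zero =>
      have := s.fst_add_snd h 0
      rw [Finset.filter_false_of_mem (fun j _ => by simp), Finset.sum_empty]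
      simp only [Fin.val_zero] at this
      omega
    | succ i ih =>
      have e : (Finset.univ.filter fun j : Fin n => j.val < i.succ.val) =
          insert i (Finset.univ.filter fun j : Fin n => j.val < i.castSucc.val) := by
        ext j
        simp only [Finset.mem_filter, Finset.mem_univ, true_and, Finset.mem_insert, Fin.val_succ,
          Fin.val_castSucc, Fin.ext_iff]
        omega
      rw [e, Finset.sum_insert (by simp), ih]
      have h1 := s.fst_add_snd h i.castSucc; have h2 := s.fst_add_snd h i.succ
      have h3 := s.fst_mono (Fin.castSucc_lt_succ (i := i)).le
      have h4 := s.snd_mono (Fin.castSucc_lt_succ (i := i)).le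
      simp only [Fin.val_castSucc, Fin.val_succ] at h1 h2
      by_cases hc : s.snd i.castSucc = s.snd i.succ
      · rw [if_neg (not_not.2 hc), hc, Nat.zero_add]
      · have : (s.snd i.castSucc).val ≠ (s.snd i.succ).val := fun h => hc (Fin.ext h)
        rw [if_pos hc]
        omega
  rw [inversions, Finset.card_filter, ← Finset.univ_product_univ, Finset.sum_product, area]
  refine Finset.sum_congr rfl fun i _ => ?_
  have h3 := s.fst_mono (Fin.castSucc_lt_succ (i := i)).le
  have h4 := s.fst_succ_le h i
  rw [← hE i.castSucc, Finset.sum_filter]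
  by_cases hc : s.fst i.castSucc = s.fst i.succ
  · rw [← hc, Nat.sub_self, Nat.zero_mul]
    exact Finset.sum_eq_zero fun j _ => if_neg fun h => h.2.1 hc
  · have hc' : (s.fst i.castSucc).val ≠ (s.fst i.succ).val := fun h => hc (Fin.ext h)
    rw [show (s.fst i.succ).val - (s.fst i.castSucc).val = 1 by omega, Nat.one_mul]
    refine Finset.sum_congr rfl fun j _ => ?_
    rw [← ite_and]
    exact if_congr ⟨fun h => ⟨h.1, h.2.2⟩, fun h => ⟨h.1, hc, h.2⟩⟩ rfl rfl

/-- Partial summation relates the area to the sum of the first coordinates of the path. -/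
theorem inversions_add_sum (s : Shuffle p q n) (h : p + q = n) :
    s.inversions + ∑ i : Fin (n + 1), (s.fst i).val + p.choose 2 = n * p := by
  have key (N : Fin (n + 1)) :
      ∑ i : Fin n with i.val < N.val,
        ((s.fst i.succ).val - (s.fst i.castSucc).val) * (s.snd i.castSucc).val +
        ∑ i : Fin (n + 1) with i.val ≤ N.val, (s.fst i).val + (s.fst N).val.choose 2 =
      N * (s.fst N).val := by
    induction N using Fin.induction with
    | zero =>
      have h0 := s.fst_zero h
      have e : (Finset.univ.filter fun i : Fin (n + 1) => i.val ≤ (0 : Fin (n + 1)).val) = {0} := by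
        ext i
        rw [Finset.mem_filter, Finset.mem_singleton, Fin.ext_iff, Fin.val_zero]
        simp
      rw [e, Finset.filter_false_of_mem (fun j _ => by simp), Finset.sum_singleton, h0]
      simp
    | succ i ih =>
      have e1 : (Finset.univ.filter fun j : Fin n => j.val < i.succ.val) =
          insert i (Finset.univ.filter fun j : Fin n => j.val < i.castSucc.val) := by
        ext j
        simp only [Finset.mem_filter, Finset.mem_univ, true_and, Finset.mem_insert, Fin.val_succ,
          Fin.val_castSucc, Fin.ext_iff]
        omega
      have e2 : (Finset.univ.filter fun j : Fin (n + 1) => j.val ≤ i.succ.val) =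
          insert i.succ (Finset.univ.filter fun j : Fin (n + 1) => j.val ≤ i.castSucc.val) := by
        ext j
        simp only [Finset.mem_filter, Finset.mem_univ, true_and, Finset.mem_insert, Fin.val_succ,
          Fin.val_castSucc, Fin.ext_iff]
        omega
      rw [e1, e2, Finset.sum_insert (by simp), Finset.sum_insert (by simp)]
      have h1 := s.fst_add_snd h i.castSucc
      have h3 := s.fst_mono (Fin.castSucc_lt_succ (i := i)).le
      have h4 := s.fst_succ_le h i
      simp only [Fin.val_castSucc, Fin.val_succ] at h1 ih ⊢
      by_cases hc : (s.fst i.succ).val = (s.fst i.castSucc).val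
      · rw [hc, Nat.sub_self, Nat.zero_mul, Nat.succ_mul]
        omega
      · have hc' : (s.fst i.succ).val = (s.fst i.castSucc).val + 1 := by omega
        rw [hc', Nat.add_sub_cancel_left, Nat.one_mul, Nat.choose_succ_succ' _ 1,
          Nat.choose_one_right]
        simp only [Nat.reduceAdd]
        have : (i.val + 1) * ((s.fst i.castSucc).val + 1) =
          i.val * (s.fst i.castSucc).val + i.val + (s.fst i.castSucc).val + 1 := by ring
        omega
  have := key (Fin.last n)
  rw [Finset.filter_true_of_mem (fun i _ => i.isLt),
    Finset.filter_true_of_mem (fun i _ => Fin.le_def.1 (Fin.le_last i)), s.fst_last h,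
    Fin.val_last] at this
  rw [s.inversions_eq_area h]
  exact this

/-- Exchange of the two coordinates. -/
def swap (s : Shuffle p q n) : Shuffle q p n where
  fst := s.snd
  snd := s.fst
  injective _ _ h := s.injective (Prod.ext (Prod.mk.inj h).2 (Prod.mk.inj h).1)

/-- Exchange of the two coordinates, as a bijection. -/
def swapEquiv (p q n : ℕ) : Shuffle p q n ≃ Shuffle q p n where
  toFun := swap
  invFun := swap
  left_inv _ := rfl
  right_inv _ := rfl

/-- The two areas on either side of a lattice path fill the rectangle. -/
theorem inversions_swap (s : Shuffle p q n) (h : p + q = n) :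
    s.inversions + s.swap.inversions = p * q := by
  have h1 := s.inversions_add_sum h
  have h2 := s.swap.inversions_add_sum ((Nat.add_comm q p).trans h)
  have h3 : ∑ i : Fin (n + 1), (s.fst i).val + ∑ i : Fin (n + 1), (s.swap.fst i).val =
      n * (n + 1) / 2 := by
    rw [← Finset.sum_add_distrib]
    refine (Finset.sum_congr rfl fun i _ => s.fst_add_snd h i).trans ?_
    rw [Fin.sum_univ_eq_sum_range (fun i => i), Finset.sum_range_id, Nat.add_sub_cancel,
      Nat.mul_comm]
  have h4 : n * (n + 1) / 2 * 2 = n * (n + 1) :=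
    Nat.div_mul_cancel (Nat.even_mul_succ_self n).two_dvd
  have h5 (m : ℕ) : (m.choose 2 : ℤ) * 2 = m * (m - 1) := by
    cases m with
    | zero => simp
    | succ m =>
      have h := Finset.sum_range_id_mul_two (m + 1)
      rw [Finset.sum_range_id, ← Nat.choose_two_right] at h
      zify at h
      simpa using h
  have h6 := h5 p
  have h7 := h5 q
  subst h
  zify at *
  nlinarith

/-- The signs of a shuffle and of its transpose differ by the Koszul sign. -/
theorem sign_swap (s : Shuffle p q n) (h : p + q = n) :
    (-1 : ℤ) ^ s.swap.inversions = (-1) ^ (p * q) * (-1) ^ s.inversions := by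
  rw [← s.inversions_swap h, pow_add]
  have : ((-1 : ℤ) ^ s.inversions) * (-1) ^ s.inversions = 1 := by
    rw [← mul_pow]; simp
  linear_combination (-(-1 : ℤ) ^ s.swap.inversions) * this

end Shuffle
end SymHom

namespace SymHom
open scoped TensorProduct Simplicial

namespace Shuffle

variable {p q n : ℕ}

/-! ### Faces of shuffles -/

/-- Omitting the `i`-th point of the path removes a column of the grid. -/
def IsCol (s : Shuffle p q (n + 1)) (i : Fin (n + 2)) : Prop :=
  ∀ m : Fin (n + 1), s.fst (i.succAbove m) ≠ s.fst i

/-- The omitted index can be read off from the ranks of the remaining points. -/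
theorem index_eq_of_face_eq (h : p + q = n + 1) {s t : Shuffle p q (n + 1)}
    {i j : Fin (n + 2)}
    (h1 : SimplexCategory.δ i ≫ s.fst = SimplexCategory.δ j ≫ t.fst)
    (h2 : SimplexCategory.δ i ≫ s.snd = SimplexCategory.δ j ≫ t.snd) : i = j := by
  refine Fin.succAbove_left_injective (funext fun m => Fin.ext ?_)
  have e1 : s.fst (i.succAbove m) = t.fst (j.succAbove m) :=
    congrArg (fun f : ⦋n⦌ ⟶ ⦋p⦌ => f m) h1
  have e2 : s.snd (i.succAbove m) = t.snd (j.succAbove m) :=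
    congrArg (fun f : ⦋n⦌ ⟶ ⦋q⦌ => f m) h2
  rw [← s.fst_add_snd h, ← t.fst_add_snd h, e1, e2]

theorem eq_of_face_eq (h : p + q = n + 1) {s t : Shuffle p q (n + 1)} {i : Fin (n + 2)}
    (h1 : SimplexCategory.δ i ≫ s.fst = SimplexCategory.δ i ≫ t.fst)
    (h2 : s.fst i = t.fst i) : s = t := by
  refine ext_fst h fun k => ?_
  obtain rfl | ⟨m, rfl⟩ := Fin.eq_self_or_eq_succAbove i k
  · rw [h2]
  · exact congrArg (fun f : ⦋n⦌ ⟶ ⦋p⦌ => (f m).val) h1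

theorem val_succAbove_of_lt {N : ℕ} (i : Fin (N + 1)) (m : Fin N) (h : m.val < i.val) :
    (i.succAbove m).val = m.val := by
  rw [Fin.succAbove_of_castSucc_lt _ _ (Fin.lt_def.2 (by simpa using h)), Fin.val_castSucc]

theorem val_succAbove_of_le {N : ℕ} (i : Fin (N + 1)) (m : Fin N) (h : i.val ≤ m.val) :
    (i.succAbove m).val = m.val + 1 := by
  rw [Fin.succAbove_of_le_castSucc _ _ (Fin.le_def.2 (by simpa using h)), Fin.val_succ]

/-- Insertion of a column in a lattice path. -/
theorem exists_insert (h : p + q = n) (s : Shuffle p q n) (j : Fin (p + 2)) :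
    ∃ (t : Shuffle (p + 1) q (n + 1)) (i : Fin (n + 2)),
      SimplexCategory.δ i ≫ t.fst = s.fst ≫ SimplexCategory.δ j ∧
      SimplexCategory.δ i ≫ t.snd = s.snd ∧ t.fst i = j := by
  have h' : p + 1 + q = n + 1 := by omega
  -- the given path, prolonged by one step in the first direction
  let a : ℕ → ℕ := fun m => if hm : m < n + 1 then (s.fst ⟨m, hm⟩).val else p + 1
  have ha (m) (hm : m < n + 1) : a m = (s.fst ⟨m, hm⟩).val := dif_pos hm
  have han : a (n + 1) = p + 1 := dif_neg (by omega)
  have ha0 : a 0 = 0 := (ha 0 (by omega)).trans (s.fst_zero h)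
  have hap : a n = p := (ha n (by omega)).trans (s.fst_last h)
  have hstep (m) (hm : m < n + 1) : a m ≤ a (m + 1) ∧ a (m + 1) ≤ a m + 1 := by
    rcases Nat.lt_succ_iff_lt_or_eq.1 hm with hm' | rfl
    · rw [ha m (by omega), ha (m + 1) (by omega)]
      exact ⟨s.fst_mono (Fin.le_def.2 (Nat.le_succ m)), s.fst_succ_le h ⟨m, hm'⟩⟩
    · omega
  have mono : ∀ d m : ℕ, m + d ≤ n + 1 → a m ≤ a (m + d) := fun d => by
    induction d with
    | zero => intro m _; exact le_rfl
    | succ d ih =>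
      intro m hm
      exact (ih m (by omega)).trans (hstep (m + d) (by omega)).1
  have mono' : ∀ m m' : ℕ, m ≤ m' → m' ≤ n + 1 → a m ≤ a m' := fun m m' h1 h2 => by
    have := mono (m' - m) m (by omega)
    rwa [Nat.add_sub_cancel' h1] at this
  classical
  have hex : ∃ i, i ≤ n + 1 ∧ j.val ≤ a i := ⟨n + 1, le_rfl, by have := j.isLt; omega⟩
  -- the new point comes immediately before the first point whose column is at least `j`
  obtain ⟨hi, hij⟩ := Nat.find_spec hex
  have hmin := fun m hm => Nat.find_min hex (m := m) hm
  generalize Nat.find hex = i at hi hij hmin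
  have hai : a i = j := by
    cases i with
    | zero => omega
    | succ i =>
      have h1 := (hstep i (by omega)).2
      have h2 : ¬ (i ≤ n + 1 ∧ j.val ≤ a i) := hmin i (by omega)
      omega
  let c : ℕ → ℕ := fun m => if m ≤ i then a m else a (m - 1) + 1
  have hc1 (m) (hm : m ≤ i) : c m = a m := if_pos hm
  have hc2 (m) (hm : i ≤ m) : c (m + 1) = a m + 1 := by
    rw [show c (m + 1) = a (m + 1 - 1) + 1 from if_neg (by omega), Nat.add_sub_cancel]
  have hcstep (m) (hm : m < n + 1) : c m ≤ c (m + 1) ∧ c (m + 1) ≤ c m + 1 := by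
    rcases lt_trichotomy m i with hmi | rfl | hmi
    · rw [hc1 m hmi.le, hc1 (m + 1) hmi]; exact hstep m hm
    · rw [hc1 m le_rfl, hc2 m le_rfl]; omega
    · obtain ⟨m, rfl⟩ : ∃ m', m = m' + 1 := ⟨m - 1, by omega⟩
      rw [hc2 m (by omega), hc2 (m + 1) (by omega)]
      have := hstep m (by omega)
      omega
  have hcn : c (n + 1) = p + 1 := by
    rcases Nat.lt_succ_iff_lt_or_eq.1 (Nat.lt_succ_of_le hi) with hi' | rfl
    · rw [hc2 n (by omega), hap]
    · rw [hc1 _ le_rfl, han]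
  let t : Shuffle (p + 1) q (n + 1) := ofPath h' c ((hc1 0 (Nat.zero_le _)).trans ha0) hcn
    (fun m hm => (hcstep m hm).1) fun m hm => (hcstep m hm).2
  let i' : Fin (n + 2) := ⟨i, by omega⟩
  have e1 : SimplexCategory.δ i' ≫ t.fst = s.fst ≫ SimplexCategory.δ j := by
    ext m : 3
    refine Fin.ext ?_
    change c (i'.succAbove m) = (j.succAbove (s.fst m)).val
    have hm : a m = (s.fst m).val := ha m m.isLt
    have hm' : m.val < n + 1 := m.isLt
    rcases lt_or_ge m.val i with hmi | hmi
    · have : ¬ (m.val ≤ n + 1 ∧ j.val ≤ a m) := hmin m hmi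
      rw [val_succAbove_of_lt i' m hmi, hc1 _ hmi.le, val_succAbove_of_lt j (s.fst m) (by omega),
        hm]
    · have := mono' i m hmi hm'.le
      rw [val_succAbove_of_le i' m hmi, hc2 _ hmi, val_succAbove_of_le j (s.fst m) (by omega), hm]
  refine ⟨t, i', e1, ?_, Fin.ext ((hc1 i le_rfl).trans hai)⟩
  ext m : 3
  refine Fin.ext ?_
  have e2 : (t.fst (i'.succAbove m)).val = (j.succAbove (s.fst m)).val :=
    congrArg (fun f : ⦋n⦌ ⟶ ⦋p + 1⦌ => (f m).val) e1
  have h1 := t.fst_add_snd h' (i'.succAbove m)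
  have h2 := s.fst_add_snd h m
  change (t.snd (i'.succAbove m)).val = (s.snd m).val
  have hm : a m = (s.fst m).val := ha m m.isLt
  rcases lt_or_ge m.val i with hmi | hmi
  · have e3 : (i'.succAbove m).val = m :=
      val_succAbove_of_lt i' m hmi
    have e4 : (t.fst (i'.succAbove m)).val = a m := by
      change c (i'.succAbove m).val = a m
      rw [e3, hc1 _ hmi.le]
    omega
  · have e3 : (i'.succAbove m).val = m + 1 :=
      val_succAbove_of_le i' m hmi
    have e4 : (t.fst (i'.succAbove m)).val = a m + 1 := by
      change c (i'.succAbove m).val = a m + 1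
      rw [e3, hc2 _ hmi]
    omega

theorem val_succAbove_add {N M : ℕ} (i : Fin (N + 1)) (m : Fin N) (j : Fin (M + 1)) (v : Fin M)
    (hiff : i.val ≤ m.val ↔ j.val ≤ v.val) :
    (j.succAbove v).val + m.val = v.val + (i.succAbove m).val := by
  by_cases hm : i.val ≤ m.val
  · rw [val_succAbove_of_le i m hm, val_succAbove_of_le j v (hiff.1 hm)]
    omega
  · rw [val_succAbove_of_lt i m (not_le.1 hm), val_succAbove_of_lt j v (not_le.1 (mt hiff.2 hm))]

/-- The sign of a shuffle after insertion of the column `j` at the point `i` of the path. -/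
theorem inversions_insert (h : p + q = n) (s : Shuffle p q n) (j : Fin (p + 2))
    (t : Shuffle (p + 1) q (n + 1)) (i : Fin (n + 2))
    (e1 : SimplexCategory.δ i ≫ t.fst = s.fst ≫ SimplexCategory.δ j) (e2 : t.fst i = j) :
    t.inversions + j = s.inversions + i := by
  have h1 := s.inversions_add_sum h
  have h2 := t.inversions_add_sum (by omega)
  have e3 (m : Fin (n + 1)) : (t.fst (i.succAbove m)).val = (j.succAbove (s.fst m)).val :=
    congrArg (fun f : ⦋n⦌ ⟶ ⦋p + 1⦌ => (f m).val) e1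
  have key (m : Fin (n + 1)) :
      (t.fst (i.succAbove m)).val + m.val = (s.fst m).val + (i.succAbove m).val := by
    rw [e3]
    refine val_succAbove_add i m j (s.fst m) ?_
    constructor
    · intro hm
      by_contra hc
      have h3 : (j.succAbove (s.fst m)).val = (s.fst m).val :=
        val_succAbove_of_lt _ _ (not_le.1 hc)
      have h4 : (t.fst i).val ≤ (t.fst (i.succAbove m)).val := t.fst_mono
        (Fin.le_def.2 (by rw [val_succAbove_of_le i m hm]; omega))
      rw [e3, e2] at h4
      omega
    · intro hv
      by_contra hc
      have h3 : (j.succAbove (s.fst m)).val = (s.fst m).val + 1 :=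
        val_succAbove_of_le _ _ hv
      have h4 : (t.fst (i.succAbove m)).val ≤ (t.fst i).val := t.fst_mono
        (Fin.le_def.2 (by rw [val_succAbove_of_lt i m (not_le.1 hc)]; omega))
      rw [e3, e2] at h4
      omega
  have h3 := Finset.sum_congr rfl fun m (_ : m ∈ Finset.univ) => key m
  rw [Finset.sum_add_distrib, Finset.sum_add_distrib] at h3
  have h4 := Fin.sum_univ_succAbove (fun k => (t.fst k).val) i
  have h5 := Fin.sum_univ_succAbove (fun k : Fin (n + 2) => k.val) i
  have h6 := Fin.sum_univ_castSucc (fun k : Fin (n + 2) => k.val)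
  simp only [Fin.val_castSucc, Fin.val_last] at h6
  have h7 : (p + 1).choose 2 = p + p.choose 2 := by
    rw [Nat.choose_succ_succ' p 1, Nat.choose_one_right]
  rw [e2] at h4
  have h8 : (n + 1) * (p + 1) = n * p + n + p + 1 := by ring
  simp only [SimplexCategory.len_mk] at *
  omega

theorem isCol_of_eq {s : Shuffle p q n} {j : Fin (p + 2)}
    {t : Shuffle (p + 1) q (n + 1)} {i : Fin (n + 2)}
    (e1 : SimplexCategory.δ i ≫ t.fst = s.fst ≫ SimplexCategory.δ j) (e2 : t.fst i = j) :
    t.IsCol i := fun m => by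
  have e3 : t.fst (i.succAbove m) = j.succAbove (s.fst m) :=
    congrArg (fun f : ⦋n⦌ ⟶ ⦋p + 1⦌ => f m) e1
  rw [e3, e2]
  exact Fin.succAbove_ne _ _

/-- The shuffle left when a column is removed. -/
noncomputable def removeCol (t : Shuffle (p + 1) q (n + 1)) (i : Fin (n + 2)) (hti : t.IsCol i) :
    Shuffle p q n where
  fst := SimplexCategory.factor_δ (SimplexCategory.δ i ≫ t.fst) (t.fst i)
  snd := SimplexCategory.δ i ≫ t.snd
  injective a b hab := by
    have h1 := congrArg (SimplexCategory.δ (n := p) (t.fst i)) (Prod.mk.inj hab).1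
    have e := SimplexCategory.factor_δ_spec (SimplexCategory.δ i ≫ t.fst) (t.fst i) hti
    have e' (m : Fin (n + 1)) := congrArg (fun f : ⦋n⦌ ⟶ ⦋p + 1⦌ => f m) e
    have h2 : t.fst (i.succAbove a) = t.fst (i.succAbove b) := (e' a).symm.trans (h1.trans (e' b))
    have h3 : t.snd (i.succAbove a) = t.snd (i.succAbove b) := (Prod.mk.inj hab).2
    exact Fin.succAbove_right_injective (t.injective (Prod.ext h2 h3))

theorem removeCol_fst (t : Shuffle (p + 1) q (n + 1)) (i : Fin (n + 2)) (hti : t.IsCol i) :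
    SimplexCategory.δ i ≫ t.fst = (t.removeCol i hti).fst ≫ SimplexCategory.δ (t.fst i) :=
  (SimplexCategory.factor_δ_spec (SimplexCategory.δ i ≫ t.fst) (t.fst i) hti).symm

section sums
variable {M : Type*} [AddCommGroup M]

open Classical in
/-- The faces of shuffles which remove a column assemble to the shuffles of the faces. -/
theorem sum_isCol (h : p + q = n) (T : (⦋n⦌ ⟶ ⦋p + 1⦌) → (⦋n⦌ ⟶ ⦋q⦌) → M) :
    ∑ x : Shuffle (p + 1) q (n + 1) × Fin (n + 2) with x.1.IsCol x.2,
      ((-1 : ℤ) ^ (x.2 : ℕ) * (-1) ^ x.1.inversions) •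
        T (SimplexCategory.δ x.2 ≫ x.1.fst) (SimplexCategory.δ x.2 ≫ x.1.snd) =
    ∑ y : Shuffle p q n × Fin (p + 2), ((-1 : ℤ) ^ (y.2 : ℕ) * (-1) ^ y.1.inversions) •
      T (y.1.fst ≫ SimplexCategory.δ y.2) y.1.snd := by
  refine Finset.sum_bij (fun x hx => (x.1.removeCol x.2 (Finset.mem_filter.1 hx).2, x.1.fst x.2))
    (fun _ _ => Finset.mem_univ _) ?_ ?_ ?_
  · rintro ⟨t, i⟩ hx ⟨t', i'⟩ hx' hxx
    have h1 := t.removeCol_fst i (Finset.mem_filter.1 hx).2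
    have h1' := t'.removeCol_fst i' (Finset.mem_filter.1 hx').2
    obtain ⟨h2, h3⟩ := Prod.mk.inj hxx
    have h4 : SimplexCategory.δ i ≫ t.fst = SimplexCategory.δ i' ≫ t'.fst := by
      rw [h1, h1', h2, h3]
    have h5 : SimplexCategory.δ i ≫ t.snd = SimplexCategory.δ i' ≫ t'.snd :=
      congrArg Shuffle.snd h2
    obtain rfl := index_eq_of_face_eq (by omega) h4 h5
    obtain rfl := eq_of_face_eq (by omega) h4 h3
    rfl
  · rintro ⟨s, j⟩ -
    obtain ⟨t, i, e1, e2, e3⟩ := s.exists_insert h j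
    have hti : t.IsCol i := isCol_of_eq e1 e3
    refine ⟨(t, i), Finset.mem_filter.2 ⟨Finset.mem_univ _, hti⟩, Prod.ext ?_ e3⟩
    refine ext_fst h fun m => ?_
    have h1 := t.removeCol_fst i hti
    rw [e1, e3] at h1
    exact congrArg (fun f : ⦋n⦌ ⟶ ⦋p⦌ => (f m).val) ((cancel_mono _).1 h1).symm
  · rintro ⟨t, i⟩ hx
    have hti := (Finset.mem_filter.1 hx).2
    have h1 := inversions_insert h _ _ t i (t.removeCol_fst i hti) rfl
    simp only
    rw [← t.removeCol_fst i hti, ← pow_add, ← pow_add]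
    congr 1
    refine neg_one_pow_congr ?_
    rw [Nat.even_iff, Nat.even_iff]
    omega

end sums
end Shuffle
end SymHom

namespace SymHom
open scoped TensorProduct Simplicial

/-! ### Corners of lattice paths -/

namespace Shuffle

variable {p q n : ℕ}

/-- A point of a path whose omission removes neither a row nor a column is a corner. -/
theorem corner_iff (h : p + q = n + 1) (s : Shuffle p q (n + 1)) (i : Fin (n + 2)) :
    (¬ s.IsCol i ∧ ¬ s.swap.IsCol i) ↔ ∃ k l : Fin (n + 2), k.val + 1 = i.val ∧ i.val + 1 = l.val ∧
      (s.fst l).val = (s.fst k).val + 1 := by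
  have hr := s.fst_add_snd h
  constructor
  · rintro ⟨h1, h2⟩
    simp only [IsCol, not_forall, not_not] at h1 h2
    obtain ⟨m, hm⟩ := h1
    obtain ⟨m', hm'⟩ := h2
    have hm : (s.fst (i.succAbove m)).val = (s.fst i).val := congrArg Fin.val hm
    have hm' : (s.snd (i.succAbove m')).val = (s.snd i).val := congrArg Fin.val hm'
    have hlow (m : Fin (n + 1)) (hmi : m.val < i.val) : ∃ k : Fin (n + 2), k.val + 1 = i.val ∧
        i.succAbove m ≤ k ∧ k ≤ i :=
      ⟨⟨i.val - 1, by omega⟩, by simp only; omega, Fin.le_def.2 (by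
        rw [val_succAbove_of_lt i m hmi]; simp only; omega), Fin.le_def.2 (by simp only; omega)⟩
    have hhigh (m : Fin (n + 1)) (hmi : i.val ≤ m.val) : ∃ l : Fin (n + 2), i.val + 1 = l.val ∧
        l ≤ i.succAbove m ∧ i ≤ l :=
      ⟨⟨i.val + 1, by omega⟩, rfl, Fin.le_def.2 (by
        rw [val_succAbove_of_le i m hmi]; simp only; omega), Fin.le_def.2 (by simp only; omega)⟩
    rcases lt_or_ge m.val i.val with hmi | hmi <;> rcases lt_or_ge m'.val i.val with hmi' | hmi'
    · obtain ⟨k, hk, hk1, hk2⟩ := hlow m hmi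
      obtain ⟨k', hk', hk1', hk2'⟩ := hlow m' hmi'
      obtain rfl : k = k' := Fin.ext (by omega)
      have := s.fst_mono hk1; have := s.fst_mono hk2
      have := s.snd_mono hk1'; have := s.snd_mono hk2
      have := hr k; have := hr i
      omega
    · obtain ⟨k, hk, hk1, hk2⟩ := hlow m hmi
      obtain ⟨l, hl, hl1, hl2⟩ := hhigh m' hmi'
      refine ⟨k, l, hk, hl, ?_⟩
      have := s.fst_mono hk1; have := s.fst_mono hk2
      have := s.snd_mono hl1; have := s.snd_mono hl2
      have := hr l; have := hr i
      omega
    · obtain ⟨k, hk, hk1, hk2⟩ := hlow m' hmi'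
      obtain ⟨l, hl, hl1, hl2⟩ := hhigh m hmi
      refine ⟨k, l, hk, hl, ?_⟩
      have := s.snd_mono hk1; have := s.snd_mono hk2
      have := s.fst_mono hl1; have := s.fst_mono hl2
      have := hr k; have := hr i
      omega
    · obtain ⟨l, hl, hl1, hl2⟩ := hhigh m hmi
      obtain ⟨l', hl', hl1', hl2'⟩ := hhigh m' hmi'
      obtain rfl : l = l' := Fin.ext (by omega)
      have := s.fst_mono hl1; have := s.fst_mono hl2
      have := s.snd_mono hl1'; have := s.snd_mono hl2
      have := hr l; have := hr i
      omega
  · rintro ⟨k, l, hk, hl, hkl⟩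
    have hki : k ≤ i := Fin.le_def.2 (by omega)
    have hil : i ≤ l := Fin.le_def.2 (by omega)
    have e1 : i.succAbove (⟨k, by omega⟩ : Fin (n + 1)) = k := Fin.ext (by
      rw [val_succAbove_of_lt _ _ (by simp only; omega)])
    have e2 : i.succAbove (⟨i, by omega⟩ : Fin (n + 1)) = l := Fin.ext (by
      rw [val_succAbove_of_le _ _ le_rfl]; exact hl)
    have := s.fst_mono hki; have := s.fst_mono hil
    have := s.snd_mono hki; have := s.snd_mono hil
    have := hr k; have := hr i; have := hr l
    constructor
    · intro hc
      have c1 := hc ⟨k, by omega⟩; have c2 := hc ⟨i, by omega⟩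
      rw [e1, Ne, Fin.ext_iff] at c1
      rw [e2, Ne, Fin.ext_iff] at c2
      omega
    · intro hc
      have c1 := hc ⟨k, by omega⟩; have c2 := hc ⟨i, by omega⟩
      rw [e1, Ne, Fin.ext_iff] at c1
      rw [e2, Ne, Fin.ext_iff] at c2
      change ¬ ((s.snd k).val = (s.snd i).val) at c1
      change ¬ ((s.snd l).val = (s.snd i).val) at c2
      omega

/-- At a corner the path can be flipped to the other side of the unit square. -/
theorem exists_flip (h : p + q = n + 1) (s : Shuffle p q (n + 1)) (i : Fin (n + 2))
    (hs : ¬ s.IsCol i ∧ ¬ s.swap.IsCol i) : ∃ t : Shuffle p q (n + 1),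
      SimplexCategory.δ i ≫ t.fst = SimplexCategory.δ i ≫ s.fst ∧
      SimplexCategory.δ i ≫ t.snd = SimplexCategory.δ i ≫ s.snd ∧
      ((t.fst i).val = (s.fst i).val + 1 ∨ (s.fst i).val = (t.fst i).val + 1) ∧
      (¬ t.IsCol i ∧ ¬ t.swap.IsCol i) := by
  obtain ⟨k, l, hk, hl, hkl⟩ := (corner_iff h s i).1 hs
  let a : ℕ → ℕ := fun m => if hm : m < n + 2 then (s.fst ⟨m, hm⟩).val else 0
  have ha (m : Fin (n + 2)) : a m = (s.fst m).val := dif_pos m.isLt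
  have hstep (m) (hm : m < n + 1) : a m ≤ a (m + 1) ∧ a (m + 1) ≤ a m + 1 := by
    have h1 := ha ⟨m, by omega⟩; have h2 := ha ⟨m + 1, by omega⟩
    simp only at h1 h2
    rw [h1, h2]
    exact ⟨s.fst_mono (Fin.le_def.2 (Nat.le_succ m)), s.fst_succ_le h ⟨m, hm⟩⟩
  have hak := ha k; have hal := ha l
  rw [← hl] at hal
  obtain ⟨i0, hi0⟩ : ∃ i0, i0 = i.val := ⟨_, rfl⟩
  have hk0 : i0 = k.val + 1 := by omega
  rw [← hi0] at hal
  have hs1 := hstep k (by omega)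
  have hs2 := hstep i0 (by omega)
  have hai := ha i
  rw [← hi0] at hai
  rw [← hk0] at hs1
  let c : ℕ → ℕ := Function.update a i0 (a k + a (i0 + 1) - a i0)
  have hci : c i0 = a k + a (i0 + 1) - a i0 := Function.update_self ..
  have hcm (m) (hm : m ≠ i0) : c m = a m := Function.update_of_ne hm ..
  have hcstep (m) (hm : m < n + 1) : c m ≤ c (m + 1) ∧ c (m + 1) ≤ c m + 1 := by
    by_cases h1 : m = i0
    · subst h1
      rw [hci, hcm _ (by omega)]; omega
    · by_cases h2 : m + 1 = i0
      · obtain rfl : m = k := by omega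
        rw [hcm _ h1, h2, hci]; omega
      · rw [hcm _ h1, hcm _ h2]; exact hstep m hm
  have hl' := l.isLt
  let t : Shuffle p q (n + 1) := ofPath h c
    (by rw [hcm 0 (by omega)]; exact (ha 0).trans (s.fst_zero h))
    (by rw [hcm (n + 1) (by omega)]; exact (ha (Fin.last (n + 1))).trans (s.fst_last h))
    (fun m hm => (hcstep m hm).1) (fun m hm => (hcstep m hm).2)
  have ht (m : Fin (n + 2)) : (t.fst m).val = c m := rfl
  have htm (m : Fin (n + 2)) (hm : m ≠ i) : (t.fst m).val = (s.fst m).val := by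
    rw [ht, hcm _ (by rw [hi0]; exact fun hc => hm (Fin.ext hc)), ha]
  refine ⟨t, ?_, ?_, ?_, (corner_iff h t i).2 ⟨k, l, hk, hl, ?_⟩⟩
  · ext m : 3
    exact Fin.ext (htm _ (Fin.succAbove_ne i m))
  · ext m : 3
    refine Fin.ext ?_
    have h1 := htm _ (Fin.succAbove_ne i m)
    have h2 := t.fst_add_snd h (i.succAbove m)
    have h3 := s.fst_add_snd h (i.succAbove m)
    change (t.snd (i.succAbove m)).val = (s.snd (i.succAbove m)).val
    omega
  · rw [ht, ← hai, ← hi0, hci]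
    omega
  · rw [htm k (fun hc => by have := congrArg Fin.val hc; omega),
      htm l (fun hc => by have := congrArg Fin.val hc; omega), hkl]

theorem sum_fst_of_face_eq {s t : Shuffle p q (n + 1)} {i : Fin (n + 2)}
    (h1 : SimplexCategory.δ i ≫ t.fst = SimplexCategory.δ i ≫ s.fst) :
    ∑ k : Fin (n + 1 + 1), (t.fst k).val + (s.fst i).val =
      ∑ k : Fin (n + 1 + 1), (s.fst k).val + (t.fst i).val := by
  rw [Fin.sum_univ_succAbove (fun k : Fin (n + 2) => (t.fst k).val) i,
    Fin.sum_univ_succAbove (fun k : Fin (n + 2) => (s.fst k).val) i]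
  have : ∑ m, (t.fst (i.succAbove m)).val = ∑ m, (s.fst (i.succAbove m)).val :=
    Finset.sum_congr rfl fun m _ => congrArg (fun f : ⦋n⦌ ⟶ ⦋p⦌ => (f m).val) h1
  simp only [SimplexCategory.len_mk] at *
  omega

section sums
variable {M : Type*} [AddCommGroup M]

open Classical in
/-- The contributions of the two sides of a unit square cancel. -/
theorem sum_corner (h : p + q = n + 1) (T : (⦋n⦌ ⟶ ⦋p⦌) → (⦋n⦌ ⟶ ⦋q⦌) → M) :
    ∑ x : Shuffle p q (n + 1) × Fin (n + 2) with ¬ x.1.IsCol x.2 ∧ ¬ x.1.swap.IsCol x.2,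
      ((-1 : ℤ) ^ (x.2 : ℕ) * (-1) ^ x.1.inversions) •
        T (SimplexCategory.δ x.2 ≫ x.1.fst) (SimplexCategory.δ x.2 ≫ x.1.snd) = 0 := by
  choose! f hf1 hf2 hf3 hf4 using fun s i => exists_flip (p := p) (q := q) h s i
  -- the flip at a corner is an involution which changes the number of inversions by one
  refine Finset.sum_involution (fun x _ => (f x.1 x.2, x.2)) ?_ ?_ ?_ ?_
  · rintro ⟨s, i⟩ hx
    have hs := (Finset.mem_filter.1 hx).2
    simp only at hs ⊢
    rw [hf1 s i hs, hf2 s i hs, ← add_smul, ← mul_add]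
    have e1 := sum_fst_of_face_eq (hf1 s i hs)
    have e2 := s.inversions_add_sum h
    have e3 := (f s i).inversions_add_sum h
    have e4 := hf3 s i hs
    have : (-1 : ℤ) ^ s.inversions + (-1) ^ (f s i).inversions = 0 := by
      rcases e4 with e4 | e4
      · rw [show s.inversions = (f s i).inversions + 1 by omega, pow_succ]; ring
      · rw [show (f s i).inversions = s.inversions + 1 by omega, pow_succ]; ring
    rw [this, mul_zero, zero_smul]
  · rintro ⟨s, i⟩ hx - hc
    have hs := (Finset.mem_filter.1 hx).2
    have e4 := hf3 s i hs
    have : f s i = s := (Prod.mk.inj hc).1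
    simp only at e4
    rw [this] at e4
    omega
  · rintro ⟨s, i⟩ hx
    exact Finset.mem_filter.2 ⟨Finset.mem_univ _, hf4 s i (Finset.mem_filter.1 hx).2⟩
  · rintro ⟨s, i⟩ hx
    have hs := (Finset.mem_filter.1 hx).2
    have hs' := hf4 s i hs
    simp only at hs hs' ⊢
    refine Prod.ext (eq_of_face_eq (i := i) h ((hf1 _ i hs').trans (hf1 s i hs)) (Fin.ext ?_)) rfl
    -- the first coordinate at a corner takes only two values
    obtain ⟨k, l, hk, hl, hkl⟩ := (corner_iff h s i).1 hs
    have hki : k ≠ i := fun hc => by have := congrArg Fin.val hc; omega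
    have hli : l ≠ i := fun hc => by have := congrArg Fin.val hc; omega
    have key (t t' : Shuffle p q (n + 1))
        (ht : SimplexCategory.δ i ≫ t.fst = SimplexCategory.δ i ≫ t'.fst) (k) (hk : k ≠ i) :
        t.fst k = t'.fst k := by
      obtain ⟨m, rfl⟩ := Fin.exists_succAbove_eq hk
      exact congrArg (fun f : ⦋n⦌ ⟶ ⦋p⦌ => f m) ht
    have b (t : Shuffle p q (n + 1)) : (t.fst k).val ≤ (t.fst i).val ∧
        (t.fst i).val ≤ (t.fst l).val :=
      ⟨t.fst_mono (Fin.le_def.2 (by omega)), t.fst_mono (Fin.le_def.2 (by omega))⟩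
    have b1 := b s; have b2 := b (f s i); have b3 := b (f (f s i) i)
    have e1 := hf3 s i hs; have e2 := hf3 _ i hs'
    have k1 := key _ _ (hf1 s i hs) k hki; have k2 := key _ _ (hf1 s i hs) l hli
    have k3 := key _ _ (hf1 _ i hs') k hki; have k4 := key _ _ (hf1 _ i hs') l hli
    rw [k3, k4, k1, k2] at b3
    rw [k1, k2] at b2
    change ((f (f s i) i).fst i).val = (s.fst i).val
    omega

open Classical in
/-- The case of rows follows from that of columns by exchanging the coordinates: the faces which
remove a row assemble to the shuffles of the faces. -/
theorem sum_isRow (h : p + q = n) (T : (⦋n⦌ ⟶ ⦋p⦌) → (⦋n⦌ ⟶ ⦋q + 1⦌) → M) :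
    ∑ x : Shuffle p (q + 1) (n + 1) × Fin (n + 2) with x.1.swap.IsCol x.2,
      ((-1 : ℤ) ^ (x.2 : ℕ) * (-1) ^ x.1.inversions) •
        T (SimplexCategory.δ x.2 ≫ x.1.fst) (SimplexCategory.δ x.2 ≫ x.1.snd) =
    (-1 : ℤ) ^ p • ∑ y : Shuffle p q n × Fin (q + 2),
      ((-1 : ℤ) ^ (y.2 : ℕ) * (-1) ^ y.1.inversions) •
        T y.1.fst (y.1.snd ≫ SimplexCategory.δ y.2) := by
  have key := sum_isCol ((Nat.add_comm q p).trans h) (fun α β => T β α)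
  have e1 : ∑ x : Shuffle p (q + 1) (n + 1) × Fin (n + 2) with x.1.swap.IsCol x.2,
      ((-1 : ℤ) ^ (x.2 : ℕ) * (-1) ^ x.1.inversions) •
        T (SimplexCategory.δ x.2 ≫ x.1.fst) (SimplexCategory.δ x.2 ≫ x.1.snd) =
      (-1 : ℤ) ^ (p * (q + 1)) • ∑ x : Shuffle (q + 1) p (n + 1) × Fin (n + 2) with
        x.1.IsCol x.2, ((-1 : ℤ) ^ (x.2 : ℕ) * (-1) ^ x.1.inversions) •
        T (SimplexCategory.δ x.2 ≫ x.1.snd) (SimplexCategory.δ x.2 ≫ x.1.fst) := by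
    rw [Finset.smul_sum]
    refine Finset.sum_equiv ((swapEquiv p (q + 1) (n + 1)).prodCongr (Equiv.refl _))
      (fun x => by simp only [Finset.mem_filter, Finset.mem_univ, true_and]; rfl) fun x _ => ?_
    have h1 := x.1.swap.sign_swap (by omega)
    change _ = (-1 : ℤ) ^ (p * (q + 1)) • ((-1 : ℤ) ^ (x.2 : ℕ) * (-1) ^ x.1.swap.inversions) •
      T (SimplexCategory.δ x.2 ≫ x.1.fst) (SimplexCategory.δ x.2 ≫ x.1.snd)
    change (-1 : ℤ) ^ x.1.inversions = _ at h1
    rw [smul_smul, h1, Nat.mul_comm p]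
    congr 1
    ring
  have e2 : ∑ y : Shuffle q p n × Fin (q + 2), ((-1 : ℤ) ^ (y.2 : ℕ) * (-1) ^ y.1.inversions) •
      T y.1.snd (y.1.fst ≫ SimplexCategory.δ y.2) = (-1 : ℤ) ^ (p * q) •
      ∑ y : Shuffle p q n × Fin (q + 2), ((-1 : ℤ) ^ (y.2 : ℕ) * (-1) ^ y.1.inversions) •
        T y.1.fst (y.1.snd ≫ SimplexCategory.δ y.2) := by
    rw [Finset.smul_sum]
    refine Finset.sum_equiv ((swapEquiv q p n).prodCongr (Equiv.refl _))
      (fun x => by simp) fun x _ => ?_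
    have h1 := x.1.swap.sign_swap (by omega)
    change _ = (-1 : ℤ) ^ (p * q) • ((-1 : ℤ) ^ (x.2 : ℕ) * (-1) ^ x.1.swap.inversions) •
      T x.1.snd (x.1.fst ≫ SimplexCategory.δ x.2)
    change (-1 : ℤ) ^ x.1.inversions = _ at h1
    rw [smul_smul, h1]
    congr 1
    ring
  rw [e1, key, e2, smul_smul, ← pow_add]
  congr 1
  refine neg_one_pow_congr ?_
  rw [Nat.even_iff, Nat.even_iff, Nat.mul_succ]
  omega

end sums
end Shuffle
end SymHom

namespace SymHom
open scoped TensorProduct Simplicial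

/-! ### Threefold shuffles -/

namespace Shuffle

variable {p q r m n : ℕ}

/-- The area does not change when a path is slowed down. -/
theorem area_comp (α : ⦋m⦌ ⟶ ⦋p⦌) (β : ⦋m⦌ ⟶ ⦋q⦌) (γ : ⦋n⦌ ⟶ ⦋m⦌) (h0 : (γ 0).val = 0)
    (hn : (γ (Fin.last n)).val = m) (hγ : ∀ i : Fin n, (γ i.succ).val ≤ (γ i.castSucc).val + 1) :
    area (γ ≫ α) (γ ≫ β) = area α β := by
  have key (N : Fin (n + 1)) : ∑ i : Fin n with i.val < N.val,
      ((α (γ i.succ)).val - (α (γ i.castSucc)).val) * (β (γ i.castSucc)).val =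
      ∑ j : Fin m with j.val < (γ N).val,
        ((α j.succ).val - (α j.castSucc).val) * (β j.castSucc).val := by
    induction N using Fin.induction with
    | zero =>
      rw [h0, Finset.filter_false_of_mem (fun j _ => by simp),
        Finset.filter_false_of_mem (fun j _ => by simp)]
      rfl
    | succ i ih =>
      have e1 : (Finset.univ.filter fun j : Fin n => j.val < i.succ.val) =
          insert i (Finset.univ.filter fun j : Fin n => j.val < i.castSucc.val) := by
        ext j
        simp only [Finset.mem_filter, Finset.mem_univ, true_and, Finset.mem_insert, Fin.val_succ,
          Fin.val_castSucc, Fin.ext_iff]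
        omega
      rw [e1, Finset.sum_insert (by simp), ih]
      have h1 : (γ i.castSucc).val ≤ (γ i.succ).val :=
        γ.toOrderHom.monotone (Fin.castSucc_lt_succ (i := i)).le
      have h2 := hγ i
      by_cases hc : γ i.succ = γ i.castSucc
      · rw [hc, Nat.sub_self, Nat.zero_mul, Nat.zero_add]
      · have hc' : (γ i.succ).val ≠ (γ i.castSucc).val := fun h => hc (Fin.ext h)
        have h3 : (γ i.succ).val < m + 1 := (γ i.succ).isLt
        obtain ⟨j, hj⟩ : ∃ j : Fin m, j.val = (γ i.castSucc).val :=
          ⟨⟨(γ i.castSucc).val, by omega⟩, rfl⟩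
        have e2 : γ i.castSucc = j.castSucc := Fin.ext (by rw [Fin.val_castSucc, hj])
        have e3 : γ i.succ = j.succ := Fin.ext (by rw [Fin.val_succ, hj]; omega)
        have e4 : (Finset.univ.filter fun k : Fin m => k.val < (γ i.succ).val) =
            insert j (Finset.univ.filter fun k : Fin m => k.val < (γ i.castSucc).val) := by
          ext k
          simp only [Finset.mem_filter, Finset.mem_univ, true_and, Finset.mem_insert, e2, e3,
            Fin.val_succ, Fin.val_castSucc, Fin.ext_iff]
          omega
        rw [e4, Finset.sum_insert (by simp [hj]), e2, e3]
  have := key (Fin.last n)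
  rwa [hn, Finset.filter_true_of_mem (fun i _ => i.isLt),
    Finset.filter_true_of_mem (fun i _ => i.isLt)] at this

theorem exists_fst_eq (s : Shuffle p q n) (h : p + q = n) (v : Fin (p + 1)) :
    ∃ j, s.fst j = v := by
  have key (i : Fin (n + 1)) : ∀ v ≤ (s.fst i).val, ∃ j, (s.fst j).val = v := by
    induction i using Fin.induction with
    | zero => exact fun v hv => ⟨0, by have := s.fst_zero h; omega⟩
    | succ i ih =>
      intro v hv
      have := s.fst_succ_le h i
      by_cases h : v ≤ (s.fst i.castSucc).val
      · exact ih v h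
      · exact ⟨i.succ, by omega⟩
  obtain ⟨j, hj⟩ := key (Fin.last n) v (by rw [s.fst_last h]; exact Nat.lt_succ_iff.1 v.isLt)
  exact ⟨j, Fin.ext hj⟩

/-- A threefold shuffle, i.e. a maximal chain of `[p] × [q] × [r]`, factors through its projection to
`[p] × [q]`. -/
theorem exists_factor (hm : p + q = m) (hn : m + r = n) (a : ⦋n⦌ ⟶ ⦋p⦌) (b : ⦋n⦌ ⟶ ⦋q⦌)
    (c : ⦋n⦌ ⟶ ⦋r⦌) (habc : ∀ i, (a i).val + (b i).val + (c i).val = i.val) :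
    ∃ (t : Shuffle m r n) (s : Shuffle p q m),
      t.fst ≫ s.fst = a ∧ t.fst ≫ s.snd = b ∧ t.snd = c := by
  have ha {i j : Fin (n + 1)} (h : i ≤ j) : (a i).val ≤ (a j).val := a.toOrderHom.monotone h
  have hb {i j : Fin (n + 1)} (h : i ≤ j) : (b i).val ≤ (b j).val := b.toOrderHom.monotone h
  have hc {i j : Fin (n + 1)} (h : i ≤ j) : (c i).val ≤ (c j).val := c.toOrderHom.monotone h
  have la (i) : (a i).val < p + 1 := (a i).isLt
  have lb (i) : (b i).val < q + 1 := (b i).isLt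
  let t : Shuffle m r n :=
    { fst := SimplexCategory.mkHom ⟨fun i => ⟨(a i).val + (b i).val, by
        have := la i; have := lb i; omega⟩, fun i j hij => Nat.add_le_add (ha hij) (hb hij)⟩
      snd := c
      injective := fun i j hij => by
        have h1 : (a i).val + (b i).val = (a j).val + (b j).val :=
          congrArg Fin.val (Prod.mk.inj hij).1
        have h2 : c i = c j := (Prod.mk.inj hij).2
        refine Fin.ext ?_
        have k1 := habc i; have k2 := habc j
        rw [h2] at k1
        omega }
  have ht (i : Fin (n + 1)) : (t.fst i).val = (a i).val + (b i).val := rfl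
  choose j hj using fun v => t.exists_fst_eq hn v
  replace hj (v : Fin (m + 1)) : (t.fst (j v)).val = v.val := congrArg Fin.val (hj v)
  have jmono {v w : Fin (m + 1)} (hvw : v ≤ w) : j v ≤ j w := by
    rcases hvw.lt_or_eq with h | rfl
    · refine le_of_not_gt fun hlt => ?_
      have := t.fst_mono hlt.le
      rw [hj, hj] at this
      exact absurd h (not_lt.2 (Fin.le_def.2 this))
    · exact le_rfl
  let s : Shuffle p q m :=
    { fst := SimplexCategory.mkHom ⟨fun v => a (j v), fun v w h => ha (jmono h)⟩
      snd := SimplexCategory.mkHom ⟨fun v => b (j v), fun v w h => hb (jmono h)⟩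
      injective := fun v w h => by
        have h1 : a (j v) = a (j w) := (Prod.mk.inj h).1
        have h2 : b (j v) = b (j w) := (Prod.mk.inj h).2
        have h3 := hj v; have h4 := hj w
        rw [ht] at h3 h4
        rw [h1, h2] at h3
        exact Fin.ext (h3.symm.trans h4) }
  have key (i) : (a (j (t.fst i))).val = (a i).val ∧ (b (j (t.fst i))).val = (b i).val := by
    have h1 := hj (t.fst i)
    rw [ht, ht] at h1
    rcases le_total (j (t.fst i)) i with h | h
    · have := ha h; have := hb h; omega
    · have := ha h; have := hb h; omega
  refine ⟨t, s, ?_, ?_, rfl⟩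
  · ext i : 3
    exact Fin.ext (key i).1
  · ext i : 3
    exact Fin.ext (key i).2

theorem factor_unique (hm : p + q = m) (hn : m + r = n) {t t' : Shuffle m r n}
    {s s' : Shuffle p q m} (h1 : t.fst ≫ s.fst = t'.fst ≫ s'.fst) (h3 : t.snd = t'.snd) :
    t = t' ∧ s = s' := by
  have ht : t = t' := ext_fst hn fun i => by
    have e1 := t.fst_add_snd hn i; have e2 := t'.fst_add_snd hn i
    rw [h3] at e1
    omega
  subst ht
  refine ⟨rfl, ext_fst hm fun v => ?_⟩
  obtain ⟨j, rfl⟩ := t.exists_fst_eq hn v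
  exact congrArg (fun f : ⦋n⦌ ⟶ ⦋p⦌ => (f j).val) h1

/-- The sign of a threefold shuffle is that of the sum of the areas of its three planar projections. -/
theorem inversions_add_inversions (hm : p + q = m) (hn : m + r = n) (t : Shuffle m r n)
    (s : Shuffle p q m) : t.inversions + s.inversions = area (t.fst ≫ s.fst) (t.fst ≫ s.snd) +
      (area (t.fst ≫ s.fst) t.snd + area (t.fst ≫ s.snd) t.snd) := by
  rw [area_comp _ _ _ (t.fst_zero hn) (t.fst_last hn) (t.fst_succ_le hn),
    t.inversions_eq_area hn, s.inversions_eq_area hm, Nat.add_comm]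
  congr 1
  rw [area, area, area, ← Finset.sum_add_distrib]
  refine Finset.sum_congr rfl fun i _ => ?_
  rw [← Nat.add_mul]
  congr 1
  have h1 := s.fst_add_snd hm (t.fst i.castSucc); have h2 := s.fst_add_snd hm (t.fst i.succ)
  have h : t.fst i.castSucc ≤ t.fst i.succ :=
    t.fst.toOrderHom.monotone (Fin.castSucc_lt_succ (i := i)).le
  have h3 := s.fst_mono h; have h4 := s.snd_mono h
  change _ = (s.fst (t.fst i.succ)).val - (s.fst (t.fst i.castSucc)).val +
    ((s.snd (t.fst i.succ)).val - (s.snd (t.fst i.castSucc)).val)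
  omega

theorem inversions_add_inversions' (hm : p + q = m) (hn : r + m = n) (t : Shuffle r m n)
    (s : Shuffle p q m) : t.inversions + s.inversions = area (t.snd ≫ s.fst) (t.snd ≫ s.snd) +
      (area t.fst (t.snd ≫ s.fst) + area t.fst (t.snd ≫ s.snd)) := by
  have hn' := (Nat.add_comm m r).trans hn
  rw [area_comp s.fst s.snd t.snd (t.swap.fst_zero hn') (t.swap.fst_last hn')
    (t.swap.fst_succ_le hn'),
    t.inversions_eq_area hn, s.inversions_eq_area hm, Nat.add_comm]
  congr 1
  rw [area, area, area, ← Finset.sum_add_distrib]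
  refine Finset.sum_congr rfl fun i _ => ?_
  rw [← Nat.mul_add]
  congr 1
  exact (s.fst_add_snd hm (t.snd i.castSucc)).symm

/-- The two ways of composing shuffles both enumerate the threefold shuffles, with the same signs. -/
theorem sum_assoc {M : Type*} [AddCommGroup M] {m' : ℕ} (hm : p + q = m) (hn : m + r = n)
    (hm' : q + r = m') (hn' : p + m' = n)
    (T : (⦋n⦌ ⟶ ⦋p⦌) → (⦋n⦌ ⟶ ⦋q⦌) → (⦋n⦌ ⟶ ⦋r⦌) → M) :
    ∑ x : Shuffle m r n × Shuffle p q m, ((-1 : ℤ) ^ x.1.inversions * (-1) ^ x.2.inversions) •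
      T (x.1.fst ≫ x.2.fst) (x.1.fst ≫ x.2.snd) x.1.snd =
    ∑ y : Shuffle p m' n × Shuffle q r m', ((-1 : ℤ) ^ y.1.inversions * (-1) ^ y.2.inversions) •
      T y.1.fst (y.1.snd ≫ y.2.fst) (y.1.snd ≫ y.2.snd) := by
  have h1 (x : Shuffle m r n × Shuffle p q m) : ∃ y : Shuffle p m' n × Shuffle q r m',
      y.1.fst = x.1.fst ≫ x.2.fst ∧ y.1.snd ≫ y.2.fst = x.1.fst ≫ x.2.snd ∧
      y.1.snd ≫ y.2.snd = x.1.snd := by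
    obtain ⟨t, s, e1, e2, e3⟩ := exists_factor hm' ((Nat.add_comm m' p).trans hn')
      (x.1.fst ≫ x.2.snd) x.1.snd (x.1.fst ≫ x.2.fst) fun i => by
        have h1 := x.2.fst_add_snd hm (x.1.fst i); have h2 := x.1.fst_add_snd hn i
        change (x.2.snd (x.1.fst i)).val + (x.1.snd i).val + (x.2.fst (x.1.fst i)).val = _
        omega
    exact ⟨(t.swap, s), e3, e1, e2⟩
  choose f hf1 hf2 hf3 using h1
  refine Finset.sum_bij (fun x _ => f x) (fun _ _ => Finset.mem_univ _) ?_ ?_ ?_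
  · intro x _ x' _ hxx
    have e1 : x.1.fst ≫ x.2.fst = x'.1.fst ≫ x'.2.fst := by rw [← hf1, hxx, hf1]
    have e3 : x.1.snd = x'.1.snd := by rw [← hf3, hxx, hf3]
    obtain ⟨h1, h2⟩ := factor_unique hm hn e1 e3
    exact Prod.ext h1 h2
  · intro y _
    obtain ⟨t, s, e1, e2, e3⟩ := exists_factor hm hn y.1.fst (y.1.snd ≫ y.2.fst)
      (y.1.snd ≫ y.2.snd) fun i => by
        have h1 := y.2.fst_add_snd hm' (y.1.snd i); have h2 := y.1.fst_add_snd hn' i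
        change (y.1.fst i).val + (y.2.fst (y.1.snd i)).val + (y.2.snd (y.1.snd i)).val = _
        omega
    refine ⟨(t, s), Finset.mem_univ _, ?_⟩
    have h1 := hf1 (t, s); have h2 := hf2 (t, s); have h3 := hf3 (t, s)
    simp only [e1, e2, e3] at h1 h2 h3
    obtain ⟨k1, k2⟩ := factor_unique hm' ((Nat.add_comm m' p).trans hn')
      (t := (f (t, s)).1.swap) (t' := y.1.swap) h2 h1
    refine Prod.ext ?_ k2
    exact congrArg swap k1
  · intro x _
    rw [hf1, hf2, hf3, ← pow_add, ← pow_add, inversions_add_inversions hm hn,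
      inversions_add_inversions' hm' hn', hf1, hf2, hf3]
    congr 2
    omega

/-- The only shuffle of `[0]` and `[n]` has no inversions. -/
theorem sum_zero_left {M : Type*} [AddCommGroup M] (T : (⦋n⦌ ⟶ ⦋0⦌) → (⦋n⦌ ⟶ ⦋n⦌) → M)
    (α : ⦋n⦌ ⟶ ⦋0⦌) :
    ∑ s : Shuffle 0 n n, (-1 : ℤ) ^ s.inversions • T s.fst s.snd = T α (𝟙 _) := by
  have h (s : Shuffle 0 n n) (i : Fin (n + 1)) : (s.fst i).val = 0 :=
    Nat.lt_one_iff.1 (s.fst i).isLt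
  let s0 : Shuffle 0 n n := ⟨α, 𝟙 _, fun i j hij => (Prod.mk.inj hij).2⟩
  rw [Finset.sum_eq_single s0 (fun s _ hs => absurd (ext_fst (Nat.zero_add n) fun i => by
    rw [h, h]) hs) (fun h => absurd (Finset.mem_univ _) h)]
  have := s0.inversions_add_sum (Nat.zero_add n)
  rw [show s0.inversions = 0 by omega, pow_zero, one_smul]

end Shuffle
end SymHom

namespace SymHom
open scoped TensorProduct Simplicial

/-! ### The Eilenberg–Zilber map on normalized chains -/

section Normalized
variable {k : Type u} [CommRing k]

/-- The class of a chain in the normalized complex. -/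
noncomputable def nmk (X : SimplicialObject (ModuleCat.{u} k)) (n : ℕ) :
    (X.obj (op ⦋n⦌) : Type u) →ₗ[k] ((normalized X).X n : Type u) := (degen X n).mkQ

theorem nmk_surjective (X : SimplicialObject (ModuleCat.{u} k)) (n : ℕ) :
    Function.Surjective (nmk X n) := Submodule.Quotient.mk_surjective _

theorem normalized_d_nmk (X : SimplicialObject (ModuleCat.{u} k)) (n : ℕ)
    (x : X.obj (op ⦋n + 1⦌)) : (normalized X).d (n + 1) n (nmk X (n + 1) x) =
      ∑ i : Fin (n + 2), (-1 : ℤ) ^ (i : ℕ) • nmk X n (X.map (SimplexCategory.δ i).op x) := by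
  have h : (((AlgebraicTopology.alternatingFaceMapComplex _).obj X).d (n + 1) n).hom x =
      ∑ i : Fin (n + 2), (-1 : ℤ) ^ (i : ℕ) • X.map (SimplexCategory.δ i).op x := by
    rw [AlgebraicTopology.alternatingFaceMapComplex_obj_d,
      AlgebraicTopology.AlternatingFaceMapComplex.objD]
    simp [ModuleCat.hom_sum]
    rfl
  refine (congrArg (nmk X n) h).trans ?_
  simp only [map_sum, map_zsmul]

theorem normalizedMap_nmk {X Y : SimplicialObject (ModuleCat.{u} k)} (f : X ⟶ Y) (n : ℕ)
    (x : X.obj (op ⦋n⦌)) : (normalizedMap k f).f n (nmk X n x) = nmk Y n (f.app _ x) := rfl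

theorem Sh_nmk (X Y : SimplicialObject (ModuleCat.{u} k)) {p q n : ℕ} (h : p + q = n)
    (x : X.obj (op ⦋p⦌)) (y : Y.obj (op ⦋q⦌)) : Sh X Y h (nmk X p x) (nmk Y q y) =
      ∑ s : Shuffle p q n, (-1 : ℤ) ^ s.inversions •
        nmk (hat X Y) n (hatMk X Y _ (X.map s.fst.op x) (Y.map s.snd.op y)) := by
  refine (congrArg (nmk (hat X Y) n) (shuffleChain_apply X Y p q n x y)).trans ?_
  simp only [map_sum, map_zsmul]

variable (X Y Z : SimplicialObject (ModuleCat.{u} k))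

theorem map_comp_apply {a b c : SimplexCategory} (α : a ⟶ b) (β : b ⟶ c) (x : X.obj (op c)) :
    X.map (α ≫ β).op x = X.map α.op (X.map β.op x) := by
  rw [op_comp, X.map_comp]; rfl

open Classical in
/-- The boundary of a shuffle product: the faces at corners cancel, and what remains are the faces which
remove a column and those which remove a row. -/
theorem d_Sh_nmk {p q n : ℕ} (h : p + q = n + 1) (x : X.obj (op ⦋p⦌)) (y : Y.obj (op ⦋q⦌)) :
    (normalized (hat X Y)).d (n + 1) n (Sh X Y h (nmk X p x) (nmk Y q y)) =
      (∑ z : Shuffle p q (n + 1) × Fin (n + 2) with z.1.IsCol z.2,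
        ((-1 : ℤ) ^ (z.2 : ℕ) * (-1) ^ z.1.inversions) • nmk (hat X Y) n (hatMk X Y _
          (X.map (SimplexCategory.δ z.2 ≫ z.1.fst).op x)
          (Y.map (SimplexCategory.δ z.2 ≫ z.1.snd).op y))) +
      ∑ z : Shuffle p q (n + 1) × Fin (n + 2) with z.1.swap.IsCol z.2,
        ((-1 : ℤ) ^ (z.2 : ℕ) * (-1) ^ z.1.inversions) • nmk (hat X Y) n (hatMk X Y _
          (X.map (SimplexCategory.δ z.2 ≫ z.1.fst).op x)
          (Y.map (SimplexCategory.δ z.2 ≫ z.1.snd).op y)) := by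
  let T (α : ⦋n⦌ ⟶ ⦋p⦌) (β : ⦋n⦌ ⟶ ⦋q⦌) :=
    nmk (hat X Y) n (hatMk X Y _ (X.map α.op x) (Y.map β.op y))
  have e1 : (normalized (hat X Y)).d (n + 1) n (Sh X Y h (nmk X p x) (nmk Y q y)) =
      ∑ z : Shuffle p q (n + 1) × Fin (n + 2), ((-1 : ℤ) ^ (z.2 : ℕ) * (-1) ^ z.1.inversions) •
        T (SimplexCategory.δ z.2 ≫ z.1.fst) (SimplexCategory.δ z.2 ≫ z.1.snd) := by
    rw [Sh_nmk, map_sum, ← Finset.univ_product_univ, Finset.sum_product]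
    refine Finset.sum_congr rfl fun s _ => ?_
    rw [map_zsmul, normalized_d_nmk, Finset.smul_sum]
    refine Finset.sum_congr rfl fun i _ => ?_
    rw [smul_smul, mul_comm, hat_map_hatMk]
    simp only [T, map_comp_apply]
  have disj (z : Shuffle p q (n + 1) × Fin (n + 2)) (h1 : z.1.IsCol z.2) :
      ¬ z.1.swap.IsCol z.2 := by
    obtain ⟨s, i⟩ := z
    intro h2
    -- a point shares its row or its column with each of its neighbours
    obtain ⟨j, l, m, hjl, hj⟩ : ∃ (j l : Fin (n + 2)) (m : Fin (n + 1)), j.val + 1 = l.val ∧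
        ((j = i ∧ i.succAbove m = l) ∨ (l = i ∧ i.succAbove m = j)) := by
      by_cases hi : i.val = 0
      · refine ⟨i, ⟨i.val + 1, by omega⟩, ⟨0, by omega⟩, rfl, Or.inl ⟨rfl, Fin.ext ?_⟩⟩
        rw [Shuffle.val_succAbove_of_le _ _ (by simp only; omega)]
        simp only; omega
      · refine ⟨⟨i.val - 1, by omega⟩, i, ⟨i.val - 1, by omega⟩, by simp only; omega,
          Or.inr ⟨rfl, Fin.ext ?_⟩⟩
        rw [Shuffle.val_succAbove_of_lt _ _ (by simp only; omega)]
    have hjl' : j ≤ l := Fin.le_def.2 (by omega)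
    have e1 := s.fst_add_snd h j; have e2 := s.fst_add_snd h l
    have e3 := s.fst_mono hjl'; have e4 := s.snd_mono hjl'
    have c1 := h1 m; have c2 := h2 m
    have e5 : (s.fst j).val ≠ (s.fst l).val ∧ (s.snd j).val ≠ (s.snd l).val := by
      rcases hj with ⟨rfl, hm⟩ | ⟨rfl, hm⟩
      · simp only [hm] at c1 c2
        exact ⟨fun hc => c1 (Fin.ext hc.symm), fun hc => c2 (Fin.ext hc.symm)⟩
      · simp only [hm] at c1 c2
        exact ⟨fun hc => c1 (Fin.ext hc), fun hc => c2 (Fin.ext hc)⟩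
    omega
  rw [e1, ← Finset.sum_filter_add_sum_filter_not Finset.univ fun z => z.1.IsCol z.2]
  congr 1
  rw [← Finset.sum_filter_add_sum_filter_not (Finset.univ.filter _) fun z => z.1.swap.IsCol z.2,
    Finset.filter_filter, Finset.filter_filter, Shuffle.sum_corner h T, add_zero]
  refine Finset.sum_congr (Finset.filter_congr fun z _ => ?_) fun _ _ => rfl
  exact ⟨fun h => h.2, fun h => ⟨fun h' => disj z h' h, h⟩⟩

open Classical in
theorem sum_isCol_nmk {p q n : ℕ} (h : p + q = n) (x : X.obj (op ⦋p + 1⦌)) (y : Y.obj (op ⦋q⦌)) :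
    ∑ z : Shuffle (p + 1) q (n + 1) × Fin (n + 2) with z.1.IsCol z.2,
        ((-1 : ℤ) ^ (z.2 : ℕ) * (-1) ^ z.1.inversions) • nmk (hat X Y) n (hatMk X Y _
          (X.map (SimplexCategory.δ z.2 ≫ z.1.fst).op x)
          (Y.map (SimplexCategory.δ z.2 ≫ z.1.snd).op y)) =
      Sh X Y h ((normalized X).d (p + 1) p (nmk X (p + 1) x)) (nmk Y q y) := by
  rw [Shuffle.sum_isCol h fun α β => nmk (hat X Y) n (hatMk X Y _ (X.map α.op x) (Y.map β.op y)),
    normalized_d_nmk, map_sum, LinearMap.sum_apply, ← Finset.univ_product_univ,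
    Finset.sum_product_right]
  refine Finset.sum_congr rfl fun j _ => ?_
  rw [map_zsmul, LinearMap.smul_apply, Sh_nmk, Finset.smul_sum]
  refine Finset.sum_congr rfl fun s _ => ?_
  rw [smul_smul, map_comp_apply]

open Classical in
theorem sum_isRow_nmk {p q n : ℕ} (h : p + q = n) (x : X.obj (op ⦋p⦌)) (y : Y.obj (op ⦋q + 1⦌)) :
    ∑ z : Shuffle p (q + 1) (n + 1) × Fin (n + 2) with z.1.swap.IsCol z.2,
        ((-1 : ℤ) ^ (z.2 : ℕ) * (-1) ^ z.1.inversions) • nmk (hat X Y) n (hatMk X Y _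
          (X.map (SimplexCategory.δ z.2 ≫ z.1.fst).op x)
          (Y.map (SimplexCategory.δ z.2 ≫ z.1.snd).op y)) =
      (-1 : ℤ) ^ p • Sh X Y h (nmk X p x) ((normalized Y).d (q + 1) q (nmk Y (q + 1) y)) := by
  rw [Shuffle.sum_isRow h fun α β => nmk (hat X Y) n (hatMk X Y _ (X.map α.op x) (Y.map β.op y)),
    normalized_d_nmk, map_sum, ← Finset.univ_product_univ, Finset.sum_product_right]
  congr 1
  refine Finset.sum_congr rfl fun j _ => ?_
  rw [map_zsmul, Sh_nmk, Finset.smul_sum]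
  refine Finset.sum_congr rfl fun s _ => ?_
  rw [smul_smul, map_comp_apply]

open Classical in
theorem sum_isCol_zero {q n : ℕ}
    (T : Shuffle 0 q (n + 1) × Fin (n + 2) → (normalized (hat X Y)).X n) :
    ∑ z : Shuffle 0 q (n + 1) × Fin (n + 2) with z.1.IsCol z.2, T z = 0 := by
  refine (Finset.sum_congr (Finset.filter_false_of_mem fun z _ hz => ?_) fun _ _ => rfl).trans
    Finset.sum_empty
  exact hz 0 (Subsingleton.elim (α := Fin 1) _ _)

open Classical in
theorem sum_isRow_zero {p n : ℕ}
    (T : Shuffle p 0 (n + 1) × Fin (n + 2) → (normalized (hat X Y)).X n) :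
    ∑ z : Shuffle p 0 (n + 1) × Fin (n + 2) with z.1.swap.IsCol z.2, T z = 0 := by
  refine (Finset.sum_congr (Finset.filter_false_of_mem fun z _ hz => ?_) fun _ _ => rfl).trans
    Finset.sum_empty
  exact hz 0 (Subsingleton.elim (α := Fin 1) _ _)

variable {X Y}

open Classical in
theorem d_Sh_of_left {p q n : ℕ} (h : p + q = n) (x : (normalized X).X (p + 1))
    (y : (normalized Y).X q) (hy : ∀ j, (normalized Y).d q j y = 0) :
    (normalized (hat X Y)).d (n + 1) n (Sh X Y (by omega : p + 1 + q = n + 1) x y) =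
      Sh X Y h ((normalized X).d (p + 1) p x) y := by
  obtain ⟨x, rfl⟩ := nmk_surjective X _ x
  obtain ⟨y, rfl⟩ := nmk_surjective Y _ y
  rw [d_Sh_nmk, sum_isCol_nmk X Y h x y]
  cases q with
  | zero => rw [sum_isRow_zero, add_zero]
  | succ q =>
    obtain ⟨n, rfl⟩ : ∃ n', n = n' + 1 := ⟨n - 1, by omega⟩
    rw [sum_isRow_nmk X Y (by omega : p + 1 + q = n + 1) x y, hy, map_zero, smul_zero, add_zero]

open Classical in
theorem d_Sh_of_right {p q n : ℕ} (h : p + q = n) (x : (normalized X).X p)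
    (y : (normalized Y).X (q + 1)) (hx : ∀ j, (normalized X).d p j x = 0) :
    (normalized (hat X Y)).d (n + 1) n (Sh X Y (by omega : p + (q + 1) = n + 1) x y) =
      (-1 : ℤ) ^ p • Sh X Y h x ((normalized Y).d (q + 1) q y) := by
  obtain ⟨x, rfl⟩ := nmk_surjective X _ x
  obtain ⟨y, rfl⟩ := nmk_surjective Y _ y
  rw [d_Sh_nmk, sum_isRow_nmk X Y h x y]
  cases p with
  | zero => rw [sum_isCol_zero, zero_add]
  | succ p =>
    obtain ⟨n, rfl⟩ : ∃ n', n = n' + 1 := ⟨n - 1, by omega⟩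
    rw [sum_isCol_nmk X Y (by omega : p + (q + 1) = n + 1) x y, hx, map_zero, LinearMap.zero_apply,
      zero_add]

/-- A product of cycles is a cycle. -/
theorem d_Sh_eq_zero {p q n : ℕ} (h : p + q = n) (x : (normalized X).X p)
    (y : (normalized Y).X q) (hx : ∀ j, (normalized X).d p j x = 0)
    (hy : ∀ j, (normalized Y).d q j y = 0) (j : ℕ) :
    (normalized (hat X Y)).d n j (Sh X Y h x y) = 0 := by
  by_cases hj : j + 1 = n
  swap
  · rw [(normalized (hat X Y)).shape n j hj]; rfl
  subst hj
  cases p with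
  | zero =>
    obtain rfl : q = j + 1 := by omega
    have := d_Sh_of_right (X := X) (Y := Y) (Nat.zero_add j) x y hx
    rw [hy, map_zero, smul_zero] at this
    exact this
  | succ p =>
    have := d_Sh_of_left (X := X) (Y := Y) (n := j) (p := p) (q := q) (by omega) x y hy
    rw [hx, map_zero, LinearMap.zero_apply] at this
    exact this

/-- Functoriality of the degreewise tensor product. -/
noncomputable def hatMap {X X' Y Y' : SimplicialObject (ModuleCat.{u} k)} (f : X ⟶ X')
    (g : Y ⟶ Y') : hat X Y ⟶ hat X' Y' where
  app n := ModuleCat.ofHom (TensorProduct.map (f.app n).hom (g.app n).hom)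
  naturality a b θ := ModuleCat.hom_ext <| TensorProduct.ext' fun x y => by
    have h1 := congrArg (fun t => t.hom x) (f.naturality θ)
    have h2 := congrArg (fun t => t.hom y) (g.naturality θ)
    exact congrArg₂ (fun s t => hatMk X' Y' b s t) h1 h2

theorem Sh_naturality {X' Y' : SimplicialObject (ModuleCat.{u} k)} (f : X ⟶ X') (g : Y ⟶ Y')
    {p q n : ℕ} (h : p + q = n) (x : (normalized X).X p) (y : (normalized Y).X q) :
    (normalizedMap k (hatMap f g)).f n (Sh X Y h x y) =
      Sh X' Y' h ((normalizedMap k f).f p x) ((normalizedMap k g).f q y) := by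
  obtain ⟨x, rfl⟩ := nmk_surjective X _ x
  obtain ⟨y, rfl⟩ := nmk_surjective Y _ y
  rw [Sh_nmk, map_sum, normalizedMap_nmk, normalizedMap_nmk, Sh_nmk]
  refine Finset.sum_congr rfl fun s _ => ?_
  rw [map_zsmul, normalizedMap_nmk]
  have h1 := congrArg (fun t => t.hom x) (f.naturality s.fst.op)
  have h2 := congrArg (fun t => t.hom y) (g.naturality s.snd.op)
  congr 2
  exact congrArg₂ (fun s t => hatMk X' Y' _ s t) h1 h2

/-- The exchange of the factors of a degreewise tensor product. -/
noncomputable def hatSwap (X Y : SimplicialObject (ModuleCat.{u} k)) : hat X Y ⟶ hat Y X where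
  app n := ModuleCat.ofHom (TensorProduct.comm k (X.obj n) (Y.obj n)).toLinearMap
  naturality _ _ _ := ModuleCat.hom_ext <| TensorProduct.ext' fun _ _ => rfl

theorem Sh_comm {p q n : ℕ} (h : p + q = n) (h' : q + p = n) (x : (normalized X).X p)
    (y : (normalized Y).X q) :
    Sh Y X h' y x = (-1 : ℤ) ^ (p * q) • (normalizedMap k (hatSwap X Y)).f n (Sh X Y h x y) := by
  obtain ⟨x, rfl⟩ := nmk_surjective X _ x
  obtain ⟨y, rfl⟩ := nmk_surjective Y _ y
  rw [Sh_nmk, Sh_nmk, map_sum, Finset.smul_sum]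
  refine (Fintype.sum_equiv (Shuffle.swapEquiv p q n) _ _ fun s => ?_).symm
  rw [map_zsmul, smul_smul, ← s.sign_swap h, normalizedMap_nmk]
  rfl

/-- Reassociation of a threefold degreewise tensor product. -/
noncomputable def hatAssoc (X Y Z : SimplicialObject (ModuleCat.{u} k)) :
    hat (hat X Y) Z ⟶ hat X (hat Y Z) where
  app n := ModuleCat.ofHom (TensorProduct.assoc k (X.obj n) (Y.obj n) (Z.obj n)).toLinearMap
  naturality _ _ _ := ModuleCat.hom_ext <| TensorProduct.ext_threefold fun _ _ _ => rfl

theorem Sh_assoc {p q r m m' n : ℕ} (hm : p + q = m) (hn : m + r = n) (hm' : q + r = m')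
    (hn' : p + m' = n) (x : (normalized X).X p) (y : (normalized Y).X q)
    (z : (normalized Z).X r) :
    (normalizedMap k (hatAssoc X Y Z)).f n (Sh (hat X Y) Z hn (Sh X Y hm x y) z) =
      Sh X (hat Y Z) hn' x (Sh Y Z hm' y z) := by
  obtain ⟨x, rfl⟩ := nmk_surjective X _ x
  obtain ⟨y, rfl⟩ := nmk_surjective Y _ y
  obtain ⟨z, rfl⟩ := nmk_surjective Z _ z
  have key := Shuffle.sum_assoc hm hn hm' hn' fun α β γ => nmk (hat X (hat Y Z)) n
    (hatMk X (hat Y Z) _ (X.map α.op x) (hatMk Y Z _ (Y.map β.op y) (Z.map γ.op z)))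
  rw [← Finset.univ_product_univ, Finset.sum_product_right, ← Finset.univ_product_univ,
    Finset.sum_product_right] at key
  rw [Sh_nmk, Sh_nmk, map_sum, LinearMap.sum_apply, map_sum, map_sum]
  refine Eq.trans (Finset.sum_congr rfl fun s _ => ?_)
    (key.trans (Finset.sum_congr rfl fun s _ => ?_))
  · rw [map_zsmul, LinearMap.smul_apply, map_zsmul, Sh_nmk, map_sum, Finset.smul_sum]
    refine Finset.sum_congr rfl fun t _ => ?_
    rw [map_zsmul, smul_smul, mul_comm, hat_map_hatMk, ← map_comp_apply, ← map_comp_apply]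
    rfl
  · rw [map_zsmul, Sh_nmk, Finset.smul_sum]
    refine Finset.sum_congr rfl fun t _ => ?_
    rw [smul_smul, mul_comm, hat_map_hatMk, ← map_comp_apply, ← map_comp_apply]

/-- The Eilenberg–Zilber map on a `0`-chain and an arbitrary chain. -/
theorem Sh_zero_left {q : ℕ} (x : X.obj (op ⦋0⦌)) (y : Y.obj (op ⦋q⦌)) (α : ⦋q⦌ ⟶ ⦋0⦌) :
    Sh X Y (Nat.zero_add q) (nmk X 0 x) (nmk Y q y) =
      nmk (hat X Y) q (hatMk X Y _ (X.map α.op x) y) := by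
  rw [Sh_nmk]
  refine (Shuffle.sum_zero_left (fun α β => nmk (hat X Y) q (hatMk X Y _ (X.map α.op x)
    (Y.map β.op y))) α).trans ?_
  simp

end Normalized
end SymHom

namespace SymHom
open scoped TensorProduct Simplicial

/-! ### The external product in homology -/

section HomologyElements
variable {k : Type u} [CommRing k] (K : ChainComplex (ModuleCat.{u} k) ℕ)

theorem iCycles_injective (n : ℕ) : Function.Injective (K.iCycles n) :=
  (ModuleCat.mono_iff_injective _).1 inferInstance

theorem homologyπ_surjective (n : ℕ) : Function.Surjective (K.homologyπ n) :=
  (ModuleCat.epi_iff_surjective _).1 inferInstance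

theorem d_iCycles (n j : ℕ) (z : K.cycles n) : K.d n j (K.iCycles n z) = 0 :=
  congrArg (fun t => t.hom z) (K.iCycles_d n j)

theorem exists_cycle {n : ℕ} (x : K.X n) (hx : ∀ j, K.d n j x = 0) :
    ∃ z : K.cycles n, K.iCycles n z = x := by
  let f : ModuleCat.of k k ⟶ K.X n := ModuleCat.ofHom (LinearMap.toSpanSingleton k _ x)
  have hf : f ≫ K.d n ((ComplexShape.down ℕ).next n) = 0 :=
    ModuleCat.hom_ext (LinearMap.ext_ring (by
    change K.d n ((ComplexShape.down ℕ).next n) ((1 : k) • x) = 0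
    rw [one_smul, hx]))
  refine ⟨K.liftCycles f _ rfl hf (1 : k), ?_⟩
  have := congrArg (fun t => t.hom (1 : k)) (K.liftCycles_i f _ rfl hf)
  exact this.trans (one_smul k x)

/-- The cycle given by a chain with zero boundary. -/
noncomputable def mkCycle {n : ℕ} (x : K.X n) (hx : ∀ j, K.d n j x = 0) : K.cycles n :=
  (exists_cycle K x hx).choose

@[simp] theorem iCycles_mkCycle {n : ℕ} (x : K.X n) (hx : ∀ j, K.d n j x = 0) :
    K.iCycles n (mkCycle K x hx) = x := (exists_cycle K x hx).choose_spec

theorem homologyπ_eq_zero_iff {n : ℕ} (z : K.cycles n) :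
    K.homologyπ n z = 0 ↔ ∃ w : K.X (n + 1), K.d (n + 1) n w = K.iCycles n z := by
  have h1 := (ShortComplex.moduleCat_exact_iff _).1
    (ShortComplex.exact_of_g_is_cokernel
      (ShortComplex.mk (K.toCycles (n + 1) n) (K.homologyπ n) (by simp))
      (K.homologyIsCokernel (n + 1) n (by simp)))
  have h2 (w : K.X (n + 1)) : K.iCycles n (K.toCycles (n + 1) n w) = K.d (n + 1) n w :=
    congrArg (fun t => t.hom w) (K.toCycles_i (n + 1) n)
  constructor
  · intro h
    obtain ⟨w, hw⟩ := h1 z h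
    exact ⟨w, by rw [← hw, ← h2]⟩
  · rintro ⟨w, hw⟩
    have : K.toCycles (n + 1) n w = z := iCycles_injective K n (by rw [h2, hw])
    rw [← this]
    exact congrArg (fun t => t.hom w) (K.toCycles_comp_homologyπ (n + 1) n)

theorem homologyπ_eq_iff {n : ℕ} (z z' : K.cycles n) : K.homologyπ n z = K.homologyπ n z' ↔
    ∃ w : K.X (n + 1), K.d (n + 1) n w = K.iCycles n z - K.iCycles n z' := by
  rw [← sub_eq_zero, ← map_sub, homologyπ_eq_zero_iff, map_sub]

variable {K}

theorem homologyMap_homologyπ {L : ChainComplex (ModuleCat.{u} k) ℕ} (f : K ⟶ L) (n : ℕ)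
    (z : K.cycles n) (w : L.cycles n) (h : f.f n (K.iCycles n z) = L.iCycles n w) :
    HomologicalComplex.homologyMap f n (K.homologyπ n z) = L.homologyπ n w := by
  have h1 := congrArg (fun t => t.hom z) (HomologicalComplex.homologyπ_naturality f n)
  have h2 := congrArg (fun t => t.hom z) (HomologicalComplex.cyclesMap_i f n)
  refine h1.trans (congrArg (L.homologyπ n) ?_)
  exact iCycles_injective L n (h2.trans h)

end HomologyElements

section NormalizedFunctoriality
variable {k : Type u} [CommRing k] {X Y Z : SimplicialObject (ModuleCat.{u} k)}

theorem normalizedMap_comp (f : X ⟶ Y) (g : Y ⟶ Z) :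
    normalizedMap k (f ≫ g) = normalizedMap k f ≫ normalizedMap k g :=
  HomologicalComplex.Hom.ext <| funext fun _ => ModuleCat.hom_ext <|
    Submodule.linearMap_qext _ <| LinearMap.ext fun _ => rfl

theorem normalizedMap_id : normalizedMap k (𝟙 X) = 𝟙 (normalized X) :=
  HomologicalComplex.Hom.ext <| funext fun _ => ModuleCat.hom_ext <|
    Submodule.linearMap_qext _ <| LinearMap.ext fun _ => rfl

/-- The map induced in normalized homology by a map of simplicial modules. -/
noncomputable abbrev homMap (f : X ⟶ Y) (n : ℕ) :
    (normalized X).homology n ⟶ (normalized Y).homology n :=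
  HomologicalComplex.homologyMap (normalizedMap k f) n

theorem homMap_comp (f : X ⟶ Y) (g : Y ⟶ Z) (n : ℕ) :
    homMap (f ≫ g) n = homMap f n ≫ homMap g n := by
  rw [homMap, normalizedMap_comp, HomologicalComplex.homologyMap_comp]

theorem homMap_comp_apply (f : X ⟶ Y) (g : Y ⟶ Z) (n : ℕ) (a : (normalized X).homology n) :
    homMap (f ≫ g) n a = homMap g n (homMap f n a) := by
  rw [homMap_comp]; rfl

theorem homMap_id (n : ℕ) : homMap (𝟙 X) n = 𝟙 _ := by
  rw [homMap, normalizedMap_id, HomologicalComplex.homologyMap_id]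

end NormalizedFunctoriality

section ExternalProduct
variable {k : Type u} [CommRing k] (X Y : SimplicialObject (ModuleCat.{u} k))

/-- Descent of a bilinear map along surjections. -/
theorem exists_descent {P Q P' Q' M : Type*} [AddCommGroup P] [AddCommGroup Q] [AddCommGroup P']
    [AddCommGroup Q'] [AddCommGroup M] [Module k P] [Module k Q] [Module k P'] [Module k Q']
    [Module k M] (f : P →ₗ[k] P') (g : Q →ₗ[k] Q') (hf : Function.Surjective f)
    (hg : Function.Surjective g) (B : P →ₗ[k] Q →ₗ[k] M) (h1 : ∀ x y, f x = 0 → B x y = 0)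
    (h2 : ∀ x y, g y = 0 → B x y = 0) :
    ∃ C : P' →ₗ[k] Q' →ₗ[k] M, ∀ x y, C (f x) (g y) = B x y := by
  let s := Function.surjInv hf
  let t := Function.surjInv hg
  have hs (x) : f (s x) = x := Function.surjInv_eq hf x
  have ht (y) : g (t y) = y := Function.surjInv_eq hg y
  have key (x x' y y') (hx : f x = f x') (hy : g y = g y') : B x y = B x' y' := by
    have e1 := h1 (x - x') y (by rw [map_sub, hx, sub_self])
    have e2 := h2 x' (y - y') (by rw [map_sub, hy, sub_self])
    rw [map_sub, LinearMap.sub_apply, sub_eq_zero] at e1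
    rw [map_sub, sub_eq_zero] at e2
    rw [e1, e2]
  refine ⟨LinearMap.mk₂ k (fun x y => B (s x) (t y)) (fun x x' y => ?_) (fun c x y => ?_)
    (fun x y y' => ?_) (fun c x y => ?_), fun x y => ?_⟩
  · rw [← LinearMap.add_apply, ← map_add]; exact key _ _ _ _ (by simp [hs]) rfl
  · rw [← LinearMap.smul_apply, ← map_smul]; exact key _ _ _ _ (by simp [hs]) rfl
  · rw [← map_add]; exact key _ _ _ _ rfl (by simp [ht])
  · rw [← map_smul]; exact key _ _ _ _ rfl (by simp [ht])
  · exact key _ _ _ _ (hs _) (ht _)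

/-- The product of two cycles. -/
noncomputable def ShCycle {p q n : ℕ} (h : p + q = n) (x : (normalized X).cycles p)
    (y : (normalized Y).cycles q) : (normalized (hat X Y)).cycles n :=
  mkCycle _ (Sh X Y h ((normalized X).iCycles p x) ((normalized Y).iCycles q y))
    (d_Sh_eq_zero h _ _ (fun j => d_iCycles _ p j x) fun j => d_iCycles _ q j y)

theorem iCycles_ShCycle {p q n : ℕ} (h : p + q = n) (x : (normalized X).cycles p)
    (y : (normalized Y).cycles q) : (normalized (hat X Y)).iCycles n (ShCycle X Y h x y) =
      Sh X Y h ((normalized X).iCycles p x) ((normalized Y).iCycles q y) := iCycles_mkCycle _ _ _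

theorem exists_shH {p q n : ℕ} (h : p + q = n) :
    ∃ C : ((normalized X).homology p : Type u) →ₗ[k] ((normalized Y).homology q : Type u) →ₗ[k]
      ((normalized (hat X Y)).homology n : Type u), ∀ x y,
      C ((normalized X).homologyπ p x) ((normalized Y).homologyπ q y) =
        (normalized (hat X Y)).homologyπ n (ShCycle X Y h x y) := by
  let B : ((normalized X).cycles p : Type u) →ₗ[k] ((normalized Y).cycles q : Type u) →ₗ[k]
      ((normalized (hat X Y)).cycles n : Type u) := LinearMap.mk₂ k (ShCycle X Y h)
    (fun _ _ _ => iCycles_injective _ n (by simp [iCycles_ShCycle]))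
    (fun _ _ _ => iCycles_injective _ n (by simp [iCycles_ShCycle]))
    (fun _ _ _ => iCycles_injective _ n (by simp [iCycles_ShCycle]))
    (fun _ _ _ => iCycles_injective _ n (by simp [iCycles_ShCycle]))
  refine exists_descent ((normalized X).homologyπ p).hom ((normalized Y).homologyπ q).hom
    (homologyπ_surjective _ p) (homologyπ_surjective _ q)
    (B.compr₂ ((normalized (hat X Y)).homologyπ n).hom) (fun x y hx => ?_) fun x y hy => ?_
  · obtain ⟨w, hw⟩ := (homologyπ_eq_zero_iff _ x).1 hx
    refine (homologyπ_eq_zero_iff _ _).2 ⟨Sh X Y (by omega) w ((normalized Y).iCycles q y), ?_⟩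
    rw [d_Sh_of_left h _ _ (fun j => d_iCycles _ q j y), hw]
    exact (iCycles_ShCycle X Y h x y).symm
  · obtain ⟨w, hw⟩ := (homologyπ_eq_zero_iff _ y).1 hy
    refine (homologyπ_eq_zero_iff _ _).2
      ⟨(-1 : ℤ) ^ p • Sh X Y (by omega) ((normalized X).iCycles p x) w, ?_⟩
    rw [map_zsmul, d_Sh_of_right h _ _ (fun j => d_iCycles _ p j x), hw, smul_smul, ← mul_pow]
    simp only [mul_neg, mul_one, neg_neg, one_pow, one_smul]
    exact (iCycles_ShCycle X Y h x y).symm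

/-- The external product `H_p(𝒩X) ⊗ H_q(𝒩Y) → H_{p+q}(𝒩(X ⊗̂ Y))`. -/
noncomputable def shH {p q n : ℕ} (h : p + q = n) : ((normalized X).homology p : Type u) →ₗ[k]
    ((normalized Y).homology q : Type u) →ₗ[k] ((normalized (hat X Y)).homology n : Type u) :=
  (exists_shH X Y h).choose

theorem shH_π {p q n : ℕ} (h : p + q = n) (x : (normalized X).cycles p)
    (y : (normalized Y).cycles q) :
    shH X Y h ((normalized X).homologyπ p x) ((normalized Y).homologyπ q y) =
      (normalized (hat X Y)).homologyπ n (ShCycle X Y h x y) := (exists_shH X Y h).choose_spec x y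

variable {X Y}

theorem shH_naturality {X' Y' : SimplicialObject (ModuleCat.{u} k)} (f : X ⟶ X') (g : Y ⟶ Y')
    {p q n : ℕ} (h : p + q = n) (a : (normalized X).homology p) (b : (normalized Y).homology q) :
    homMap (hatMap f g) n (shH X Y h a b) = shH X' Y' h (homMap f p a) (homMap g q b) := by
  obtain ⟨x, rfl⟩ := homologyπ_surjective _ _ a
  obtain ⟨y, rfl⟩ := homologyπ_surjective _ _ b
  have e1 (n : ℕ) {U V : SimplicialObject (ModuleCat.{u} k)} (f : U ⟶ V)
      (x : (normalized U).cycles n) : homMap f n ((normalized U).homologyπ n x) =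
        (normalized V).homologyπ n (HomologicalComplex.cyclesMap (normalizedMap k f) n x) :=
    homologyMap_homologyπ _ _ _ _
      (congrArg (fun t => t.hom x) (HomologicalComplex.cyclesMap_i (normalizedMap k f) n)).symm
  have e2 (n : ℕ) {U V : SimplicialObject (ModuleCat.{u} k)} (f : U ⟶ V)
      (x : (normalized U).cycles n) : (normalized V).iCycles n
        (HomologicalComplex.cyclesMap (normalizedMap k f) n x) =
        (normalizedMap k f).f n ((normalized U).iCycles n x) :=
    congrArg (fun t => t.hom x) (HomologicalComplex.cyclesMap_i (normalizedMap k f) n)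
  rw [e1, e1, shH_π, shH_π, e1]
  congr 1
  refine iCycles_injective _ n ?_
  rw [e2, iCycles_ShCycle, iCycles_ShCycle, Sh_naturality, e2, e2]

theorem shH_comm {p q n : ℕ} (h : p + q = n) (h' : q + p = n) (a : (normalized X).homology p)
    (b : (normalized Y).homology q) :
    shH Y X h' b a = (-1 : ℤ) ^ (p * q) • homMap (hatSwap X Y) n (shH X Y h a b) := by
  obtain ⟨x, rfl⟩ := homologyπ_surjective _ _ a
  obtain ⟨y, rfl⟩ := homologyπ_surjective _ _ b
  rw [shH_π, shH_π, ← map_zsmul, ← map_zsmul]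
  symm
  refine homologyMap_homologyπ _ _ _ _ ?_
  rw [map_zsmul, map_zsmul, iCycles_ShCycle, iCycles_ShCycle, Sh_comm h h']

theorem shH_assoc {Z : SimplicialObject (ModuleCat.{u} k)} {p q r m m' n : ℕ} (hm : p + q = m)
    (hn : m + r = n) (hm' : q + r = m') (hn' : p + m' = n) (a : (normalized X).homology p)
    (b : (normalized Y).homology q) (c : (normalized Z).homology r) :
    homMap (hatAssoc X Y Z) n (shH (hat X Y) Z hn (shH X Y hm a b) c) =
      shH X (hat Y Z) hn' a (shH Y Z hm' b c) := by
  obtain ⟨x, rfl⟩ := homologyπ_surjective _ _ a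
  obtain ⟨y, rfl⟩ := homologyπ_surjective _ _ b
  obtain ⟨z, rfl⟩ := homologyπ_surjective _ _ c
  rw [shH_π, shH_π, shH_π, shH_π]
  refine homologyMap_homologyπ _ _ _ _ ?_
  rw [iCycles_ShCycle, iCycles_ShCycle, iCycles_ShCycle, iCycles_ShCycle,
    Sh_assoc _ hm hn hm' hn']

theorem d_zero_eq_zero (x : (normalized X).X 0) (j : ℕ) : (normalized X).d 0 j x = 0 := by
  rw [(normalized X).shape 0 j (Nat.succ_ne_zero j)]; rfl

variable (X) in
/-- The homology class of a `0`-chain. -/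
noncomputable def class₀ (x : X.obj (op ⦋0⦌)) : (normalized X).homology 0 :=
  (normalized X).homologyπ 0 (mkCycle _ (nmk X 0 x) (d_zero_eq_zero _))

/-- The ends of a `1`-chain are homologous. -/
theorem class₀_eq_of_face (e : X.obj (op ⦋1⦌)) :
    class₀ X (X.map (SimplexCategory.δ 0).op e) = class₀ X (X.map (SimplexCategory.δ 1).op e) := by
  refine (homologyπ_eq_iff _ _ _).2 ⟨nmk X 1 e, ?_⟩
  rw [normalized_d_nmk, iCycles_mkCycle, iCycles_mkCycle, Fin.sum_univ_two]
  simp [sub_eq_add_neg]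

theorem class₀_add (x y : X.obj (op ⦋0⦌)) : class₀ X (x + y) = class₀ X x + class₀ X y := by
  rw [class₀, class₀, class₀, ← map_add]
  exact congrArg _ (iCycles_injective _ 0 (by simp))

theorem class₀_smul (c : k) (x : X.obj (op ⦋0⦌)) : class₀ X (c • x) = c • class₀ X x := by
  rw [class₀, class₀, ← map_smul]
  exact congrArg _ (iCycles_injective _ 0 (by simp))

/-- The unique map to the terminal object of the simplex category. -/
def toZero (Δ : SimplexCategory) : Δ ⟶ ⦋0⦌ := SimplexCategory.isTerminalZero.from Δ

/-- Multiplication by a `0`-simplex, as a simplicial map `Y ⟶ X ⊗̂ Y`. -/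
noncomputable def hatLeft (Y : SimplicialObject (ModuleCat.{u} k)) (x : X.obj (op ⦋0⦌)) :
    Y ⟶ hat X Y where
  app Δ := ModuleCat.ofHom (hatMk X Y Δ (X.map (toZero Δ.unop).op x))
  naturality Δ Δ' θ := by
    refine ModuleCat.hom_ext (LinearMap.ext fun y => ?_)
    have h : X.map (toZero Δ'.unop).op x = X.map θ (X.map (toZero Δ.unop).op x) := by
      rw [← ConcreteCategory.comp_apply, ← Functor.map_comp]
      congr 3
    exact congrArg (fun t => hatMk X Y Δ' t (Y.map θ y)) h

/-- External multiplication by the class of a `0`-chain. -/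
theorem shH_class₀ (x : X.obj (op ⦋0⦌)) {q : ℕ} (b : (normalized Y).homology q) :
    shH X Y (Nat.zero_add q) (class₀ X x) b = homMap (hatLeft Y x) q b := by
  obtain ⟨y, rfl⟩ := homologyπ_surjective _ _ b
  rw [class₀, shH_π]
  symm
  refine homologyMap_homologyπ _ _ _ _ ?_
  rw [iCycles_ShCycle, iCycles_mkCycle]
  obtain ⟨y', hy'⟩ := nmk_surjective Y _ ((normalized Y).iCycles q y)
  rw [← hy', Sh_zero_left x y' (toZero _)]
  rfl

end ExternalProduct
end SymHom

namespace SymHom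
open scoped TensorProduct Simplicial

/-! ### The cylinder lemma -/

section Cylinder
variable {k : Type u} [CommRing k] {W W' : SimplicialObject (ModuleCat.{u} k)}

/-- Fixing a `0`-chain `x` in a simplicial map `F` out of `X ⊗̂ W` amounts in homology to the external
product with the class of `x`; in particular the result depends only on this class. -/
theorem homMap_hatLeft_comp {X : SimplicialObject (ModuleCat.{u} k)} (F : hat X W ⟶ W')
    (x : X.obj (op ⦋0⦌)) {n : ℕ} (b : (normalized W).homology n) :
    homMap (hatLeft W x ≫ F) n b = homMap F n (shH X W (Nat.zero_add n) (class₀ X x) b) := by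
  rw [homMap_comp_apply, shH_class₀]

/-- The generator of a free module given by a simplex. -/
noncomputable def simp1 (S : SSet.{0}) {Δ : SimplexCategoryᵒᵖ} (s : S.obj Δ) :
    (S ⋙ linearize k).obj Δ := (Finsupp.single s 1 : S.obj Δ →₀ k)

theorem map_simp1 (S : SSet.{0}) {Δ Δ' : SimplexCategoryᵒᵖ} (θ : Δ ⟶ Δ') (s : S.obj Δ) :
    (S ⋙ linearize k).map θ (simp1 (k := k) S s) = simp1 S (S.map θ s) := Finsupp.mapDomain_single

theorem linearCombination_simp1 (S : SSet.{0}) {Δ : SimplexCategoryᵒᵖ} {M : Type*} [AddCommGroup M]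
    [Module k M] (h : S.obj Δ → M) (s : S.obj Δ) :
    Finsupp.linearCombination k h (simp1 (k := k) S s) = h s :=
  (Finsupp.linearCombination_single k (1 : k) s).trans (one_smul k _)

/-- The ends of an edge have the same homology class. -/
theorem class₀_simp1_eq (S : SSet.{0}) (e : S.obj (op ⦋1⦌)) (s t : S.obj (op ⦋0⦌))
    (hs : S.map (SimplexCategory.δ 1).op e = s) (ht : S.map (SimplexCategory.δ 0).op e = t) :
    class₀ (S ⋙ linearize k) (simp1 S s) = class₀ (S ⋙ linearize k) (simp1 S t) := by
  rw [← hs, ← ht, ← map_simp1, ← map_simp1]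
  exact (class₀_eq_of_face _).symm

/-- The simplex of a nerve given by a constant functor. -/
def constSimplex (C : Type) [SmallCategory C] (Δ : SimplexCategoryᵒᵖ) (a : C) : (nerve C).obj Δ :=
  (Functor.const _).obj a

theorem class₀_const_eq {C : Type} [SmallCategory C] {a b : C} (f : a ⟶ b) :
    class₀ (nerve C ⋙ linearize k) (simp1 _ (constSimplex C (op ⦋0⦌) a)) =
      class₀ (nerve C ⋙ linearize k) (simp1 _ (constSimplex C (op ⦋0⦌) b)) :=
  class₀_simp1_eq (nerve C) (ComposableArrows.mk₁ f) _ _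
    (ComposableArrows.ext₀ rfl) (ComposableArrows.ext₀ rfl)

/-- A natural family of linear maps `W_Δ → W'_Δ`, indexed by the simplices of `S`, as a map from
`k[S] ⊗̂ W`. -/
noncomputable def family (S : SSet.{0})
    (h : ∀ Δ, S.obj Δ → ((W.obj Δ : Type u) →ₗ[k] (W'.obj Δ : Type u)))
    (hh : ∀ {Δ Δ' : SimplexCategoryᵒᵖ} (θ : Δ ⟶ Δ') (t : S.obj Δ) (w : W.obj Δ),
      W'.map θ (h Δ t w) = h Δ' (S.map θ t) (W.map θ w)) : hat (S ⋙ linearize k) W ⟶ W' where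
  app Δ := ModuleCat.ofHom (TensorProduct.lift (Finsupp.linearCombination k (h Δ)))
  naturality Δ Δ' θ := by
    refine ModuleCat.hom_ext (TensorProduct.ext (Finsupp.lhom_ext' fun s => LinearMap.ext_ring
      (LinearMap.ext fun w => ?_)))
    have e1 := map_simp1 (k := k) S θ s
    change Finsupp.linearCombination k (h Δ') ((S ⋙ linearize k).map θ (simp1 (k := k) S s))
      (W.map θ w) = W'.map θ (Finsupp.linearCombination k (h Δ) (simp1 (k := k) S s) w)
    rw [e1, linearCombination_simp1, linearCombination_simp1, hh]

theorem family_hatMk (S : SSet.{0})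
    (h : ∀ Δ, S.obj Δ → ((W.obj Δ : Type u) →ₗ[k] (W'.obj Δ : Type u))) (hh)
    {Δ : SimplexCategoryᵒᵖ} (s : S.obj Δ) (w : W.obj Δ) :
    (family S h hh).app Δ (hatMk (S ⋙ linearize k) W Δ (simp1 S s) w) = h Δ s w := by
  change Finsupp.linearCombination k (h Δ) (simp1 (k := k) S s) w = h Δ s w
  rw [linearCombination_simp1]

/-- Two simplicial maps which are the ends of a family indexed by the simplices of an interval
agree in homology: external multiplication by an edge is a chain homotopy. -/
theorem homMap_eq_of_family (f g : W ⟶ W')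
    (h : ∀ Δ, (nerve (Fin 2)).obj Δ → ((W.obj Δ : Type u) →ₗ[k] (W'.obj Δ : Type u)))
    (hh : ∀ {Δ Δ' : SimplexCategoryᵒᵖ} (θ : Δ ⟶ Δ') (t : (nerve (Fin 2)).obj Δ) (w : W.obj Δ),
      W'.map θ (h Δ t w) = h Δ' ((nerve (Fin 2)).map θ t) (W.map θ w))
    (h0 : ∀ Δ w, h Δ (constSimplex _ Δ 0) w = f.app Δ w)
    (h1 : ∀ Δ w, h Δ (constSimplex _ Δ 1) w = g.app Δ w) (n : ℕ) :
    homMap f n = homMap g n := by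
  have hc (a : Fin 2) : (hatLeft W (simp1 _ (constSimplex (Fin 2) (op ⦋0⦌) a)) ≫
      family (nerve (Fin 2)) h hh) =
    { app := fun Δ => ModuleCat.ofHom (h Δ (constSimplex _ Δ a))
      naturality := fun Δ Δ' θ => ModuleCat.hom_ext (LinearMap.ext fun w =>
        (hh θ (constSimplex _ Δ a) w).symm) } := by
    refine NatTrans.ext (funext fun Δ => ModuleCat.hom_ext (LinearMap.ext fun w => ?_))
    change (family (nerve (Fin 2)) h hh).app Δ (hatMk _ W Δ
      ((nerve (Fin 2) ⋙ linearize k).map (toZero Δ.unop).op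
        (simp1 _ (constSimplex (Fin 2) (op ⦋0⦌) a))) w) = _
    rw [map_simp1, family_hatMk]
    rfl
  have hf : f = hatLeft W (simp1 _ (constSimplex (Fin 2) (op ⦋0⦌) 0)) ≫
      family (nerve (Fin 2)) h hh := by
    rw [hc]
    exact NatTrans.ext (funext fun Δ => ModuleCat.hom_ext (LinearMap.ext fun w => (h0 Δ w).symm))
  have hg : g = hatLeft W (simp1 _ (constSimplex (Fin 2) (op ⦋0⦌) 1)) ≫
      family (nerve (Fin 2)) h hh := by
    rw [hc]
    exact NatTrans.ext (funext fun Δ => ModuleCat.hom_ext (LinearMap.ext fun w => (h1 Δ w).symm))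
  refine ModuleCat.hom_ext (LinearMap.ext fun b => ?_)
  change homMap f n b = homMap g n b
  rw [hf, hg, homMap_hatLeft_comp, homMap_hatLeft_comp]
  exact congrArg (fun c => homMap _ n (shH _ W (Nat.zero_add n) c b))
    (class₀_const_eq (k := k) (homOfLE (Fin.zero_le (1 : Fin 2))))

end Cylinder
end SymHom

namespace SymHom
open scoped TensorProduct Simplicial

/-! ### The standard resolution -/

section ExtraDegeneracy

/-- A simplex whose first vertex is initial is determined by its zeroth face. -/
theorem nerve_eq_of_isInitial {D : Type} [SmallCategory D] {I : D} (hI : Limits.IsInitial I) {n : ℕ}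
    {F G : ComposableArrows D (n + 1)} (hF : F.obj 0 = I) (hG : G.obj 0 = I)
    (h : (nerve D).δ 0 F = (nerve D).δ 0 G) : F = G := by
  refine ComposableArrows.ext_succ (hF.trans hG.symm) h ?_
  exact (hI.ofIso (eqToIso hF.symm)).hom_ext _ _

variable (k : Type u) [CommRing k] (D : Type) [SmallCategory D]

/-- The simplicial module `k[N D]` with its augmentation to `k`. -/
noncomputable def nerveAug : SimplicialObject.Augmented (ModuleCat.{u} k) where
  left := nerve D ⋙ linearize k
  right := ModuleCat.of k k
  hom :=
    { app := fun Δ => coeffSum k ((nerve D).obj Δ)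
      naturality := fun _ _ _ => (linearize_map_coeffSum k _).trans (Category.comp_id _).symm }

theorem coeffSum_simp1 (S : SSet.{0}) {Δ : SimplexCategoryᵒᵖ} (s : S.obj Δ) :
    coeffSum k (S.obj Δ) (simp1 S s) = 1 :=
  Finsupp.sum_single_index (h := fun _ => LinearMap.id (R := k)) rfl

variable {D}

/-- The simplices of the nerve of a category with an initial object have an extra degeneracy: the
initial object is inserted in front. -/
noncomputable def nerveExtraDegeneracy {I : D} (hI : Limits.IsInitial I) :
    SimplicialObject.Augmented.ExtraDegeneracy (nerveAug k D) where
  s' := ModuleCat.ofHom (LinearMap.toSpanSingleton k _ (simp1 _ (constSimplex D (op ⦋0⦌) I)))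
  s n := (linearize k).map (TypeCat.ofHom fun u : ComposableArrows D n => u.precomp (hI.to u.left))
  s'_comp_ε := by
    refine ModuleCat.hom_ext (LinearMap.ext_ring ?_)
    exact (congrArg (coeffSum k ((nerve D).obj (op ⦋0⦌))) (one_smul k _)).trans
      (coeffSum_simp1 k (nerve D) _)
  s₀_comp_δ₁ := by
    refine ModuleCat.hom_ext (Finsupp.lhom_ext' fun u => LinearMap.ext_ring ?_)
    let v : (nerve D).obj (op ⦋1⦌) := ComposableArrows.precomp u (hI.to (ComposableArrows.left u))
    have h1 : (linearize k).map (TypeCat.ofHom fun u : ComposableArrows D 0 =>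
        u.precomp (hI.to u.left)) (simp1 (k := k) (nerve D) (Δ := op ⦋0⦌) u) = simp1 (nerve D) v :=
      Finsupp.mapDomain_single
    refine (congrArg ((nerve D ⋙ linearize k).map (SimplexCategory.δ 1).op) h1).trans
      ((map_simp1 (nerve D) _ v).trans (Eq.trans ?_ (congrArg
        (fun c : k => c • simp1 (nerve D) (constSimplex D (op ⦋0⦌) I))
          (coeffSum_simp1 k (nerve D) u)).symm))
    rw [one_smul]
    exact congrArg (simp1 (nerve D)) (ComposableArrows.ext₀ rfl)
  s_comp_δ₀ n := by
    refine ((linearize k).map_comp _ _).symm.trans (Eq.trans (congrArg (linearize k).map ?_)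
      ((linearize k).map_id _))
    exact ConcreteCategory.hom_ext _ _ fun u => rfl
  s_comp_δ n i := by
    refine ((linearize k).map_comp _ _).symm.trans (Eq.trans (congrArg (linearize k).map ?_)
      ((linearize k).map_comp _ _))
    refine ConcreteCategory.hom_ext _ _ fun u => ?_
    refine nerve_eq_of_isInitial hI rfl rfl ?_
    exact congrArg (fun t => t ((ComposableArrows.precomp u (hI.to (ComposableArrows.left u)) :
      ComposableArrows D _))) ((nerve D).δ_comp_δ (Fin.zero_le i))
  s_comp_σ n i := by
    refine ((linearize k).map_comp _ _).symm.trans (Eq.trans (congrArg (linearize k).map ?_)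
      ((linearize k).map_comp _ _))
    refine ConcreteCategory.hom_ext _ _ fun u => ?_
    refine nerve_eq_of_isInitial hI rfl rfl ?_
    exact congrArg (fun t => t ((ComposableArrows.precomp u (hI.to (ComposableArrows.left u)) :
      ComposableArrows D _))) ((nerve D).δ_comp_σ_of_le (i := 0) (j := i) (Fin.zero_le _))

variable (D)

/-- The augmentation of `k[N D]` as a chain map. -/
noncomputable def nerveπ : (AlgebraicTopology.alternatingFaceMapComplex _).obj
    (nerve D ⋙ linearize k) ⟶ (ChainComplex.single₀ _).obj (ModuleCat.of k k) :=
  AlgebraicTopology.AlternatingFaceMapComplex.ε.app (nerveAug k D)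

theorem quasiIso_nerveπ {I : D} (hI : Limits.IsInitial I) : QuasiIso (nerveπ k D) :=
  inferInstanceAs (QuasiIso (nerveExtraDegeneracy k hI).homotopyEquiv.hom)

end ExtraDegeneracy

section Std
variable (k : Type u) [CommRing k] (C : Type) [SmallCategory C]

/-- The simplicial right module `k[N(- ∖ C)]` with its augmentation to the constant module. -/
noncomputable def stdAugmented : SimplicialObject.Augmented (Cᵒᵖ ⥤ ModuleCat.{u} k) where
  left := stdRes k C
  right := (Functor.const Cᵒᵖ).obj (ModuleCat.of k k)
  hom :=
    { app := fun Δ =>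
        { app := fun X => coeffSum k ((nerve (Under X.unop)).obj Δ)
          naturality := fun _ _ _ => (linearize_map_coeffSum k _).trans (Category.comp_id _).symm }
      naturality := fun _ _ _ => NatTrans.ext (funext fun _ =>
        (linearize_map_coeffSum k _).trans (Category.comp_id _).symm) }

/-- The augmentation of the standard complex. -/
noncomputable def stdπ : (AlgebraicTopology.alternatingFaceMapComplex _).obj (stdRes k C) ⟶
    (ChainComplex.single₀ _).obj ((Functor.const Cᵒᵖ).obj (ModuleCat.of k k)) :=
  AlgebraicTopology.AlternatingFaceMapComplex.ε.app (stdAugmented k C)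

theorem stdπ_f_zero : (stdπ k C).f 0 = stdAug k C :=
  AlgebraicTopology.AlternatingFaceMapComplex.ε_app_f_zero (stdAugmented k C)

/-- The value of the standard complex at `X` is the chain complex of `k[N(X ∖ C)]`. -/
noncomputable def evalStd (X : C) :
    (((evaluation Cᵒᵖ (ModuleCat.{u} k)).obj (op X)).mapHomologicalComplex _).obj
      ((AlgebraicTopology.alternatingFaceMapComplex _).obj (stdRes k C)) ≅
    (AlgebraicTopology.alternatingFaceMapComplex _).obj (nerve (Under X) ⋙ linearize k) :=
  HomologicalComplex.Hom.isoOfComponents (fun n => Iso.refl _) fun i j h => by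
    have h : j + 1 = i := h
    subst h
    refine (Category.id_comp _).trans (Eq.trans ?_ (Category.comp_id _).symm)
    rw [AlgebraicTopology.alternatingFaceMapComplex_obj_d,
      Functor.mapHomologicalComplex_obj_d, AlgebraicTopology.alternatingFaceMapComplex_obj_d,
      AlgebraicTopology.AlternatingFaceMapComplex.objD,
      AlgebraicTopology.AlternatingFaceMapComplex.objD, Functor.map_sum]
    simp only [Functor.map_zsmul]
    rfl

instance : QuasiIso (stdπ k C) := by
  rw [HomologicalComplex.quasiIso_iff_evaluation]
  rintro ⟨X⟩
  have := quasiIso_nerveπ k (Under X) (Under.mkIdInitial (X := X))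
  let j := ((HomologicalComplex.singleMapHomologicalComplex
    ((evaluation Cᵒᵖ (ModuleCat.{u} k)).obj (op X)) (ComplexShape.down ℕ) 0).app
      ((Functor.const Cᵒᵖ).obj (ModuleCat.of k k)))
  have h2 : (((evaluation Cᵒᵖ (ModuleCat.{u} k)).obj (op X)).mapHomologicalComplex _).map
      (stdπ k C) ≫ j.hom = (evalStd k C X).hom ≫
        nerveπ k (Under X) := by
    refine (ChainComplex.toSingle₀Equiv _ _).injective (Subtype.ext ?_)
    change ((stdπ k C).f 0).app (op X) ≫ j.hom.f 0 = 𝟙 _ ≫ (nerveπ k (Under X)).f 0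
    have h1 : (nerveπ k (Under X)).f 0 = coeffSum k ((nerve (Under X)).obj (op ⦋0⦌)) :=
      AlgebraicTopology.AlternatingFaceMapComplex.ε_app_f_zero (nerveAug k (Under X))
    have h3 : j.hom.f 0 = 𝟙 _ := HomologicalComplex.singleMapHomologicalComplex_hom_app_self
      ((evaluation Cᵒᵖ (ModuleCat.{u} k)).obj (op X)) (c := ComplexShape.down ℕ) 0 _
    rw [h1, h3, stdπ_f_zero]
    exact (Category.comp_id _).trans (Category.id_comp _).symm
  rw [← quasiIso_iff_comp_right _ j.hom, h2]
  exact quasiIso_comp _ _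

variable {k C}

/-- The chain `σ`, as a simplex of the under-category of its first object. -/
def underChain {n : ℕ} (σ : Fin (n + 1) ⥤ C) : Fin (n + 1) ⥤ Under (σ.obj 0) where
  obj i := Under.mk (σ.map (homOfLE (Fin.zero_le i)))
  map {i j} f := Under.homMk (σ.map f) (by
    exact (σ.map_comp _ _).symm)
  map_id i := Under.UnderMorphism.ext (σ.map_id i)
  map_comp f g := Under.UnderMorphism.ext (σ.map_comp f g)

theorem under_ext {J : Type} [SmallCategory J] {Z : C} (F G : J ⥤ Under Z)
    (h : F ⋙ Under.forget Z = G ⋙ Under.forget Z) (hobj : ∀ j, F.obj j = G.obj j) : F = G :=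
  CategoryTheory.Functor.ext hobj fun i j f => Under.UnderMorphism.ext <| by
    rw [Under.comp_right, Under.comp_right, Under.eqToHom_right, Under.eqToHom_right]
    exact Functor.congr_hom h f

/-- Every simplex of an under-category comes from `underChain` by restriction along its first arrow. -/
theorem underChain_forget {n : ℕ} {X : C} (u : Fin (n + 1) ⥤ Under X) :
    underChain (u ⋙ Under.forget X) ⋙ Under.map (u.obj 0).hom = u :=
  under_ext _ _ rfl fun i => congrArg Under.mk (Under.w (u.map (homOfLE (Fin.zero_le i))))

/-- In degree `n` the standard complex is the sum of the representable modules `k[Hom(-, σ 0)]` over the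
chains `σ` in `C`: a map out of it is determined by arbitrary values on the simplices `underChain σ`. -/
instance (n : ℕ) : Projective ((stdRes k C).obj (op ⦋n⦌)) where
  factors {E G} f e he := by
    have hs (X : C) : Function.Surjective (e.app (op X)) :=
      (ModuleCat.epi_iff_surjective _).1 ((NatTrans.epi_iff_epi_app e).1 he (op X))
    choose l hl using fun σ : Fin (n + 1) ⥤ C =>
      hs (σ.obj 0) (f.app _ (stdSingle k C (Δ := op ⦋n⦌) (underChain σ)))
    let g (X : C) : (((stdRes k C).obj (op ⦋n⦌)).obj (op X) : Type u) →ₗ[k]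
        (E.obj (op X) : Type u) :=
      Finsupp.linearCombination k fun u : Fin (n + 1) ⥤ Under X =>
        E.map (u.obj 0).hom.op (l (u ⋙ Under.forget X))
    have hg (X : C) (u : Fin (n + 1) ⥤ Under X) : g X (stdSingle k C (Δ := op ⦋n⦌) u) =
        E.map (u.obj 0).hom.op (l (u ⋙ Under.forget X)) :=
      (Finsupp.linearCombination_single k (1 : k) u).trans (one_smul k _)
    refine ⟨{ app := fun X => ModuleCat.ofHom (g X.unop), naturality := ?_ }, ?_⟩
    · rintro ⟨Y⟩ ⟨X⟩ φ
      refine ModuleCat.hom_ext (std_hom_ext k fun u => ?_)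
      change g X (((stdRes k C).obj (op ⦋n⦌)).map φ.unop.op (stdSingle k C u)) =
        E.map φ (g Y (stdSingle k C u))
      rw [stdSingle_map]
      refine (hg X _).trans (Eq.trans ?_ (congrArg (E.map φ) (hg Y u)).symm)
      exact congrArg (fun t => t.hom (l (u ⋙ Under.forget Y)))
        (E.map_comp (Functor.obj (C := Fin (n + 1)) u 0).hom.op φ)
    · refine NatTrans.ext (funext fun X => ModuleCat.hom_ext (std_hom_ext k fun u => ?_))
      change e.app X (g X.unop (stdSingle k C u)) = f.app X (stdSingle k C u)
      have h1 := NatTrans.naturality_apply e (u.obj 0).hom.op (l (u ⋙ Under.forget X.unop))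
      have h2 := NatTrans.naturality_apply f (u.obj 0).hom.op
        (stdSingle k C (Δ := op ⦋n⦌) (underChain (u ⋙ Under.forget X.unop)))
      refine (congrArg (e.app X) (hg X.unop u)).trans (h1.trans
        ((congrArg (G.map (u.obj 0).hom.op) (hl (u ⋙ Under.forget X.unop))).trans
          (h2.symm.trans ?_)))
      refine congrArg (f.app X) ((stdSingle_map k _ _).trans ?_)
      exact congrArg (stdSingle k C) (underChain_forget u)

variable (k C)

/-- The standard complex is a projective resolution of the constant module `k`. -/
noncomputable def stdResolution : ProjectiveResolution
    ((Functor.const Cᵒᵖ).obj (ModuleCat.of k k) : Cᵒᵖ ⥤ ModuleCat.{u} k) where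
  complex := (AlgebraicTopology.alternatingFaceMapComplex _).obj (stdRes k C)
  projective n := inferInstanceAs (Projective ((stdRes k C).obj (op ⦋n⦌)))
  π := stdπ k C

end Std
end SymHom

namespace SymHom
open scoped TensorProduct Simplicial
open AlgebraicTopology AlgebraicTopology.DoldKan

/-! ### Comparison of the normalized and unnormalized complexes -/

section Normalization
variable {k : Type u} [CommRing k] (X : SimplicialObject (ModuleCat.{u} k))

theorem PInfty_eq_zero_of_mem_degen {n : ℕ} (x : X.obj (op ⦋n⦌)) (hx : x ∈ degen X n) :
    (PInfty (X := X)).f n x = 0 := by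
  suffices degen X n ≤ LinearMap.ker ((PInfty (X := X)).f n).hom from this hx
  cases n with
  | zero => exact bot_le (α := Submodule k (X.obj (op ⦋0⦌)))
  | succ n =>
    refine iSup_le fun i => ?_
    rintro _ ⟨y, rfl⟩
    exact congrArg (fun t => t.hom y) (σ_comp_PInfty X i)

theorem QInfty_mem_degen {n : ℕ} (x : X.obj (op ⦋n⦌)) : (QInfty (X := X)).f n x ∈ degen X n := by
  cases n with
  | zero =>
    rw [QInfty_f_0]
    exact zero_mem _
  | succ n =>
    rw [QInfty_f, decomposition_Q]
    simp only [ModuleCat.hom_sum, LinearMap.sum_apply]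
    refine sum_mem fun i _ => ?_
    exact σ_mem_degen X _ _

theorem nmk_PInfty {n : ℕ} (x : X.obj (op ⦋n⦌)) :
    nmk X n ((PInfty (X := X)).f n x) = nmk X n x := by
  have h := congrArg (fun t => t.hom x) (PInfty_f_add_QInfty_f (X := X) n)
  have h' : (PInfty (X := X)).f n x + (QInfty (X := X)).f n x = x := h
  have h0 : nmk X n ((QInfty (X := X)).f n x) = 0 :=
    (Submodule.Quotient.mk_eq_zero _).2 (QInfty_mem_degen X x)
  have := congrArg (nmk X n) h'
  rwa [map_add, h0, add_zero] at this

/-- The projection `PInfty` vanishes on degenerate chains, and induces a section of the projection to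
the normalized complex. -/
noncomputable def fromNormalized : normalized X ⟶ (alternatingFaceMapComplex _).obj X where
  f n := ModuleCat.ofHom ((degen X n).liftQ ((PInfty (X := X)).f n).hom
    (PInfty_eq_zero_of_mem_degen X))
  comm' i j _ := by
    refine ModuleCat.hom_ext (Submodule.linearMap_qext _ (LinearMap.ext fun x => ?_))
    exact congrArg (fun t => t.hom x) ((PInfty (X := X)).comm i j)

/-- The projection to the normalized complex is a homotopy equivalence. -/
noncomputable def normalizedHomotopyEquiv :
    HomotopyEquiv ((alternatingFaceMapComplex _).obj X) (normalized X) where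
  hom := toNormalized k X
  inv := fromNormalized X
  homotopyHomInvId := (Homotopy.ofEq (HomologicalComplex.Hom.ext <| funext fun _ =>
    ModuleCat.hom_ext <| LinearMap.ext fun _ => rfl)).trans (homotopyPInftyToId X)
  homotopyInvHomId := Homotopy.ofEq (HomologicalComplex.Hom.ext <| funext fun _ =>
    ModuleCat.hom_ext <| Submodule.linearMap_qext _ <| LinearMap.ext fun x => nmk_PInfty X x)

instance : QuasiIso (toNormalized k X) :=
  inferInstanceAs (QuasiIso (normalizedHomotopyEquiv X).hom)

theorem toNormalized_naturality {Y : SimplicialObject (ModuleCat.{u} k)} (f : X ⟶ Y) :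
    (alternatingFaceMapComplex _).map f ≫ toNormalized k Y = toNormalized k X ≫ normalizedMap k f :=
  rfl

end Normalization

section Comparison
variable (k : Type u) [CommRing k] (A : Type u) [Ring A] [Algebra k A]

theorem stdResolution_isAugmented : IsAugmented k (stdResolution k DeltaS) (𝟙 _) := by
  have h : (HomologicalComplex.singleObjXSelf (ComplexShape.down ℕ) 0
    ((Functor.const DeltaSᵒᵖ).obj (ModuleCat.of k k) : DeltaSᵒᵖ ⥤ ModuleCat.{u} k)).hom = 𝟙 _ := rfl
  refine (Category.id_comp _).trans ?_
  rw [h]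
  exact (stdπ_f_zero k DeltaS).symm.trans (Category.comp_id _).symm

/-- The map from the standard complex to the normalized complex of `𝒴⁺`. -/
noncomputable def stdToNY : ((tensorFunctor k (Bsym k A)).mapHomologicalComplex _).obj
    (stdComplex k) ⟶ NYplus k A :=
  tensorStd k A ≫ (alternatingFaceMapComplex _).map (inclY k A) ≫ toNormalized k (Yplus k A)

theorem comparison_def (P : ProjectiveResolution
      ((Functor.const DeltaSᵒᵖ).obj (ModuleCat.of k k) : DeltaSᵒᵖ ⥤ ModuleCat.{u} k))
    (φ : P.complex ⟶ stdComplex k) (n : ℕ) : comparison k A P φ n =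
      (P.isoLeftDerivedObj (tensorFunctor k (Bsym k A)) n).hom ≫ HomologicalComplex.homologyMap
        (((tensorFunctor k (Bsym k A)).mapHomologicalComplex _).map φ) n ≫
          HomologicalComplex.homologyMap (stdToNY k A) n :=
  congrArg (fun t => _ ≫ t) (HomologicalComplex.homologyMap_comp _ _ n)

theorem comparison_std (n : ℕ) : comparison k A (stdResolution k DeltaS) (𝟙 _) n =
    ((stdResolution k DeltaS).isoLeftDerivedObj (tensorFunctor k (Bsym k A)) n).hom ≫
      HomologicalComplex.homologyMap (stdToNY k A) n := by
  refine (comparison_def k A (stdResolution k DeltaS) (𝟙 _) n).trans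
    (congrArg (fun t => _ ≫ t) ?_)
  have h : HomologicalComplex.homologyMap
      (((tensorFunctor k (Bsym k A)).mapHomologicalComplex _).map (𝟙 (stdComplex k))) n = 𝟙 _ := by
    rw [CategoryTheory.Functor.map_id, HomologicalComplex.homologyMap_id]
  exact (congrArg (fun t => t ≫ _) h).trans (Category.id_comp _)

/-- The comparison map does not depend on the projective resolution and on the lift. -/
theorem comparison_eq (P : ProjectiveResolution
      ((Functor.const DeltaSᵒᵖ).obj (ModuleCat.of k k) : DeltaSᵒᵖ ⥤ ModuleCat.{u} k))
    (φ : P.complex ⟶ stdComplex k) (h : IsAugmented k P φ) (n : ℕ) :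
    comparison k A P φ n = comparison k A (stdResolution k DeltaS) (𝟙 _) n := by
  have comm : φ.f 0 ≫ (stdResolution k DeltaS).π.f 0 = P.π.f 0 ≫ 𝟙 _ := by
    have h' : (HomologicalComplex.singleObjXSelf (ComplexShape.down ℕ) 0
      ((Functor.const DeltaSᵒᵖ).obj (ModuleCat.of k k) : DeltaSᵒᵖ ⥤ ModuleCat.{u} k)).hom = 𝟙 _ :=
      rfl
    rw [IsAugmented, h'] at h
    exact (congrArg (fun t => φ.f 0 ≫ t) (stdπ_f_zero k DeltaS)).trans h
  have key := ProjectiveResolution.isoLeftDerivedObj_hom_naturality (𝟙 _) P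
    (stdResolution k DeltaS) φ comm (tensorFunctor k (Bsym k A)) n
  rw [CategoryTheory.Functor.map_id, Category.id_comp] at key
  refine (comparison_def k A P φ n).trans (((Category.assoc _ _ _).symm.trans
    (congrArg (fun t => t ≫ _) key.symm)).trans (comparison_std k A n).symm)

theorem homologyMap_stdToNY (n : ℕ) : HomologicalComplex.homologyMap (stdToNY k A) n =
    HomologicalComplex.homologyMap (tensorStd k A) n ≫
      HomologicalComplex.homologyMap (toNormalized k (YDeltaS k A)) n ≫ homMap (inclY k A) n := by
  rw [stdToNY, toNormalized_naturality, HomologicalComplex.homologyMap_comp,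
    HomologicalComplex.homologyMap_comp]

instance : IsIso (tensorStd k A) :=
  haveI (n : ℕ) : IsIso ((tensorStd k A).f n) := inferInstanceAs (IsIso (𝟙 _))
  HomologicalComplex.Hom.isIso_of_components _

theorem isIso_comparison_std (n : ℕ) (h : IsIso (homMap (inclY k A) n)) :
    IsIso (comparison k A (stdResolution k DeltaS) (𝟙 _) n) := by
  have h1 : IsIso (HomologicalComplex.homologyMap (stdToNY k A) n) := by
    rw [homologyMap_stdToNY]
    infer_instance
  rw [comparison_std]
  have h2 := ((stdResolution k DeltaS).isoLeftDerivedObj (tensorFunctor k (Bsym k A)) n).isIso_hom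
  exact @IsIso.comp_isIso _ _ _ _ _ _ _ h2 h1

end Comparison
end SymHom

namespace SymHom
open scoped TensorProduct Simplicial

/-! ### Functoriality of the bar construction in the category -/

section Push
variable (k : Type u) [CommRing k] {C C' : Type} [SmallCategory C] [SmallCategory C']

/-- The class `u ⊗ b` in the bar construction. -/
noncomputable def barMk (F : C ⥤ ModuleCat.{u} k) (Δ : SimplexCategoryᵒᵖ) (X : C)
    (u : (nerve (Under X)).obj Δ) : (F.obj X : Type u) →ₗ[k] ((stdBar k F).obj Δ : Type u) :=
  TensorOver.mk ((stdRes k C).obj Δ) F X (stdSingle k C u)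

variable {k}

theorem bar_hom_ext {F : C ⥤ ModuleCat.{u} k} {Δ : SimplexCategoryᵒᵖ} {M : Type u} [AddCommGroup M]
    [Module k M] {α β : ((stdBar k F).obj Δ : Type u) →ₗ[k] M}
    (h : ∀ X u b, α (barMk k F Δ X u b) = β (barMk k F Δ X u b)) : α = β := by
  refine TensorOver.hom_ext fun X g b => ?_
  have : α ∘ₗ (TensorOver.mk ((stdRes k C).obj Δ) F X).flip b =
      β ∘ₗ (TensorOver.mk ((stdRes k C).obj Δ) F X).flip b := std_hom_ext k fun u => h X u b
  exact LinearMap.congr_fun this g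

theorem bar_ext {F : C ⥤ ModuleCat.{u} k} {Y : SimplicialObject (ModuleCat.{u} k)}
    {f g : stdBar k F ⟶ Y}
    (h : ∀ Δ X u b, f.app Δ (barMk k F Δ X u b) = g.app Δ (barMk k F Δ X u b)) : f = g :=
  NatTrans.ext (funext fun Δ => ModuleCat.hom_ext (bar_hom_ext (h Δ)))

theorem bar_map {F : C ⥤ ModuleCat.{u} k} {Δ Δ' : SimplexCategoryᵒᵖ} (θ : Δ ⟶ Δ') (X : C)
    (u : (nerve (Under X)).obj Δ) (b : F.obj X) :
    (stdBar k F).map θ (barMk k F Δ X u b) = barMk k F Δ' X ((nerve (Under X)).map θ u) b :=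
  (TensorOver.map_mk _ _ _ _).trans
    (congrArg (fun t => TensorOver.mk ((stdRes k C).obj Δ') F X t b) (stdSingle_app k θ u))

theorem barMk_balanced {F : C ⥤ ModuleCat.{u} k} {Δ : SimplexCategoryᵒᵖ} {X Y : C} (f : X ⟶ Y)
    (u : (nerve (Under Y)).obj Δ) (b : F.obj X) :
    barMk k F Δ X ((nerveMap (Under.map f)).app Δ u) b = barMk k F Δ Y u (F.map f b) :=
  (congrArg (fun t => TensorOver.mk ((stdRes k C).obj Δ) F X t b) (stdSingle_map k f u)).symm.trans
    (TensorOver.mk_balanced f _ b)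

theorem under_post_map (J : C ⥤ C') {X Y : C} (f : X ⟶ Y) :
    Under.map f ⋙ Under.post (X := X) J = Under.post (X := Y) J ⋙ Under.map (J.map f) :=
  under_ext _ _ rfl fun U => congrArg Under.mk (J.map_comp f U.hom)

theorem post_under_map (J : C ⥤ C') {Δ : SimplexCategoryᵒᵖ} {X Y : C} (f : X ⟶ Y)
    (u : (nerve (Under Y)).obj Δ) :
    (nerveMap (Under.post J)).app Δ ((nerveMap (Under.map f)).app Δ u) =
      (nerveMap (Under.map (J.map f))).app Δ ((nerveMap (Under.post J)).app Δ u) :=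
  congrArg (fun H => u ⋙ H) (under_post_map J f)

/-- Linear maps out of a level of the bar construction, given on generators. -/
noncomputable def barLift (F : C ⥤ ModuleCat.{u} k) {Δ : SimplexCategoryᵒᵖ} {M : Type u}
    [AddCommGroup M] [Module k M]
    (φ : ∀ X : C, (nerve (Under X)).obj Δ → (F.obj X : Type u) →ₗ[k] M)
    (h : ∀ (X Y : C) (f : X ⟶ Y) (u : (nerve (Under Y)).obj Δ) (b : F.obj X),
      φ X ((nerveMap (Under.map f)).app Δ u) b = φ Y u (F.map f b)) :
    ((stdBar k F).obj Δ : Type u) →ₗ[k] M :=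
  TensorOver.lift (fun X => Finsupp.linearCombination k (φ X)) fun X Y f g b => by
    have hs (X : C) (u : (nerve (Under X)).obj Δ) :
        Finsupp.linearCombination k (φ X) (stdSingle k C u) = φ X u :=
      (Finsupp.linearCombination_single k (1 : k) u).trans (one_smul k _)
    have : (Finsupp.linearCombination k (φ X)).flip b ∘ₗ (((stdRes k C).obj Δ).map f.op).hom =
        (Finsupp.linearCombination k (φ Y)).flip (F.map f b) := by
      refine std_hom_ext k fun u => ?_
      change Finsupp.linearCombination k (φ X) (((stdRes k C).obj Δ).map f.op (stdSingle k C u)) b =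
        Finsupp.linearCombination k (φ Y) (stdSingle k C u) (F.map f b)
      rw [stdSingle_map, hs, hs, h]
    exact LinearMap.congr_fun this g

theorem barLift_barMk (F : C ⥤ ModuleCat.{u} k) {Δ : SimplexCategoryᵒᵖ} {M : Type u}
    [AddCommGroup M] [Module k M]
    (φ : ∀ X : C, (nerve (Under X)).obj Δ → (F.obj X : Type u) →ₗ[k] M) (h) (X : C)
    (u : (nerve (Under X)).obj Δ) (b : F.obj X) : barLift F φ h (barMk k F Δ X u b) = φ X u b := by
  refine (TensorOver.lift_mk _ _ _ _ _).trans ?_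
  exact congrArg (fun t => t b)
    ((Finsupp.linearCombination_single k (1 : k) u).trans (one_smul k (φ X u)))

/-- The map induced by a functor and a natural map of coefficients, on one level. -/
noncomputable def pushAt (J : C ⥤ C') {F : C ⥤ ModuleCat.{u} k} {F' : C' ⥤ ModuleCat.{u} k}
    (β : F ⟶ J ⋙ F') (Δ : SimplexCategoryᵒᵖ) :
    ((stdBar k F).obj Δ : Type u) →ₗ[k] ((stdBar k F').obj Δ : Type u) :=
  barLift F (fun X u =>
      barMk k F' Δ (J.obj X) ((nerveMap (Under.post J)).app Δ u) ∘ₗ (β.app X).hom)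
    fun X Y f u b => by
      have h2 : F'.map (J.map f) (β.app X b) = β.app Y (F.map f b) :=
        (NatTrans.naturality_apply β f b).symm
      change barMk k F' Δ (J.obj X) _ (β.app X b) = barMk k F' Δ (J.obj Y) _ (β.app Y (F.map f b))
      rw [post_under_map, barMk_balanced, h2]

theorem pushAt_barMk (J : C ⥤ C') {F : C ⥤ ModuleCat.{u} k} {F' : C' ⥤ ModuleCat.{u} k}
    (β : F ⟶ J ⋙ F') (Δ : SimplexCategoryᵒᵖ) (X : C) (u : (nerve (Under X)).obj Δ) (b : F.obj X) :
    pushAt J β Δ (barMk k F Δ X u b) =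
      barMk k F' Δ (J.obj X) ((nerveMap (Under.post J)).app Δ u) (β.app X b) :=
  barLift_barMk _ _ _ _ _ _

/-- The map of bar constructions induced by a functor `J` and a natural map of coefficients. -/
noncomputable def push (J : C ⥤ C') {F : C ⥤ ModuleCat.{u} k} {F' : C' ⥤ ModuleCat.{u} k}
    (β : F ⟶ J ⋙ F') : stdBar k F ⟶ stdBar k F' where
  app Δ := ModuleCat.ofHom (pushAt J β Δ)
  naturality Δ Δ' θ := by
    refine ModuleCat.hom_ext (bar_hom_ext fun X u b => ?_)
    change pushAt J β Δ' ((stdBar k F).map θ (barMk k F Δ X u b)) =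
      (stdBar k F').map θ (pushAt J β Δ (barMk k F Δ X u b))
    rw [pushAt_barMk, bar_map, bar_map, pushAt_barMk]
    rfl

theorem push_barMk (J : C ⥤ C') {F : C ⥤ ModuleCat.{u} k} {F' : C' ⥤ ModuleCat.{u} k}
    (β : F ⟶ J ⋙ F') (Δ : SimplexCategoryᵒᵖ) (X : C) (u : (nerve (Under X)).obj Δ) (b : F.obj X) :
    (push J β).app Δ (barMk k F Δ X u b) =
      barMk k F' Δ (J.obj X) ((nerveMap (Under.post J)).app Δ u) (β.app X b) :=
  pushAt_barMk J β Δ X u b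

end Push

section Append
variable {k : Type u} [CommRing k] {C : Type} [SmallCategory C] {T : C ⥤ C} (η : 𝟭 C ⟶ T)

/-- A natural transformation, as a functor from the interval. -/
abbrev interval : Fin 2 ⥤ C ⥤ C := ComposableArrows.mk₁ η

/-- The natural transformation from the identity to a member of the interval. -/
def intervalFrom (t : Fin 2) : 𝟭 C ⟶ (interval η).obj t :=
  (interval η).map (homOfLE (Fin.zero_le t))

theorem intervalFrom_comp {t t' : Fin 2} (g : t ⟶ t') :
    intervalFrom η t ≫ (interval η).map g = intervalFrom η t' := ((interval η).map_comp _ _).symm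

/-- The homotopy on under-categories, from the identity to `(X → P) ↦ (X → P → T P)`. -/
def underHomotopy (X : C) : Fin 2 × Under X ⥤ Under X where
  obj t := Under.mk (Y := ((interval η).obj t.1).obj t.2.right)
    (t.2.hom ≫ (intervalFrom η t.1).app t.2.right)
  map {t t'} g := Under.homMk ((Functor.uncurry.obj (interval η)).map
      (X := (t.1, t.2.right)) (Y := (t'.1, t'.2.right)) (g.1, g.2.right)) (by
    have h1 := Under.w g.2
    have h2 := (intervalFrom η t'.1).naturality g.2.right
    rw [← intervalFrom_comp η g.1, NatTrans.comp_app] at h2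
    change (t.2.hom ≫ (intervalFrom η t.1).app t.2.right) ≫
      ((interval η).map g.1).app t.2.right ≫ ((interval η).obj t'.1).map g.2.right =
        t'.2.hom ≫ (intervalFrom η t'.1).app t'.2.right
    rw [← h1, Category.assoc, Category.assoc, ← intervalFrom_comp η g.1, NatTrans.comp_app]
    refine congrArg (fun r => t.2.hom ≫ r) ((Category.assoc _ _ _).symm.trans h2.symm))
  map_id t := Under.UnderMorphism.ext ((Functor.uncurry.obj (interval η)).map_id (t.1, t.2.right))
  map_comp {t t' t''} g g' := Under.UnderMorphism.ext
    ((Functor.uncurry.obj (interval η)).map_comp (X := (t.1, t.2.right)) (Y := (t'.1, t'.2.right))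
      (Z := (t''.1, t''.2.right)) (g.1, g.2.right) (g'.1, g'.2.right))

theorem underHomotopy_map {X Y : C} (f : X ⟶ Y) :
    (𝟭 (Fin 2)).prod (Under.map f) ⋙ underHomotopy η X = underHomotopy η Y ⋙ Under.map f :=
  under_ext _ _ rfl fun _ => congrArg Under.mk (Category.assoc _ _ _)

/-- The action of the homotopy on simplices. -/
def underAct {Δ : SimplexCategoryᵒᵖ} (t : (nerve (Fin 2)).obj Δ) {X : C}
    (u : (nerve (Under X)).obj Δ) : (nerve (Under X)).obj Δ :=
  Functor.prod' t u ⋙ underHomotopy η X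

theorem underAct_map {Δ : SimplexCategoryᵒᵖ} (t : (nerve (Fin 2)).obj Δ) {X Y : C} (f : X ⟶ Y)
    (u : (nerve (Under Y)).obj Δ) : underAct η t ((nerveMap (Under.map f)).app Δ u) =
      (nerveMap (Under.map f)).app Δ (underAct η t u) :=
  congrArg (fun H => Functor.prod' t u ⋙ H) (underHomotopy_map η f)

theorem underAct_zero {Δ : SimplexCategoryᵒᵖ} {X : C} (u : (nerve (Under X)).obj Δ) :
    underAct η (constSimplex (Fin 2) Δ 0) u = u := by
  refine under_ext _ _ (Functor.hext (fun _ => rfl) fun i j f => heq_of_eq ?_) fun j => ?_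
  · refine (congrArg (fun α => NatTrans.app α _ ≫ _) ((interval η).map_id 0)).trans ?_
    exact Category.id_comp _
  · exact congrArg Under.mk (Category.comp_id _)

theorem underAct_one {Δ : SimplexCategoryᵒᵖ} {X : C} (u : (nerve (Under X)).obj Δ) :
    underAct η (constSimplex (Fin 2) Δ 1) u =
      (nerveMap (Under.map (η.app X))).app Δ ((nerveMap (Under.post T)).app Δ u) := by
  refine under_ext _ _ (Functor.hext (fun _ => rfl) fun i j f => heq_of_eq ?_) fun j => ?_
  · refine (congrArg (fun α => NatTrans.app α _ ≫ _) ((interval η).map_id 1)).trans ?_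
    exact Category.id_comp _
  · exact congrArg Under.mk (η.naturality (Functor.obj (C := Fin _) (D := Under X) u j).hom)

variable (F : C ⥤ ModuleCat.{u} k)

/-- The simplicial homotopy from the identity to the endomorphism induced by `T`, as a family of linear
maps indexed by the simplices of the interval. -/
noncomputable def barHomotopy (Δ : SimplexCategoryᵒᵖ) (t : (nerve (Fin 2)).obj Δ) :
    ((stdBar k F).obj Δ : Type u) →ₗ[k] ((stdBar k F).obj Δ : Type u) :=
  barLift F (fun X u => barMk k F Δ X (underAct η t u))
    fun X Y f u b => by
      rw [underAct_map, barMk_balanced]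

theorem barHomotopy_barMk (Δ : SimplexCategoryᵒᵖ) (t : (nerve (Fin 2)).obj Δ) (X : C)
    (u : (nerve (Under X)).obj Δ) (b : F.obj X) :
    barHomotopy η F Δ t (barMk k F Δ X u b) = barMk k F Δ X (underAct η t u) b :=
  barLift_barMk _ _ _ _ _ _

/-- The endomorphism of the bar construction induced by a functor `T` receiving a natural
transformation from the identity acts trivially in homology. -/
theorem homMap_push_eq_id (n : ℕ) :
    homMap (push T (F.rightUnitor.inv ≫ Functor.whiskerRight η F) : stdBar k F ⟶ stdBar k F) n =
      𝟙 _ := by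
  rw [← homMap_id]
  symm
  refine homMap_eq_of_family _ _ (barHomotopy η F) (fun {Δ Δ'} θ t w => ?_) (fun Δ w => ?_)
    (fun Δ w => ?_) n
  · have : ((stdBar k F).map θ).hom ∘ₗ barHomotopy η F Δ t =
        barHomotopy η F Δ' ((nerve (Fin 2)).map θ t) ∘ₗ ((stdBar k F).map θ).hom := by
      refine bar_hom_ext fun X u b => ?_
      change (stdBar k F).map θ (barHomotopy η F Δ t (barMk k F Δ X u b)) =
        barHomotopy η F Δ' ((nerve (Fin 2)).map θ t) ((stdBar k F).map θ (barMk k F Δ X u b))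
      rw [barHomotopy_barMk, bar_map, bar_map, barHomotopy_barMk]
      rfl
    exact LinearMap.congr_fun this w
  · have : barHomotopy η F Δ (constSimplex _ Δ 0) = LinearMap.id :=
      bar_hom_ext fun X u b => by rw [barHomotopy_barMk, underAct_zero]; rfl
    rw [this]; rfl
  · have : barHomotopy η F Δ (constSimplex _ Δ 1) = ((push T _).app Δ).hom :=
      bar_hom_ext fun X u b => by
        rw [barHomotopy_barMk, underAct_one, barMk_balanced]
        exact (push_barMk T (F.rightUnitor.inv ≫ Functor.whiskerRight η F) Δ X u b).symm
    exact LinearMap.congr_fun this w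

end Append
end SymHom

namespace SymHom
open scoped TensorProduct Simplicial

/-! ### Adjoining a point -/

section AddPoint

/-- The set with one element. -/
def point : FAs := ⟨1⟩

/-- The fibres of the inclusion of `X` in `[0] ⊙ X`. -/
def ptFib (X : FAs) (i : Fin (FAs.add point X).n) : List (Fin X.n) :=
  match (FAs.sumEquiv point X).symm i with
  | .inl _ => []
  | .inr y => [y]

theorem ptFib_inl (X : FAs) (x : Fin point.n) : ptFib X (FAs.inl point X x) = [] := by
  rw [ptFib, FAs.sumEquiv_symm_inl]

theorem ptFib_inr (X : FAs) (y : Fin X.n) : ptFib X (FAs.inr point X y) = [y] := by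
  rw [ptFib, FAs.sumEquiv_symm_inr]

/-- The inclusion of `X` as the second block of `[0] ⊙ X`. -/
def ptHom (X : FAs) : X ⟶ FAs.add point X :=
  show FAs.Hom _ _ from
  { toFun := FAs.inr point X
    fib := ptFib X
    nodup := FAs.add_cases (fun x => by simp [ptFib_inl]) fun y => by simp [ptFib_inr]
    mem_fib := FAs.add_cases
      (fun x y => by simp [ptFib_inl, (FAs.inl_ne_inr _ _ _ _).symm])
      fun x y => by simp [ptFib_inr, (FAs.inr_injective _ _).eq_iff] }

theorem ptHom_fib_inl (X : FAs) (x : Fin point.n) :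
    FAs.Hom.fib (ptHom X) (FAs.inl point X x) = [] := ptFib_inl X x

theorem ptHom_fib_inr (X : FAs) (y : Fin X.n) :
    FAs.Hom.fib (ptHom X) (FAs.inr point X y) = [y] := ptFib_inr X y

theorem ptHom_naturality {X Y : FAs} (f : X ⟶ Y) :
    ptHom X ≫ FAs.addHom (𝟙 point) f = f ≫ ptHom Y :=
  FAs.hom_ext <| FAs.add_cases
    (fun x => by
      rw [FAs.comp_fib, FAs.comp_fib, FAs.addHom_fib_inl, ptHom_fib_inl]
      simp [ptHom_fib_inl])
    (fun y => by
      rw [FAs.comp_fib, FAs.comp_fib, FAs.addHom_fib_inr, ptHom_fib_inr]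
      simp [List.flatMap_map, ptHom_fib_inr])

/-- The functor `[0] ⊙ -`, with values in the non-empty sets. -/
def addPoint : FAs ⥤ DeltaS where
  obj X := ⟨FAs.add point X, by change 1 + X.n ≠ 0; omega⟩
  map f := ObjectProperty.homMk (FAs.addHom (𝟙 _) f)
  map_id X := ObjectProperty.hom_ext _ (FAs.addHom_id _ X)
  map_comp f g := ObjectProperty.hom_ext _ (by
    have := FAs.addHom_comp (𝟙 point) f (𝟙 _) g
    rwa [Category.id_comp] at this)

/-- The natural inclusion `X → [0] ⊙ X`. -/
def ptUnit : 𝟭 FAs ⟶ addPoint ⋙ inclDeltaS where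
  app X := ptHom X
  naturality _ _ f := (ptHom_naturality f).symm

/-- The natural inclusion `X → [0] ⊙ X` for non-empty sets `X`. -/
def ptUnitDeltaS : 𝟭 DeltaS ⟶ inclDeltaS ⋙ addPoint where
  app X := ObjectProperty.homMk (ptHom X.obj)
  naturality _ _ f := ObjectProperty.hom_ext _ (ptHom_naturality f.hom).symm

variable (k : Type u) [CommRing k] (A : Type u) [Ring A] [Algebra k A]

/-- The insertion of a unit, `𝒴⁺_* A → k[N(- ∖ ΔS)] ⊗_{ΔS} B^{sym}_* A`. -/
noncomputable def retractY : Yplus k A ⟶ YDeltaS k A :=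
  push (F := Bplus k A) (F' := Bsym k A) addPoint
    ((Bplus k A).rightUnitor.inv ≫ Functor.whiskerRight ptUnit (Bplus k A))

theorem inclY_barMk (Δ : SimplexCategoryᵒᵖ) (X : DeltaS) (u : (nerve (Under X)).obj Δ)
    (b : (Bsym k A).obj X) : (inclY k A).app Δ (barMk k (Bsym k A) Δ X u b) =
      barMk k (Bplus k A) Δ X.obj ((nerveMap (Under.post (X := X) inclDeltaS)).app Δ u) b :=
  (inclYAt_mk k A X _ b).trans (congrArg (fun t => Ymk k A Δ X.obj t b) (stdIncl_single k u))

theorem inclY_retractY : inclY k A ≫ retractY k A =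
    push (inclDeltaS ⋙ addPoint)
      ((Bsym k A).rightUnitor.inv ≫ Functor.whiskerRight ptUnitDeltaS (Bsym k A)) := by
  refine bar_ext fun Δ X u b => ?_
  refine (congrArg ((retractY k A).app Δ) (inclY_barMk k A Δ X u b)).trans
    ((push_barMk _ _ Δ _ _ _).trans ?_)
  exact (push_barMk (inclDeltaS ⋙ addPoint)
    ((Bsym k A).rightUnitor.inv ≫ Functor.whiskerRight ptUnitDeltaS (Bsym k A)) Δ X u b).symm

theorem retractY_inclY : retractY k A ≫ inclY k A =
    push (addPoint ⋙ inclDeltaS)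
      ((Bplus k A).rightUnitor.inv ≫ Functor.whiskerRight ptUnit (Bplus k A)) := by
  refine bar_ext fun Δ X u b => ?_
  refine (congrArg ((inclY k A).app Δ) (push_barMk _ _ Δ X u b)).trans
    ((inclY_barMk k A Δ _ _ _).trans ?_)
  exact (push_barMk (addPoint ⋙ inclDeltaS)
    ((Bplus k A).rightUnitor.inv ≫ Functor.whiskerRight ptUnit (Bplus k A)) Δ X u b).symm

/-- The inclusion of the non-empty sets does not change the homology: adjoining a point is an
inverse up to homotopy. -/
theorem isIso_homMap_inclY (n : ℕ) : IsIso (homMap (inclY k A) n) :=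
  ⟨homMap (retractY k A) n,
    by rw [← homMap_comp, inclY_retractY]; exact homMap_push_eq_id ptUnitDeltaS (Bsym k A) n,
    by rw [← homMap_comp, retractY_inclY]; exact homMap_push_eq_id ptUnit (Bplus k A) n⟩

/-- The canonical isomorphism of symmetric homology with the homology of `𝒩𝒴⁺`. -/
noncomputable def comparisonIso (n : ℕ) : HS k A n ≅ (NYplus k A).homology n :=
  haveI := isIso_comparison_std k A n (isIso_homMap_inclY k A n)
  asIso (comparison k A (stdResolution k DeltaS) (𝟙 _) n)

end AddPoint
end SymHom

namespace SymHom
open scoped TensorProduct Simplicial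

/-! ### Coherence of the permutative structure -/

section Chains

/-- A bijection, as a morphism of non-commutative sets. -/
def equivHom {X Y : FAs} (e : Fin X.n ≃ Fin Y.n) : X ⟶ Y :=
  show FAs.Hom _ _ from
  { toFun := e
    fib := fun i => [e.symm i]
    nodup := by simp
    mem_fib := fun i x => by simp [Equiv.eq_symm_apply] }

@[simp] theorem equivHom_fib {X Y : FAs} (e : Fin X.n ≃ Fin Y.n) (i : Fin Y.n) :
    FAs.Hom.fib (equivHom e) i = [e.symm i] := rfl

theorem equivHom_trans {X Y Z : FAs} (e : Fin X.n ≃ Fin Y.n) (e' : Fin Y.n ≃ Fin Z.n) :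
    equivHom e ≫ equivHom e' = equivHom (X := X) (Y := Z) (e.trans e') :=
  FAs.hom_ext fun i => by simp

theorem eqToHom_eq_equivHom {X Y : FAs} (h : X = Y) :
    eqToHom h = equivHom (finCongr (congrArg FAs.n h)) := by
  subst h
  exact FAs.hom_ext fun i => by simp

theorem equivHom_comp_eq {X X' Y Y' : FAs} (e : Fin X.n ≃ Fin Y.n) (e' : Fin X'.n ≃ Fin Y'.n)
    (f : X ⟶ X') (g : Y ⟶ Y')
    (h : ∀ i, (FAs.Hom.fib g (e' i)).map e.symm = FAs.Hom.fib f i) :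
    equivHom e ≫ g = f ≫ equivHom e' :=
  FAs.hom_ext fun i => by
    obtain ⟨i, rfl⟩ := e'.surjective i
    rw [FAs.comp_fib, FAs.comp_fib, equivHom_fib, Equiv.symm_apply_apply, List.flatMap_singleton,
      ← h i]
    exact (List.map_eq_flatMap ..).symm

theorem under_obj_ext {Z : FAs} {U V : Under Z} (e : U.right = V.right)
    (h : U.hom ≫ eqToHom e = V.hom) : U = V := by
  obtain ⟨⟨⟨⟩⟩, P, f⟩ := U
  obtain ⟨⟨⟨⟩⟩, Q, g⟩ := V
  obtain rfl : P = Q := e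
  obtain rfl : f = g := by simpa using h
  rfl

/-- Two diagrams in an under-category agree if they are related by identities, `c` being given in a
form other than `eqToHom`. -/
theorem under_chain_ext {J : Type} [SmallCategory J] {Z : FAs} (F G : J ⥤ Under Z)
    (c : ∀ j, (F.obj j).right ⟶ (G.obj j).right) (hc : ∀ j, ∃ e, c j = eqToHom e)
    (h : ∀ j, (F.obj j).hom ≫ c j = (G.obj j).hom)
    (hm : ∀ i j (f : i ⟶ j), (F.map f).right ≫ c j = c i ≫ (G.map f).right) : F = G := by
  choose e he using hc
  obtain rfl : c = fun j => eqToHom (e j) := funext he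
  exact CategoryTheory.Functor.ext (fun j => under_obj_ext (e j) (h j)) fun i j f =>
    Under.UnderMorphism.ext <| by
      rw [Under.comp_right, Under.comp_right, Under.eqToHom_right, Under.eqToHom_right,
        ← Category.assoc, ← hm i j f, Category.assoc, eqToHom_trans, eqToHom_refl, Category.comp_id]

/-- The operation `⊙` on under-categories. -/
def addUnder (X Y : FAs) : Under X × Under Y ⥤ Under (FAs.add X Y) where
  obj t := Under.mk (FAs.addHom t.1.hom t.2.hom)
  map {t t'} g := Under.homMk (FAs.addHom g.1.right g.2.right) (by
    have h := FAs.addHom_comp t.1.hom t.2.hom g.1.right g.2.right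
    rw [Under.w, Under.w] at h
    exact h.symm)
  map_id t := Under.UnderMorphism.ext (FAs.addHom_id _ _)
  map_comp _ _ := Under.UnderMorphism.ext (FAs.addHom_comp _ _ _ _)

variable {J : Type} [SmallCategory J] {X Y Z : FAs}

/-- The operation `⊙` on diagrams in under-categories. -/
def addChain (u : J ⥤ Under X) (v : J ⥤ Under Y) : J ⥤ Under (FAs.add X Y) :=
  Functor.prod' u v ⋙ addUnder X Y

/-- The reassociation of three blocks. -/
def assocEquiv (X Y Z : FAs) :
    Fin (FAs.add (FAs.add X Y) Z).n ≃ Fin (FAs.add X (FAs.add Y Z)).n :=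
  finCongr (Nat.add_assoc X.n Y.n Z.n)

theorem assocEquiv_inl_inl (i : Fin X.n) : assocEquiv X Y Z (FAs.inl _ Z (FAs.inl X Y i)) =
    FAs.inl X (FAs.add Y Z) i := rfl

theorem assocEquiv_inl_inr (i : Fin Y.n) : assocEquiv X Y Z (FAs.inl _ Z (FAs.inr X Y i)) =
    FAs.inr X (FAs.add Y Z) (FAs.inl Y Z i) := rfl

theorem assocEquiv_inr (i : Fin Z.n) : assocEquiv X Y Z (FAs.inr (FAs.add X Y) Z i) =
    FAs.inr X (FAs.add Y Z) (FAs.inr Y Z i) := Fin.ext (Nat.add_assoc _ _ _)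

/-- The associativity of `⊙`, which is an identity up to the equality of its source and target. -/
def assocHom (X Y Z : FAs) : FAs.add (FAs.add X Y) Z ⟶ FAs.add X (FAs.add Y Z) :=
  equivHom (assocEquiv X Y Z)

theorem assocHom_eq (X Y Z : FAs) : ∃ e, assocHom X Y Z = eqToHom e :=
  ⟨congrArg FAs.mk (Nat.add_assoc _ _ _), (eqToHom_eq_equivHom _).symm⟩

theorem assocHom_naturality {X' Y' Z' : FAs} (f : X ⟶ X') (g : Y ⟶ Y') (h : Z ⟶ Z') :
    assocHom X Y Z ≫ FAs.addHom f (FAs.addHom g h) =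
      FAs.addHom (FAs.addHom f g) h ≫ assocHom X' Y' Z' := by
  refine equivHom_comp_eq _ _ _ _
    (FAs.add_cases (FAs.add_cases (fun i => ?_) fun i => ?_) fun i => ?_)
  · rw [FAs.addHom_fib_inl, FAs.addHom_fib_inl, assocEquiv_inl_inl, FAs.addHom_fib_inl,
      List.map_map, List.map_map]
    rfl
  · rw [FAs.addHom_fib_inl, FAs.addHom_fib_inr, assocEquiv_inl_inr, FAs.addHom_fib_inr,
      FAs.addHom_fib_inl, List.map_map, List.map_map, List.map_map]
    rfl
  · rw [FAs.addHom_fib_inr, assocEquiv_inr, FAs.addHom_fib_inr, FAs.addHom_fib_inr, List.map_map,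
      List.map_map]
    exact List.map_congr_left fun x _ => (Equiv.symm_apply_eq _).2 (assocEquiv_inr x).symm

/-- The exchange of two blocks, as a bijection. -/
def flipEquiv (X Y : FAs) : Fin (FAs.add X Y).n ≃ Fin (FAs.add Y X).n := finAddFlip

theorem flipEquiv_inl (i : Fin X.n) : flipEquiv X Y (FAs.inl X Y i) = FAs.inr Y X i :=
  finAddFlip_apply_castAdd _ _

theorem flipEquiv_inr (i : Fin Y.n) : flipEquiv X Y (FAs.inr X Y i) = FAs.inl Y X i :=
  finAddFlip_apply_natAdd _ _

/-- The exchange of two blocks. -/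
def flipHom (X Y : FAs) : FAs.add X Y ⟶ FAs.add Y X := equivHom (flipEquiv X Y)

theorem flipHom_naturality {X' Y' : FAs} (f : X ⟶ X') (g : Y ⟶ Y') :
    flipHom X Y ≫ FAs.addHom g f = FAs.addHom f g ≫ flipHom X' Y' := by
  refine equivHom_comp_eq _ _ _ _ (FAs.add_cases (fun i => ?_) fun i => ?_)
  · rw [flipEquiv_inl, FAs.addHom_fib_inl, FAs.addHom_fib_inr, List.map_map]
    exact List.map_congr_left fun x _ => (Equiv.symm_apply_eq _).2 (flipEquiv_inl x).symm
  · rw [flipEquiv_inr, FAs.addHom_fib_inl, FAs.addHom_fib_inr, List.map_map]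
    exact List.map_congr_left fun x _ => (Equiv.symm_apply_eq _).2 (flipEquiv_inr x).symm

/-- The empty set. -/
def empty : FAs := ⟨0⟩

/-- The removal of an empty first block. -/
def unitEquiv (X : FAs) : Fin (FAs.add empty X).n ≃ Fin X.n := finCongr (Nat.zero_add X.n)

theorem unitEquiv_inr (i : Fin X.n) : unitEquiv X (FAs.inr empty X i) = i :=
  Fin.ext (Nat.zero_add _)

/-- The left unit law of `⊙`, which is an identity up to the equality of its source and target. -/
def unitHom (X : FAs) : FAs.add empty X ⟶ X := equivHom (unitEquiv X)

theorem unitHom_eq (X : FAs) : ∃ e, unitHom X = eqToHom e :=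
  ⟨congrArg FAs.mk (Nat.zero_add _), (eqToHom_eq_equivHom _).symm⟩

theorem unitHom_naturality {X' : FAs} (f : X ⟶ X') :
    unitHom X ≫ f = FAs.addHom (𝟙 empty) f ≫ unitHom X' := by
  refine equivHom_comp_eq _ _ _ _ (FAs.add_cases (fun i => i.elim0) fun i => ?_)
  rw [unitEquiv_inr, FAs.addHom_fib_inr]
  exact List.map_congr_left fun x _ => (Equiv.symm_apply_eq _).2 (unitEquiv_inr x).symm

theorem addChain_assoc (u : J ⥤ Under X) (v : J ⥤ Under Y) (w : J ⥤ Under Z) :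
    addChain (addChain u v) w = addChain u (addChain v w) ⋙ Under.map (assocHom X Y Z) :=
  under_chain_ext _ _ (fun _ => assocHom _ _ _) (fun _ => assocHom_eq _ _ _)
    (fun _ => (assocHom_naturality _ _ _).symm) fun _ _ _ => (assocHom_naturality _ _ _).symm

theorem addChain_empty (v : J ⥤ Under X) :
    addChain ((Functor.const J).obj (Under.mk (𝟙 empty))) v = v ⋙ Under.map (unitHom X) :=
  under_chain_ext _ _ (fun _ => unitHom _) (fun _ => unitHom_eq _)
    (fun _ => (unitHom_naturality _).symm) fun _ _ _ => (unitHom_naturality _).symm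

theorem blockIso_one (P Q : FAs) : blockIso 1 P Q = Iso.refl _ := by
  refine Iso.ext (FAs.hom_ext fun i => ?_)
  simp [blockIso, FAs.permIso, FAs.permHom, FAs.blockPerm]
  rfl

theorem blockIso_of_ne_one {σ : Equiv.Perm (Fin 2)} (hσ : σ ≠ 1) (P Q : FAs)
    (h : FAs.add Q P = FAs.add P Q) : (blockIso σ P Q).hom = flipHom P Q ≫ eqToHom h := by
  rw [eqToHom_eq_equivHom, flipHom, equivHom_trans]
  have h1 : FAs.blockPerm σ P.n Q.n = finAddFlip.trans (finCongr (Nat.add_comm Q.n P.n)) :=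
    if_neg hσ
  exact congrArg (fun e => FAs.permHom (X := FAs.add P Q) e) h1

variable {Δ : SimplexCategoryᵒᵖ}

/-- The operation `⊙` on simplices of the nerves of under-categories. -/
def addNerve (u : (nerve (Under X)).obj Δ) (v : (nerve (Under Y)).obj Δ) :
    (nerve (Under (FAs.add X Y))).obj Δ := addChain u v

theorem addNerve_assoc (u : (nerve (Under X)).obj Δ) (v : (nerve (Under Y)).obj Δ)
    (w : (nerve (Under Z)).obj Δ) : addNerve (addNerve u v) w =
      (nerveMap (Under.map (assocHom X Y Z))).app Δ (addNerve u (addNerve v w)) :=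
  addChain_assoc u v w

theorem addNerve_empty (v : (nerve (Under X)).obj Δ) :
    addNerve (constSimplex (Under empty) Δ (Under.mk (𝟙 empty))) v =
      (nerveMap (Under.map (unitHom X))).app Δ v := addChain_empty v

theorem muNerve_one (u : (nerve (Under X)).obj Δ) (v : (nerve (Under Y)).obj Δ) :
    muNerve (constSimplex _ Δ ⟨1⟩) u v = addNerve u v := by
  refine under_chain_ext _ _ (fun j => (blockIso 1 _ _).inv) (fun j => ⟨rfl, ?_⟩) (fun j => ?_)
    fun i j f => ?_
  · rw [blockIso_one]; rfl
  · exact (Category.assoc _ _ _).trans ((congrArg (fun t => _ ≫ t) (Iso.hom_inv_id _)).trans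
      (Category.comp_id _))
  · refine (Category.assoc _ _ _).trans (congrArg (fun t => _ ≫ t) ?_)
    exact (Category.assoc _ _ _).trans ((congrArg (fun t => _ ≫ t) (Iso.hom_inv_id _)).trans
      (Category.comp_id _))

/-- Up to an identity, exchanging the blocks in the target of `u ⊙ v` is exchanging those of the source
of `v ⊙ u`. -/
theorem muNerve_of_ne_one {σ : Equiv.Perm (Fin 2)} (hσ : σ ≠ 1) (u : (nerve (Under X)).obj Δ)
    (v : (nerve (Under Y)).obj Δ) : muNerve (constSimplex _ Δ ⟨σ⟩) u v =
      (nerveMap (Under.map (flipHom X Y))).app Δ (addNerve v u) := by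
  have e (P Q : FAs) : FAs.add P Q = FAs.add Q P := congrArg FAs.mk (Nat.add_comm _ _)
  have hb (P Q : FAs) : (blockIso σ P Q).hom ≫ eqToHom (e P Q) = flipHom P Q := by
    rw [blockIso_of_ne_one hσ P Q (e Q P), Category.assoc, eqToHom_trans, eqToHom_refl,
      Category.comp_id]
  have hb' (P Q : FAs) : (blockIso σ P Q).inv ≫ flipHom P Q = eqToHom (e P Q) :=
    (Iso.inv_comp_eq _).2 (hb P Q).symm
  refine under_chain_ext _ _ (fun j => eqToHom (e _ _)) (fun j => ⟨_, rfl⟩) (fun j => ?_)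
    fun i j f => ?_
  · refine (Category.assoc _ _ _).trans ((congrArg (fun t => _ ≫ t) (hb _ _)).trans ?_)
    exact (flipHom_naturality _ _).symm
  · refine (Category.assoc _ _ _).trans ((congrArg (fun t => _ ≫ t)
      ((Category.assoc _ _ _).trans (congrArg (fun t => _ ≫ t) (hb _ _)))).trans ?_)
    refine (congrArg (fun t => _ ≫ t) (flipHom_naturality _ _).symm).trans ?_
    exact (Category.assoc _ _ _).symm.trans (congrArg (fun t => t ≫ _) (hb' _ _))

end Chains
end SymHom

namespace SymHom
open scoped TensorProduct Simplicial

/-! ### The product on `𝒴⁺` for a fixed block permutation -/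

section Juxtaposition
variable (k : Type u) [CommRing k] (A : Type u) [Ring A] [Algebra k A] {X Y Z : FAs}

theorem act_equivHom (e : Fin X.n ≃ Fin Y.n) (a : Fin X.n → A) :
    act k A (equivHom e) (PiTensorProduct.tprod k a) =
      PiTensorProduct.tprod k fun i => a (e.symm i) := by
  rw [act_tprod]
  congr 1
  funext i
  simp

theorem map_juxtB_assoc (b : (Bplus k A).obj X) (b' : (Bplus k A).obj Y) (b'' : (Bplus k A).obj Z) :
    (Bplus k A).map (assocHom X Y Z) (juxtB k A _ _ (juxtB k A _ _ b b') b'') =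
      juxtB k A _ _ b (juxtB k A _ _ b' b'') := by
  have : ((juxt k A (FAs.add X Y) Z).compr₂ (act k A (assocHom X Y Z))) ∘ₗ
      TensorProduct.lift (juxt k A X Y) =
      TensorProduct.lift (LinearMap.lcomp _ _ (juxt k A Y Z) ∘ₗ LinearMap.llcomp k _ _ _ ∘ₗ
        (juxt k A X (FAs.add Y Z))) := by
    refine TensorProduct.ext (PiTensorProduct.ext (MultilinearMap.ext fun a => PiTensorProduct.ext
      (MultilinearMap.ext fun a' => PiTensorProduct.ext (MultilinearMap.ext fun a'' => ?_))))
    change act k A (assocHom X Y Z) (juxt k A _ _ (juxt k A _ _ (PiTensorProduct.tprod k a)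
      (PiTensorProduct.tprod k a')) (PiTensorProduct.tprod k a'')) = juxt k A _ _
        (PiTensorProduct.tprod k a) (juxt k A _ _ (PiTensorProduct.tprod k a')
          (PiTensorProduct.tprod k a''))
    rw [juxt_tprod, juxt_tprod, juxt_tprod, juxt_tprod, assocHom, act_equivHom]
    congr 1
    funext i
    obtain ⟨i, rfl⟩ := (assocEquiv X Y Z).surjective i
    rw [Equiv.symm_apply_apply]
    revert i
    refine FAs.add_cases (FAs.add_cases (fun i => ?_) fun i => ?_) fun i => ?_
    · rw [assocEquiv_inl_inl]
      simp [FAs.sumEquiv_symm_inl]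
    · rw [assocEquiv_inl_inr]
      simp [FAs.sumEquiv_symm_inl, FAs.sumEquiv_symm_inr]
    · rw [assocEquiv_inr]
      simp [FAs.sumEquiv_symm_inr]
  exact LinearMap.congr_fun (LinearMap.congr_fun this (b ⊗ₜ b')) b''

theorem map_juxtB_flip (b : (Bplus k A).obj X) (b' : (Bplus k A).obj Y) :
    (Bplus k A).map (flipHom X Y) (juxtB k A _ _ b b') = juxtB k A _ _ b' b := by
  have : (juxt k A X Y).compr₂ (act k A (flipHom X Y)) = (juxt k A Y X).flip := by
    refine PiTensorProduct.ext (MultilinearMap.ext fun a => PiTensorProduct.ext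
      (MultilinearMap.ext fun a' => ?_))
    change act k A (flipHom X Y) (juxt k A _ _ (PiTensorProduct.tprod k a)
      (PiTensorProduct.tprod k a')) = juxt k A _ _ (PiTensorProduct.tprod k a')
        (PiTensorProduct.tprod k a)
    rw [juxt_tprod, juxt_tprod, flipHom, act_equivHom]
    congr 1
    funext i
    obtain ⟨i, rfl⟩ := (flipEquiv X Y).surjective i
    rw [Equiv.symm_apply_apply]
    revert i
    refine FAs.add_cases (fun i => ?_) fun i => ?_
    · rw [flipEquiv_inl, FAs.sumEquiv_symm_inl, FAs.sumEquiv_symm_inr]; rfl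
    · rw [flipEquiv_inr, FAs.sumEquiv_symm_inl, FAs.sumEquiv_symm_inr]; rfl
  exact LinearMap.congr_fun₂ this b b'

/-- The empty tensor. -/
noncomputable def emptyTensor : (Bplus k A).obj empty :=
  PiTensorProduct.tprod k (s := fun _ : Fin empty.n => A) fun i => i.elim0

theorem map_juxtB_empty (b : (Bplus k A).obj X) :
    (Bplus k A).map (unitHom X) (juxtB k A _ _ (emptyTensor k A) b) = b := by
  have : act k A (unitHom X) ∘ₗ juxt k A empty X (emptyTensor k A) = LinearMap.id := by
    refine PiTensorProduct.ext (MultilinearMap.ext fun a => ?_)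
    change act k A (unitHom X) (juxt k A _ _ (PiTensorProduct.tprod k _)
      (PiTensorProduct.tprod k a)) = PiTensorProduct.tprod k a
    rw [juxt_tprod, unitHom, act_equivHom]
    congr 1
    funext i
    obtain ⟨i, rfl⟩ := (unitEquiv X).surjective i
    rw [Equiv.symm_apply_apply]
    revert i
    refine FAs.add_cases (fun i => i.elim0) fun i => ?_
    rw [unitEquiv_inr, FAs.sumEquiv_symm_inr]; rfl
  exact LinearMap.congr_fun this b

end Juxtaposition

section ChiConst
variable (k : Type u) [CommRing k] (A : Type u) [Ring A] [Algebra k A]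

/-- The class `u ⊗ b` in `𝒴⁺`. -/
noncomputable def yMk (Δ : SimplexCategoryᵒᵖ) (X : FAs) (u : (nerve (Under X)).obj Δ) :
    ((Bplus k A).obj X : Type u) →ₗ[k] ((Yplus k A).obj Δ : Type u) := barMk k (Bplus k A) Δ X u

theorem map_yMk {Δ Δ' : SimplexCategoryᵒᵖ} (θ : Δ ⟶ Δ') (X : FAs) (u : (nerve (Under X)).obj Δ)
    (b : (Bplus k A).obj X) : (Yplus k A).map θ (yMk k A Δ X u b) =
      yMk k A Δ' X ((nerve (Under X)).map θ u) b := bar_map (F := Bplus k A) θ X u b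

theorem yMk_balanced {Δ : SimplexCategoryᵒᵖ} {X Y : FAs} (f : X ⟶ Y) (u : (nerve (Under Y)).obj Δ)
    (b : (Bplus k A).obj X) : yMk k A Δ X ((nerveMap (Under.map f)).app Δ u) b =
      yMk k A Δ Y u ((Bplus k A).map f b) := barMk_balanced (F := Bplus k A) f u b

theorem Y_lin_ext {Δ : SimplexCategoryᵒᵖ} {M : Type u} [AddCommGroup M] [Module k M]
    {α β : ((Yplus k A).obj Δ : Type u) →ₗ[k] M}
    (h : ∀ X u b, α (yMk k A Δ X u b) = β (yMk k A Δ X u b)) : α = β := bar_hom_ext h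

theorem chiAt_yMk {Δ : SimplexCategoryᵒᵖ}
    (s : (nerve (Codiscrete (Equiv.Perm (Fin 2)))).obj Δ) (X Y : FAs)
    (u : (nerve (Under X)).obj Δ) (b : (Bplus k A).obj X) (v : (nerve (Under Y)).obj Δ)
    (b' : (Bplus k A).obj Y) :
    chiAt k A s (yMk k A Δ X u b) (yMk k A Δ Y v b') =
      yMk k A Δ (FAs.add X Y) (muNerve s u v) (juxtB k A X Y b b') :=
  (chiAt_mk k A s X Y _ b _ b').trans
    (congrArg (fun t => Ymk k A Δ _ t (juxtB k A X Y b b')) (stdMul_single k s X Y u v))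

/-- The product of `𝒴⁺` given by a vertex of `E S₂`. -/
noncomputable def chiAtConst (σ : Equiv.Perm (Fin 2)) (Δ : SimplexCategoryᵒᵖ) :
    ((Yplus k A).obj Δ : Type u) →ₗ[k] ((Yplus k A).obj Δ : Type u) →ₗ[k]
      ((Yplus k A).obj Δ : Type u) := chiAt k A (constSimplex _ Δ ⟨σ⟩)

theorem chiAtConst_one {Δ : SimplexCategoryᵒᵖ} (X Y : FAs)
    (u : (nerve (Under X)).obj Δ) (b : (Bplus k A).obj X) (v : (nerve (Under Y)).obj Δ)
    (b' : (Bplus k A).obj Y) :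
    chiAtConst k A 1 Δ (yMk k A Δ X u b) (yMk k A Δ Y v b') =
      yMk k A Δ (FAs.add X Y) (addNerve u v) (juxtB k A X Y b b') := by
  rw [chiAtConst, chiAt_yMk, muNerve_one]

/-- The exchange of the blocks in the target is balanced by that in the source. -/
theorem chiAtConst_of_ne_one {σ : Equiv.Perm (Fin 2)} (hσ : σ ≠ 1) {Δ : SimplexCategoryᵒᵖ}
    (x y : (Yplus k A).obj Δ) : chiAtConst k A σ Δ x y = chiAtConst k A 1 Δ y x := by
  have : chiAtConst k A σ Δ = (chiAtConst k A 1 Δ).flip := by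
    refine Y_lin_ext k A fun X u b => Y_lin_ext k A fun Y v b' => ?_
    rw [LinearMap.flip_apply, chiAtConst_one, chiAtConst, chiAt_yMk, muNerve_of_ne_one hσ,
      yMk_balanced, map_juxtB_flip]
  exact LinearMap.congr_fun₂ this x y

theorem chiAtConst_assoc {Δ : SimplexCategoryᵒᵖ} (x y z : (Yplus k A).obj Δ) :
    chiAtConst k A 1 Δ (chiAtConst k A 1 Δ x y) z =
      chiAtConst k A 1 Δ x (chiAtConst k A 1 Δ y z) := by
  let m := chiAtConst k A 1 Δ
  have : m.compr₂ m = LinearMap.lcomp _ _ m ∘ₗ LinearMap.llcomp k _ _ _ ∘ₗ m := by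
    refine Y_lin_ext k A fun X u b => Y_lin_ext k A fun Y v b' => Y_lin_ext k A fun Z w b'' => ?_
    change chiAtConst k A 1 Δ (chiAtConst k A 1 Δ (yMk k A Δ X u b) (yMk k A Δ Y v b'))
      (yMk k A Δ Z w b'') = chiAtConst k A 1 Δ (yMk k A Δ X u b)
        (chiAtConst k A 1 Δ (yMk k A Δ Y v b') (yMk k A Δ Z w b''))
    rw [chiAtConst_one, chiAtConst_one, chiAtConst_one, chiAtConst_one, addNerve_assoc,
      yMk_balanced, map_juxtB_assoc]
  exact LinearMap.congr_fun (LinearMap.congr_fun₂ this x y) z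

/-- The unit of `𝒴⁺`, in dimension zero: the empty tensor over the identity of the empty set. -/
noncomputable def unitY : (Yplus k A).obj (op ⦋0⦌) :=
  yMk k A _ empty (constSimplex (Under empty) _ (Under.mk (𝟙 empty))) (emptyTensor k A)

theorem map_unitY {Δ : SimplexCategoryᵒᵖ} (θ : op ⦋0⦌ ⟶ Δ) : (Yplus k A).map θ (unitY k A) =
    yMk k A Δ empty (constSimplex (Under empty) _ (Under.mk (𝟙 empty)))
      (emptyTensor k A) := map_yMk k A θ _ _ _

theorem chiAtConst_unitY {Δ : SimplexCategoryᵒᵖ} (θ : op ⦋0⦌ ⟶ Δ) (y : (Yplus k A).obj Δ) :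
    chiAtConst k A 1 Δ ((Yplus k A).map θ (unitY k A)) y = y := by
  have : chiAtConst k A 1 Δ ((Yplus k A).map θ (unitY k A)) = LinearMap.id := by
    refine Y_lin_ext k A fun X u b => ?_
    rw [map_unitY, chiAtConst_one, addNerve_empty, yMk_balanced, map_juxtB_empty]
    rfl
  exact LinearMap.congr_fun this y

end ChiConst
end SymHom

namespace SymHom
open scoped TensorProduct Simplicial

/-! ### The Pontryagin product in the homology of `𝒩𝒴⁺` -/

section ChiSimplicial
variable (k : Type u) [CommRing k] (A : Type u) [Ring A] [Algebra k A]

/-- The product of `𝒴⁺` given by a vertex of `E S₂`, as a simplicial map. -/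
noncomputable def chiC (σ : Equiv.Perm (Fin 2)) : hat (Yplus k A) (Yplus k A) ⟶ Yplus k A where
  app Δ := ModuleCat.ofHom (TensorProduct.lift (chiAtConst k A σ Δ))
  naturality Δ _ θ := ModuleCat.hom_ext <| TensorProduct.ext' fun x y =>
    (chiAt_map k A θ (constSimplex _ Δ ⟨σ⟩) x y).symm

theorem chiC_assoc : hatMap (chiC k A 1) (𝟙 (Yplus k A)) ≫ chiC k A 1 =
    hatAssoc _ _ _ ≫ hatMap (𝟙 (Yplus k A)) (chiC k A 1) ≫ chiC k A 1 :=
  NatTrans.ext <| funext fun _ => ModuleCat.hom_ext <| TensorProduct.ext_threefold fun x y z =>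
    chiAtConst_assoc k A x y z

theorem hatSwap_chiC {σ : Equiv.Perm (Fin 2)} (hσ : σ ≠ 1) :
    hatSwap (Yplus k A) (Yplus k A) ≫ chiC k A 1 = chiC k A σ :=
  NatTrans.ext <| funext fun _ => ModuleCat.hom_ext <| TensorProduct.ext' fun x y =>
    (chiAtConst_of_ne_one k A hσ x y).symm

theorem hatLeft_unitY_chiC : hatLeft (Yplus k A) (unitY k A) ≫ chiC k A 1 = 𝟙 _ :=
  NatTrans.ext <| funext fun Δ => ModuleCat.hom_ext <| LinearMap.ext fun y =>
    chiAtConst_unitY k A (toZero Δ.unop).op y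

/-- The `0`-chain of `𝒟_sm(2)` given by a vertex of `E S₂`. -/
noncomputable def vertexChain (σ : Equiv.Perm (Fin 2)) : (Dsm k 2).obj (op ⦋0⦌) :=
  simp1 _ (constSimplex (Codiscrete (Equiv.Perm (Fin 2))) (op ⦋0⦌) ⟨σ⟩)

theorem hatLeft_vertexChain_chiBar (σ : Equiv.Perm (Fin 2)) :
    hatLeft (hat (Yplus k A) (Yplus k A)) (vertexChain k σ) ≫ chiBar k A = chiC k A σ := by
  refine NatTrans.ext <| funext fun Δ => ModuleCat.hom_ext <| TensorProduct.ext' fun x y => ?_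
  have h := map_simp1 (k := k) (nerve (Codiscrete (Equiv.Perm (Fin 2)))) (toZero Δ.unop).op
    (constSimplex (Codiscrete (Equiv.Perm (Fin 2))) (op ⦋0⦌) ⟨σ⟩)
  change chiLin k A Δ ((nerve (Codiscrete (Equiv.Perm (Fin 2))) ⋙ linearize k).map
    (toZero Δ.unop).op (simp1 _ (constSimplex _ (op ⦋0⦌) ⟨σ⟩))) x y = chiAtConst k A σ Δ x y
  rw [h]
  exact LinearMap.congr_fun₂ (linearCombination_simp1 (k := k)
    (nerve (Codiscrete (Equiv.Perm (Fin 2)))) (fun s => chiAt k A s) _) x y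

theorem class₀_vertexChain (σ τ : Equiv.Perm (Fin 2)) :
    class₀ (Dsm k 2) (vertexChain k σ) = class₀ (Dsm k 2) (vertexChain k τ) :=
  class₀_const_eq (C := Codiscrete (Equiv.Perm (Fin 2))) (a := ⟨σ⟩) (b := ⟨τ⟩)
    (Codiscrete.iso _ _).hom

/-- The edges of `E S₂` identify the products given by its vertices. -/
theorem homMap_chiC (σ τ : Equiv.Perm (Fin 2)) (n : ℕ) :
    homMap (chiC k A σ) n = homMap (chiC k A τ) n := by
  refine ModuleCat.hom_ext (LinearMap.ext fun b => ?_)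
  change homMap (chiC k A σ) n b = homMap (chiC k A τ) n b
  rw [← hatLeft_vertexChain_chiBar, ← hatLeft_vertexChain_chiBar, homMap_hatLeft_comp,
    homMap_hatLeft_comp, class₀_vertexChain k σ τ]

/-- The augmentation identifies `H₀(𝒟_ch(2))` with `k`, generated by the class of a vertex. -/
theorem class₀_eq_smul (c : (Dsm k 2).obj (op ⦋0⦌)) :
    class₀ (Dsm k 2) c = augD k 2 (nmk (Dsm k 2) 0 c) • class₀ (Dsm k 2) (vertexChain k 1) := by
  let α : ((nerve (Codiscrete (Equiv.Perm (Fin 2)))).obj (op ⦋0⦌) →₀ k) →ₗ[k]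
      ((normalized (Dsm k 2)).homology 0 : Type u) :=
    { toFun := class₀ (Dsm k 2)
      map_add' := class₀_add (X := Dsm k 2)
      map_smul' := class₀_smul (X := Dsm k 2) }
  let β : ((nerve (Codiscrete (Equiv.Perm (Fin 2)))).obj (op ⦋0⦌) →₀ k) →ₗ[k]
      ((normalized (Dsm k 2)).homology 0 : Type u) :=
    (LinearMap.toSpanSingleton k _ (class₀ (Dsm k 2) (vertexChain k 1))) ∘ₗ
      (coeffSum k ((nerve (Codiscrete (Equiv.Perm (Fin 2)))).obj (op ⦋0⦌))).hom
  have : α = β := Finsupp.lhom_ext' fun s => LinearMap.ext_ring <| by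
    have hs : s = constSimplex (Codiscrete (Equiv.Perm (Fin 2))) (op ⦋0⦌) ⟨(s.obj 0).as⟩ :=
      ComposableArrows.ext₀ rfl
    change class₀ (Dsm k 2) (simp1 _ s) = coeffSum k _ (simp1 _ s) • class₀ (Dsm k 2) _
    rw [coeffSum_simp1, one_smul, hs]
    exact class₀_vertexChain k _ _
  exact LinearMap.congr_fun this c

end ChiSimplicial

section HomologyProduct
variable (k : Type u) [CommRing k] (A : Type u) [Ring A] [Algebra k A]

/-- The Pontryagin product `H_p(𝒩𝒴⁺) ⊗ H_q(𝒩𝒴⁺) → H_{p+q}(𝒩𝒴⁺)`. -/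
noncomputable def mulH {p q n : ℕ} (h : p + q = n) :
    ((NYplus k A).homology p : Type u) →ₗ[k] ((NYplus k A).homology q : Type u) →ₗ[k]
      ((NYplus k A).homology n : Type u) :=
  (shH (Yplus k A) (Yplus k A) h).compr₂ (homMap (chiC k A 1) n).hom

theorem mulH_apply {p q n : ℕ} (h : p + q = n) (a : (NYplus k A).homology p)
    (b : (NYplus k A).homology q) :
    mulH k A h a b = homMap (chiC k A 1) n (shH (Yplus k A) (Yplus k A) h a b) := rfl

theorem mulH_assoc {p q r m m' n : ℕ} (hm : p + q = m) (hn : m + r = n) (hm' : q + r = m')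
    (hn' : p + m' = n) (a : (NYplus k A).homology p) (b : (NYplus k A).homology q)
    (c : (NYplus k A).homology r) :
    mulH k A hn (mulH k A hm a b) c = mulH k A hn' a (mulH k A hm' b c) := by
  have hid (n : ℕ) (a : (NYplus k A).homology n) : a = homMap (𝟙 (Yplus k A)) n a := by
    rw [homMap_id]; rfl
  rw [mulH_apply, mulH_apply, mulH_apply, mulH_apply]
  conv_lhs => rw [hid r c]
  conv_rhs => rw [hid p a]
  rw [← shH_naturality, ← shH_naturality, ← homMap_comp_apply, ← homMap_comp_apply, chiC_assoc,
    homMap_comp_apply, shH_assoc hm hn hm' hn']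

theorem mulH_comm {p q n : ℕ} (h : p + q = n) (h' : q + p = n) (a : (NYplus k A).homology p)
    (b : (NYplus k A).homology q) :
    mulH k A h a b = (-1 : ℤ) ^ (p * q) • mulH k A h' b a := by
  have hσ : Equiv.swap (0 : Fin 2) 1 ≠ 1 := fun e => by
    simpa using congrArg (fun σ : Equiv.Perm (Fin 2) => σ 0) e
  rw [mulH_apply, mulH_apply, shH_comm h' h, map_zsmul, ← homMap_comp_apply, hatSwap_chiC k A hσ,
    homMap_chiC k A _ 1, mul_comm]

/-- The unit of the Pontryagin product. -/
noncomputable def oneH : (NYplus k A).homology 0 := class₀ (Yplus k A) (unitY k A)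

theorem oneH_mulH {q : ℕ} (b : (NYplus k A).homology q) :
    mulH k A (Nat.zero_add q) (oneH k A) b = b := by
  rw [mulH_apply, oneH, ← homMap_hatLeft_comp, hatLeft_unitY_chiC, homMap_id]
  rfl

/-- The structure map on cycles computes the product, whatever the `0`-chain of augmentation one. -/
theorem exists_cycle_chiTilde (c : (Dch k 2).X 0) (hc : augD k 2 c = 1) {p q : ℕ}
    (x : (NYplus k A).cycles p) (y : (NYplus k A).cycles q) :
    ∃ z : (NYplus k A).cycles (p + q),
      (NYplus k A).iCycles (p + q) z = chiTilde k A (Nat.zero_add (p + q)) c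
        ((NYplus k A).iCycles p x) ((NYplus k A).iCycles q y) ∧
      mulH k A rfl ((NYplus k A).homologyπ p x) ((NYplus k A).homologyπ q y) =
        (NYplus k A).homologyπ (p + q) z := by
  obtain ⟨c, rfl⟩ := nmk_surjective _ _ c
  let Y := Yplus k A
  let w := ShCycle (Dsm k 2) (hat Y Y) (Nat.zero_add (p + q))
    (mkCycle _ (nmk (Dsm k 2) 0 c) (d_zero_eq_zero _)) (ShCycle Y Y rfl x y)
  have hz : (normalized Y).iCycles _ (HomologicalComplex.cyclesMap (normalizedMap k (chiBar k A))
      (p + q) w) = (normalizedMap k (chiBar k A)).f (p + q) ((normalized _).iCycles _ w) :=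
    congrArg (fun t => t.hom w) (HomologicalComplex.cyclesMap_i (normalizedMap k (chiBar k A)) _)
  refine ⟨HomologicalComplex.cyclesMap (normalizedMap k (chiBar k A)) (p + q) w, ?_, ?_⟩
  · rw [chiTilde, hz, iCycles_ShCycle, iCycles_ShCycle, iCycles_mkCycle]
  · rw [← homologyMap_homologyπ (normalizedMap k (chiBar k A)) (p + q) w _ hz.symm, ← shH_π,
      ← shH_π, mulH_apply]
    change _ = homMap (chiBar k A) (p + q) (shH _ _ _ (class₀ (Dsm k 2) c) _)
    rw [class₀_eq_smul, hc, one_smul, ← homMap_hatLeft_comp, hatLeft_vertexChain_chiBar]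

end HomologyProduct

section Star
variable (k : Type u) [CommRing k] (A : Type u) [Ring A] [Algebra k A]

/-- The Pontryagin product on the homogeneous components of `HS_*(A)`. -/
noncomputable def mulHS {p q n : ℕ} (h : p + q = n) :
    (HS k A p : Type u) →ₗ[k] (HS k A q : Type u) →ₗ[k] (HS k A n : Type u) :=
  ((mulH k A h).compl₁₂ (comparisonIso k A p).hom.hom (comparisonIso k A q).hom.hom).compr₂
    (comparisonIso k A n).inv.hom

theorem mulHS_apply {p q n : ℕ} (h : p + q = n) (a : HS k A p) (b : HS k A q) :
    mulHS k A h a b = (comparisonIso k A n).inv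
      (mulH k A h ((comparisonIso k A p).hom a) ((comparisonIso k A q).hom b)) := rfl

theorem comparisonIso_hom_inv (n : ℕ) (a : (NYplus k A).homology n) :
    (comparisonIso k A n).hom ((comparisonIso k A n).inv a) = a :=
  congrArg (fun t => t.hom a) (comparisonIso k A n).inv_hom_id

theorem comparisonIso_inv_hom (n : ℕ) (a : HS k A n) :
    (comparisonIso k A n).inv ((comparisonIso k A n).hom a) = a :=
  congrArg (fun t => t.hom a) (comparisonIso k A n).hom_inv_id

theorem mulHS_assoc {p q r m m' n : ℕ} (hm : p + q = m) (hn : m + r = n) (hm' : q + r = m')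
    (hn' : p + m' = n) (a : HS k A p) (b : HS k A q) (c : HS k A r) :
    mulHS k A hn (mulHS k A hm a b) c = mulHS k A hn' a (mulHS k A hm' b c) := by
  simp only [mulHS_apply, comparisonIso_hom_inv]
  rw [mulH_assoc k A hm hn hm' hn']

theorem mulHS_comm {p q n : ℕ} (h : p + q = n) (h' : q + p = n) (a : HS k A p) (b : HS k A q) :
    mulHS k A h a b = (-1 : ℤ) ^ (p * q) • mulHS k A h' b a := by
  rw [mulHS_apply, mulHS_apply, mulH_comm k A h h', map_zsmul]

/-- The unit of `HS_*(A)`. -/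
noncomputable def oneHS : HS k A 0 := (comparisonIso k A 0).inv (oneH k A)

theorem oneHS_mulHS {q : ℕ} (b : HS k A q) : mulHS k A (Nat.zero_add q) (oneHS k A) b = b := by
  rw [mulHS_apply, oneHS, comparisonIso_hom_inv, oneH_mulH, comparisonIso_inv_hom]

/-- The Pontryagin product on `HS_*(A)`. -/
noncomputable def mulStar : HSStar k A →ₗ[k] HSStar k A →ₗ[k] HSStar k A :=
  DirectSum.toModule k ℕ _ fun p => LinearMap.flip <| DirectSum.toModule k ℕ _ fun q =>
    LinearMap.flip <| (mulHS k A (rfl : p + q = p + q)).compr₂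
      (DirectSum.lof k ℕ (fun n => (HS k A n : Type u)) (p + q))

theorem mulStar_HSof {p q n : ℕ} (h : p + q = n) (a : HS k A p) (b : HS k A q) :
    mulStar k A (HSof k A p a) (HSof k A q b) = HSof k A n (mulHS k A h a b) := by
  subst h
  rw [mulStar, HSof, HSof, DirectSum.toModule_lof, LinearMap.flip_apply, DirectSum.toModule_lof]
  rfl

theorem mulStar_comm {p q : ℕ} (a : HS k A p) (b : HS k A q) :
    mulStar k A (HSof k A p a) (HSof k A q b) =
      (-1 : ℤ) ^ (p * q) • mulStar k A (HSof k A q b) (HSof k A p a) := by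
  rw [mulStar_HSof k A rfl, mulStar_HSof k A (Nat.add_comm q p),
    mulHS_comm k A rfl (Nat.add_comm q p)]
  exact map_zsmul (DirectSum.lof k ℕ (fun n => (HS k A n : Type u)) (p + q)) _ _

theorem mulStar_assoc (a b c : HSStar k A) :
    mulStar k A (mulStar k A a b) c = mulStar k A a (mulStar k A b c) := by
  let m := mulStar k A
  have : m.compr₂ m = LinearMap.lcomp _ _ m ∘ₗ LinearMap.llcomp k _ _ _ ∘ₗ m := by
    refine DirectSum.linearMap_ext k fun p => LinearMap.ext fun a => DirectSum.linearMap_ext k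
      fun q => LinearMap.ext fun b => DirectSum.linearMap_ext k fun r => LinearMap.ext fun c => ?_
    change mulStar k A (mulStar k A (HSof k A p a) (HSof k A q b)) (HSof k A r c) =
      mulStar k A (HSof k A p a) (mulStar k A (HSof k A q b) (HSof k A r c))
    rw [mulStar_HSof k A rfl, mulStar_HSof k A rfl, mulStar_HSof k A rfl,
      mulStar_HSof k A (Nat.add_assoc p q r).symm,
      mulHS_assoc k A rfl rfl rfl (Nat.add_assoc p q r).symm]
  exact LinearMap.congr_fun (LinearMap.congr_fun₂ this a b) c

theorem one_mulStar (a : HSStar k A) : mulStar k A (HSof k A 0 (oneHS k A)) a = a := by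
  have : mulStar k A (HSof k A 0 (oneHS k A)) = LinearMap.id := by
    refine DirectSum.linearMap_ext k fun q => LinearMap.ext fun b => ?_
    change mulStar k A (HSof k A 0 (oneHS k A)) (HSof k A q b) = HSof k A q b
    rw [mulStar_HSof k A (Nat.zero_add q), oneHS_mulHS]
  exact LinearMap.congr_fun this a

theorem mulStar_one (a : HSStar k A) : mulStar k A a (HSof k A 0 (oneHS k A)) = a := by
  have : (mulStar k A).flip (HSof k A 0 (oneHS k A)) = LinearMap.id := by
    refine DirectSum.linearMap_ext k fun q => LinearMap.ext fun b => ?_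
    change mulStar k A (HSof k A q b) (HSof k A 0 (oneHS k A)) = HSof k A q b
    rw [mulStar_comm, mul_zero, pow_zero, one_smul, one_mulStar]
  exact LinearMap.congr_fun this a

end Star
end SymHom

theorem mainTheorem2 (k : Type u) [CommRing k] (A : Type u) [Ring A] [Algebra k A] :
    ∃ e : ∀ n : ℕ, SymHom.HS k A n ≅ (SymHom.NYplus k A).homology n,
      -- `e` is the canonical comparison of `Tor` with the homology of `𝒩𝒴⁺`
      ((∃ (P : ProjectiveResolution ((Functor.const SymHom.DeltaSᵒᵖ).obj (ModuleCat.of k k)))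
          (φ : P.complex ⟶ SymHom.stdComplex k), SymHom.IsAugmented k P φ) ∧
        ∀ (P : ProjectiveResolution ((Functor.const SymHom.DeltaSᵒᵖ).obj (ModuleCat.of k k)))
          (φ : P.complex ⟶ SymHom.stdComplex k), SymHom.IsAugmented k P φ →
          ∀ n : ℕ, (e n).hom = SymHom.comparison k A P φ n) ∧
      ∃ (mul : SymHom.HSStar k A →ₗ[k] SymHom.HSStar k A →ₗ[k] SymHom.HSStar k A)
        (one : SymHom.HS k A 0),
        -- the product is induced by `c ⊗ x ⊗ y ↦ χ̃(c ⊗ x ⊗ y)`, for every choice of `c`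
        (∀ c : (SymHom.Dch k 2).X 0, SymHom.augD k 2 c = 1 →
          ∀ (p q : ℕ) (x : (SymHom.NYplus k A).cycles p) (y : (SymHom.NYplus k A).cycles q),
            ∃ z : (SymHom.NYplus k A).cycles (p + q),
              (SymHom.NYplus k A).iCycles (p + q) z =
                SymHom.chiTilde k A (Nat.zero_add (p + q)) c
                  ((SymHom.NYplus k A).iCycles p x) ((SymHom.NYplus k A).iCycles q y) ∧
              mul (SymHom.HSof k A p (SymHom.cycleClass e p x))
                  (SymHom.HSof k A q (SymHom.cycleClass e q y)) =
                SymHom.HSof k A (p + q) (SymHom.cycleClass e (p + q) z)) ∧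
        -- the product is associative and unital
        (∀ a b c : SymHom.HSStar k A, mul (mul a b) c = mul a (mul b c)) ∧
        (∀ a : SymHom.HSStar k A,
          mul (SymHom.HSof k A 0 one) a = a ∧ mul a (SymHom.HSof k A 0 one) = a) ∧
        -- the product is graded-commutative
        ∀ (p q : ℕ) (a : SymHom.HS k A p) (b : SymHom.HS k A q),
          mul (SymHom.HSof k A p a) (SymHom.HSof k A q b) =
            (-1 : ℤ) ^ (p * q) • mul (SymHom.HSof k A q b) (SymHom.HSof k A p a) := by
  refine ⟨SymHom.comparisonIso k A, ⟨⟨SymHom.stdResolution k SymHom.DeltaS, 𝟙 _,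
    SymHom.stdResolution_isAugmented k⟩, fun P φ h n => (SymHom.comparison_eq k A P φ h n).symm⟩,
    SymHom.mulStar k A, SymHom.oneHS k A, fun c hc p q x y => ?_, SymHom.mulStar_assoc k A,
    fun a => ⟨SymHom.one_mulStar k A a, SymHom.mulStar_one k A a⟩,
    fun p q => SymHom.mulStar_comm k A⟩
  obtain ⟨z, hz, h⟩ := SymHom.exists_cycle_chiTilde k A c hc x y
  refine ⟨z, hz, ?_⟩
  rw [SymHom.mulStar_HSof k A rfl, SymHom.mulHS_apply, SymHom.cycleClass, SymHom.cycleClass,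
    SymHom.comparisonIso_hom_inv, SymHom.comparisonIso_hom_inv, h, SymHom.cycleClass]
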